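/- Let $\Omega\subset\mathbb{R}^2$ be an open regular hexagon of side length $L>0$, with two sides parallel to the first coordinate axis. For $m\ge 1$ divide $\overline\Omega$ into equilateral triangles of side $h=L/m$, let $\mathcal{T}_m$ be the set of these triangles, let $n=3m^2-3m+1$ be the number of internal nodes, and let $\varphi_1,\dots,\varphi_n$ be the continuous piecewise linear nodal basis functions attached to the internal nodes. Let $a\in C^2(\overline\Omega)$ with $a\ge a_0>0$, and let $\mathbf b\in C^1(\overline\Omega;\mathbb{R}^2)$ with $\operatorname{div}\mathbf b\ge 0$ in $\Omega$. Define the $n\times n$ matrices $$(\Theta_n(a))_{i,j}=\int_\Omega a\,\nabla\varphi_j\cdot\nabla\varphi_i,\qquad (\Psi_n(\mathbf b))_{i,j}=-\int_\Omega(\mathbf b\cdot\nabla\varphi_i)\,\varphi_j,$$ $$A_n(a,\mathbf b)=\Theta_n(a)+\Psi_n(\mathbf b),\qquad \mathrm{Re}(A_n(a,\mathbf b))=\tfrac12\big(A_n(a,\mathbf b)+A_n(a,\mathbf b)^H\big),$$ $$P_n(a)=D_n^{1/2}(a)\,A_n(1,0)\,D_n^{1/2}(a),\qquad D_n(a)=\mathrm{diag}(A_n(a,0))\,\mathrm{diag}(A_n(1,0))^{-1}.$$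 A sequence of matrices is called properly clustered at $1$ if, for every $\varepsilon>0$, the number of eigenvalues (with multiplicity) outside the disk of centre $1$ and radius $\varepsilon$ is bounded by a constant independent of $n$. (1) Exact integrals. For every $n$ the matrices $P_n(a)$ and $\mathrm{Re}(A_n(a,\mathbf b))$ are positive definite; the sequence $\{P_n(a)^{-1}\mathrm{Re}(A_n(a,\mathbf b))\}$ is properly clustered at $1$; and there are constants $0<d\le D$, independent of $n$, such that for every $n$ all eigenvalues of $P_n(a)^{-1}\mathrm{Re}(A_n(a,\mathbf b))$ are real and belong to $[d,D]$. (2) Quadrature. For every $m$ and every $K\in\mathcal{T}_m$ let a quadrature formula $\int_K g\approx |K|\sum_k w_k\,g(x_k)$ be given, with points $x_k\in K$ and with $\sum_k|w_k|$ bounded uniformly in $m$ and $K$, whose error is $O(h^2)$: for every $g\in C^2(\overline\Omega)$ there is a constant $C$ such that the error on $K$ is at most $C h^2|K|$ for all $m$ and all $K\in\mathcal{T}_m$. Let $\Theta_n(a)$ and $\Psi_n(\mathbf b)$ be assembled triangle by triangle with these formulas in place of the integrals, and let $\mathrm{Re}(A_n(a,\mathbf b))$ and $P_n(a)$ be defined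 from them as above, the constant coefficient matrix $A_n(1,0)$ being kept exact. Then $P_n(a)$ and $\mathrm{Re}(A_n(a,\mathbf b))$ are positive definite for all sufficiently large $n$; the sequence $\{P_n(a)^{-1}\mathrm{Re}(A_n(a,\mathbf b))\}$ is properly clustered at $1$; and there are constants $0<d\le D$, independent of $n$, such that, for every $n$ for which both matrices are positive definite, all eigenvalues of $P_n(a)^{-1}\mathrm{Re}(A_n(a,\mathbf b))$ are real and belong to $[d,D]$. -/

import Mathlib

open MeasureTheory

noncomputable section

namespace HexFEM

/-! ### The regular hexagon and its meshes of equilateral triangles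

Points of the plane are elements of `ℝ × ℝ`.  The unit vectors `e₁ = (1, 0)` and
`e₂ = (-1/2, √3/2)` (angle 120 degrees) generate the triangular lattice, whose six vectors of
length one are `±e₁`, `±e₂`, `±(e₁ + e₂)`. -/

/-- First coordinate of `x` with respect to the basis `e₁, e₂`. -/
def coordS (x : ℝ × ℝ) : ℝ := x.1 + x.2 / √3

/-- Second coordinate of `x` with respect to the basis `e₁, e₂`. -/
def coordT (x : ℝ × ℝ) : ℝ := 2 * x.2 / √3

/-- The gauge of the regular hexagon with vertices `±e₁`, `±e₂`, `±(e₁ + e₂)`. -/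
def hexGauge (x : ℝ × ℝ) : ℝ :=
  max |coordS x| (max |coordT x| |coordS x - coordT x|)

/-- The open regular hexagon with centre `c` and side length `L`. -/
def hexagon (c : ℝ × ℝ) (L : ℝ) : Set (ℝ × ℝ) := {x | hexGauge (x - c) < L}

/-- The closed regular hexagon with centre `c` and side length `L`. -/
def closedHexagon (c : ℝ × ℝ) (L : ℝ) : Set (ℝ × ℝ) := {x | hexGauge (x - c) ≤ L}

/-- The mesh size when each side of the hexagon is divided into `m` equal parts. -/
def meshSize (L : ℝ) (m : ℕ) : ℝ := L / m

/-- The lattice point `c + h (p₁ e₁ + p₂ e₂)` with `h = L / m`. -/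
def node (c : ℝ × ℝ) (L : ℝ) (m : ℕ) (p : ℤ × ℤ) : ℝ × ℝ :=
  (c.1 + meshSize L m * ((p.1 : ℝ) - (p.2 : ℝ) / 2),
   c.2 + meshSize L m * (√3 / 2 * (p.2 : ℝ)))

/-- The hexagonal gauge in integer lattice coordinates. -/
def hexGaugeInt (p : ℤ × ℤ) : ℤ := max |p.1| (max |p.2| |p.1 - p.2|)

/-- The internal nodes of the mesh with `m` subdivisions per side; there are
`3 m ^ 2 - 3 m + 1` of them when `1 ≤ m`. -/
def innerNodes (m : ℕ) : Finset (ℤ × ℤ) :=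
  (Finset.Icc (-(m : ℤ)) m ×ˢ Finset.Icc (-(m : ℤ)) m).filter fun p => hexGaugeInt p < m

/-- The index type of the unknowns of the mesh with `m` subdivisions per side. -/
abbrev Idx (m : ℕ) : Type := {p : ℤ × ℤ // p ∈ innerNodes m}

/-- A lattice triangle: `(p, true)` stands for the triangle with vertices `p`, `p + e₁`,
`p + e₁ + e₂`, and `(p, false)` for the one with vertices `p`, `p + e₂`, `p + e₁ + e₂`. -/
abbrev Tri : Type := (ℤ × ℤ) × Bool

/-- The three vertices of a lattice triangle, in lattice coordinates. -/
def Tri.vertex (T : Tri) : Fin 3 → ℤ × ℤ :=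
  ![T.1, T.1 + (if T.2 then (1, 0) else (0, 1)), T.1 + (1, 1)]

/-- The triangles of the mesh: all lattice triangles with vertices in the closed hexagon. -/
def triangles (m : ℕ) : Finset Tri :=
  ((Finset.Icc (-(m : ℤ)) m ×ˢ Finset.Icc (-(m : ℤ)) m) ×ˢ Finset.univ).filter
    fun T => ∀ k, hexGaugeInt (T.vertex k) ≤ m

/-- The closed triangle of the plane represented by `T`. -/
def triSet (c : ℝ × ℝ) (L : ℝ) (m : ℕ) (T : Tri) : Set (ℝ × ℝ) :=
  convexHull ℝ (Set.range fun k => node c L m (T.vertex k))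

/-- The barycentre of the triangle represented by `T`. -/
def barycentre (c : ℝ × ℝ) (L : ℝ) (m : ℕ) (T : Tri) : ℝ × ℝ :=
  (1 / 3 : ℝ) • ∑ k, node c L m (T.vertex k)

/-- The area `√3/4 h ^ 2` of an equilateral triangle with side `h = L / m`. -/
def triArea (L : ℝ) (m : ℕ) : ℝ := √3 / 4 * meshSize L m ^ 2

/-! ### The linear finite element basis -/

/-- The nodal basis function of the node `p`: continuous, affine on every lattice triangle, with
value `1` at the node `p` and `0` at all other nodes. -/
def hat (c : ℝ × ℝ) (L : ℝ) (m : ℕ) (p : ℤ × ℤ) (x : ℝ × ℝ) : ℝ :=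
  max 0 (1 - hexGauge ((meshSize L m)⁻¹ • (x - node c L m p)))

/-- The gradient of a scalar function of two variables. -/
def grad (f : ℝ × ℝ → ℝ) (x : ℝ × ℝ) : ℝ × ℝ :=
  (fderiv ℝ f x (1, 0), fderiv ℝ f x (0, 1))

/-- The divergence of a planar vector field. -/
def divergence (b : ℝ × ℝ → ℝ × ℝ) (x : ℝ × ℝ) : ℝ :=
  (fderiv ℝ b x (1, 0)).1 + (fderiv ℝ b x (0, 1)).2

/-- The Euclidean scalar product of the plane. -/
def dot (u v : ℝ × ℝ) : ℝ := u.1 * v.1 + u.2 * v.2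

/-- The constant gradient, on the triangle `T`, of the basis function of the node `p`. -/
def hatGrad (c : ℝ × ℝ) (L : ℝ) (m : ℕ) (p : ℤ × ℤ) (T : Tri) : ℝ × ℝ :=
  grad (hat c L m p) (barycentre c L m T)

/-! ### Matrices with exactly evaluated integrals -/

/-- The diffusion matrix `Θ(a)`, with entries `∫_Ω a ∇φ_j · ∇φ_i`. -/
def diffusionMatrix (c : ℝ × ℝ) (L : ℝ) (a : ℝ × ℝ → ℝ) (m : ℕ) : Matrix (Idx m) (Idx m) ℝ :=
  Matrix.of fun i j => ∫ x in hexagon c L,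
    a x * dot (grad (hat c L m j.1) x) (grad (hat c L m i.1) x)

/-- The convection matrix `Ψ(b)`, with entries `-∫_Ω (b · ∇φ_i) φ_j`. -/
def convectionMatrix (c : ℝ × ℝ) (L : ℝ) (b : ℝ × ℝ → ℝ × ℝ) (m : ℕ) :
    Matrix (Idx m) (Idx m) ℝ :=
  Matrix.of fun i j => -∫ x in hexagon c L,
    dot (b x) (grad (hat c L m i.1) x) * hat c L m j.1 x

/-! ### Matrices with integrals evaluated by quadrature -/

/-- Quadrature formulas on the triangles of all the meshes: the integral of `g` over the
triangle `T` of the `m`-th mesh is replaced by `|T| ∑ k, weight m T k * g (point m T k)`. -/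
structure QuadratureFamily where
  num : ℕ → Tri → ℕ
  weight : ∀ (m : ℕ) (T : Tri), Fin (num m T) → ℝ
  point : ∀ (m : ℕ) (T : Tri), Fin (num m T) → ℝ × ℝ

/-- The value of the quadrature formula for the integral of `g` over `T`. -/
def QuadratureFamily.apply (Q : QuadratureFamily) (L : ℝ) (m : ℕ) (T : Tri)
    (g : ℝ × ℝ → ℝ) : ℝ :=
  triArea L m * ∑ k, Q.weight m T k * g (Q.point m T k)

/-- The quadrature formulas use points of the triangle they refer to, have uniformly bounded
weights, and their error is `O(h ^ 2)`: for every `g` of class `C²` on the closed hexagon, the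
error on a triangle `T` is at most `C h ^ 2 |T|`, with `C` independent of the mesh and of `T`. -/
def QuadratureFamily.HasErrorOrderTwo (Q : QuadratureFamily) (c : ℝ × ℝ) (L : ℝ) : Prop :=
  (∀ m, 1 ≤ m → ∀ T ∈ triangles m, ∀ k, Q.point m T k ∈ triSet c L m T) ∧
  (∃ W : ℝ, ∀ m, 1 ≤ m → ∀ T ∈ triangles m, ∑ k, |Q.weight m T k| ≤ W) ∧
  (∀ g : ℝ × ℝ → ℝ, ContDiffOn ℝ 2 g (closedHexagon c L) →
    ∃ C : ℝ, ∀ m, 1 ≤ m → ∀ T ∈ triangles m,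
      |(∫ x in triSet c L m T, g x) - Q.apply L m T g| ≤ C * meshSize L m ^ 2 * triArea L m)

/-- The diffusion matrix assembled triangle by triangle with the quadrature formulas `Q`. -/
def diffusionMatrixQ (Q : QuadratureFamily) (c : ℝ × ℝ) (L : ℝ) (a : ℝ × ℝ → ℝ) (m : ℕ) :
    Matrix (Idx m) (Idx m) ℝ :=
  Matrix.of fun i j => ∑ T ∈ triangles m, Q.apply L m T fun x =>
    a x * dot (hatGrad c L m j.1 T) (hatGrad c L m i.1 T)

/-- The convection matrix assembled triangle by triangle with the quadrature formulas `Q`. -/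
def convectionMatrixQ (Q : QuadratureFamily) (c : ℝ × ℝ) (L : ℝ) (b : ℝ × ℝ → ℝ × ℝ) (m : ℕ) :
    Matrix (Idx m) (Idx m) ℝ :=
  Matrix.of fun i j => -∑ T ∈ triangles m, Q.apply L m T fun x =>
    dot (b x) (hatGrad c L m i.1 T) * hat c L m j.1 x

/-! ### Hermitian part, preconditioner and spectral notions -/

/-- The Hermitian part `(A + Aᴴ) / 2`. -/
def hermPart {ι : Type*} (A : Matrix ι ι ℝ) : Matrix ι ι ℝ :=
  (1 / 2 : ℝ) • (A + A.conjTranspose)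

/-- The preconditioner `D^{1/2} S D^{1/2}` with `D = diag(Θ) diag(S)⁻¹`. -/
def preconditioner {ι : Type*} [Fintype ι] [DecidableEq ι] (Θ S : Matrix ι ι ℝ) :
    Matrix ι ι ℝ :=
  Matrix.diagonal (fun i => √(Θ i i / S i i)) * S *
    Matrix.diagonal (fun i => √(Θ i i / S i i))

/-- The (complex) eigenvalues of a real square matrix, with algebraic multiplicity. -/
def eigs {ι : Type*} [Fintype ι] [DecidableEq ι] (M : Matrix ι ι ℝ) : Multiset ℂ :=
  (M.map (algebraMap ℝ ℂ)).charpoly.roots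

open Classical in
/-- A sequence of matrices is properly clustered at `p`: for every `ε > 0` the number of
eigenvalues, with multiplicity, outside the open disk of centre `p` and radius `ε` is bounded by
a constant independent of the matrix. -/
def ProperlyClusteredAt {ι : ℕ → Type*} [∀ m, Fintype (ι m)] [∀ m, DecidableEq (ι m)]
    (M : ∀ m, Matrix (ι m) (ι m) ℝ) (p : ℂ) : Prop :=
  ∀ ε : ℝ, 0 < ε → ∃ C : ℕ, ∀ m,
    Multiset.card ((eigs (M m)).filter fun z => z ∉ Metric.ball p ε) ≤ C

/-- All eigenvalues of `M` are real and lie in `[d, D]`. -/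
def EigsIn {ι : Type*} [Fintype ι] [DecidableEq ι] (M : Matrix ι ι ℝ) (d D : ℝ) : Prop :=
  ∀ z ∈ eigs M, ∃ t ∈ Set.Icc d D, z = (t : ℂ)

/-- `P(a) = D^{1/2}(a) A(1,0) D^{1/2}(a)`, all integrals being exact. -/
def precond (c : ℝ × ℝ) (L : ℝ) (a : ℝ × ℝ → ℝ) (m : ℕ) : Matrix (Idx m) (Idx m) ℝ :=
  preconditioner (diffusionMatrix c L a m) (diffusionMatrix c L (fun _ => 1) m)

/-- `Re A(a,b)` with `A(a,b) = Θ(a) + Ψ(b)`, all integrals being exact. -/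
def reA (c : ℝ × ℝ) (L : ℝ) (a : ℝ × ℝ → ℝ) (b : ℝ × ℝ → ℝ × ℝ) (m : ℕ) :
    Matrix (Idx m) (Idx m) ℝ :=
  hermPart (diffusionMatrix c L a m + convectionMatrix c L b m)

/-- `P(a)` when the integrals with the variable coefficient `a` are computed by quadrature;
`A(1,0)` has a constant coefficient and is exact. -/
def precondQ (Q : QuadratureFamily) (c : ℝ × ℝ) (L : ℝ) (a : ℝ × ℝ → ℝ) (m : ℕ) :
    Matrix (Idx m) (Idx m) ℝ :=
  preconditioner (diffusionMatrixQ Q c L a m) (diffusionMatrix c L (fun _ => 1) m)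

/-- `Re A(a,b)` when all integrals are computed by quadrature. -/
def reAQ (Q : QuadratureFamily) (c : ℝ × ℝ) (L : ℝ) (a : ℝ × ℝ → ℝ) (b : ℝ × ℝ → ℝ × ℝ)
    (m : ℕ) : Matrix (Idx m) (Idx m) ℝ :=
  hermPart (diffusionMatrixQ Q c L a m + convectionMatrixQ Q c L b m)

end HexFEM

end

/-!
Everything is read off quadratic forms. For a vector `x` of nodal values with finite element function
`u`, every assembled diffusion matrix has the form `(√3)⁻¹ ∑_T α_T e_T(u)`, where `e_T(u)` is the
`triEnergy` of `u` on the triangle `T` and `α_T` is an exact or approximate mean value of `a`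
(`IsAssembled.form`). The diagonal ratio `Θᵢᵢ / Sᵢᵢ` is an average of the `α_T` around the node `i`,
hence equal to `a` there up to `O(h)`. So `P` has the form `(√3)⁻¹ · energy (g u)` with nodal values
`g = √(Θᵢᵢ / Sᵢᵢ)`, and a discrete product rule with Young's inequality gives, for every `η ∈ (0, 1]`,
`|⟨x, P x⟩ - ⟨x, Θ x⟩| ≤ (C h + η) E(u) + (C / η) h² ∑ xᵢ²`, where `E` is the Dirichlet energy, and
`E(u) ≤ C ⟨x, P x⟩`, once `h` is small (`preconditioner_estimates`). The convection form obeys an estimate of the same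
kind.

Clustering at `1` follows from a discrete Poincaré inequality: on the common kernel of the sums over
`K × K` boxes, `h² ∑ xᵢ² ≤ C K⁻² E(u)` (`sum_sq_le_energy_of_boxSums_eq_zero`). First `η` and then
`K`, both independent of the mesh, are chosen so that `|⟨x, Re A x⟩ - ⟨x, P x⟩| < ε ⟨x, P x⟩` on this
kernel once `h` is small, and the Courant–Fischer argument leaves at most `2 K²` eigenvalues outside
the disk of radius `ε` (`card_eigs_filter_le`). The coarser meshes are finitely many and each
contributes finitely many eigenvalues.

The bounds `[d, D]` need a lower bound of `⟨x, Re A x⟩` by the energy. With exact integrals,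
integration by parts turns the convection form into `1/2 ∫ (div b) u² ≥ 0`
(`convectionMatrix_form_nonneg`). With quadrature it differs from the exact form by `O(h) E(u)`
(`abs_convectionMatrixQ_form_sub_le`): `a` and `b` are Lipschitz, the points lie in their triangles,
the weights are bounded, and testing the formulas on the constant `1` shows that the weights add up
to `1 + O(h²)`; nothing more about the formulas is used. `spectral_conclusions` combines these facts for either assembly procedure.
-/

open MeasureTheory

noncomputable section

namespace HexFEM

/-! ### Generalized eigenvalues of a pair of symmetric matrices -/

open Matrix in
/-- A real symmetric matrix is diagonalized by an orthogonal matrix. -/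
theorem exists_orthogonal_diagonal {ι : Type*} [Fintype ι] [DecidableEq ι] {A : Matrix ι ι ℝ}
    (hA : A.IsHermitian) :
    ∃ U : Matrix ι ι ℝ, Uᵀ * U = 1 ∧ Uᵀ * A * U = diagonal hA.eigenvalues := by
  refine ⟨hA.eigenvectorUnitary, ?_, ?_⟩
  · exact Unitary.coe_star_mul_self hA.eigenvectorUnitary
  · have h := hA.conjStarAlgAut_star_eigenvectorUnitary
    rw [Unitary.conjStarAlgAut_star_apply] at h
    exact h

open Matrix in
/-- A symmetric pair `(P, R)` with `P` positive definite is simultaneously diagonalized by a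
congruence; the diagonal entries are the eigenvalues of `P⁻¹ R`. -/
theorem exists_simultaneous_diagonal {ι : Type*} [Fintype ι] [DecidableEq ι]
    {P R : Matrix ι ι ℝ} (hP : P.PosDef) (hR : R.IsHermitian) :
    ∃ (μ : ι → ℝ) (V : Matrix ι ι ℝ), Vᵀ * P * V = 1 ∧ Vᵀ * R * V = diagonal μ ∧
      eigs (P⁻¹ * R) = (Finset.univ : Finset ι).val.map fun i => (μ i : ℂ) := by
  obtain ⟨U, hU, hUP⟩ := exists_orthogonal_diagonal hP.1
  have hpos := hP.eigenvalues_pos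
  set V₀ : Matrix ι ι ℝ := U * diagonal (fun i => (√(hP.1.eigenvalues i))⁻¹) with hV₀
  have h1 : V₀ᵀ * P * V₀ = 1 := by
    have : V₀ᵀ * P * V₀ = diagonal (fun i => (√(hP.1.eigenvalues i))⁻¹) * (Uᵀ * P * U) *
        diagonal (fun i => (√(hP.1.eigenvalues i))⁻¹) := by
      rw [hV₀, transpose_mul, diagonal_transpose]; simp only [Matrix.mul_assoc]
    rw [this, hUP, diagonal_mul_diagonal, diagonal_mul_diagonal, ← diagonal_one]
    congr 1; ext i
    have := Real.sqrt_pos.2 (hpos i)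
    have h2 := Real.mul_self_sqrt (hpos i).le
    field_simp
    rw [sq, h2]
  have hH : (V₀ᵀ * R * V₀).IsHermitian := by
    have hRt : Rᵀ = R := hR
    change (V₀ᵀ * R * V₀)ᵀ = _
    simp only [transpose_mul, transpose_transpose, hRt, Matrix.mul_assoc]
  obtain ⟨W, hW, hWH⟩ := exists_orthogonal_diagonal hH
  have e1 : (V₀ * W)ᵀ * P * (V₀ * W) = 1 := by
    have : (V₀ * W)ᵀ * P * (V₀ * W) = Wᵀ * (V₀ᵀ * P * V₀) * W := by
      rw [transpose_mul]; simp only [Matrix.mul_assoc]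
    rw [this, h1, Matrix.mul_one, hW]
  have e2 : (V₀ * W)ᵀ * R * (V₀ * W) = diagonal hH.eigenvalues := by
    rw [← hWH, transpose_mul]; simp only [Matrix.mul_assoc]
  refine ⟨hH.eigenvalues, V₀ * W, e1, e2, ?_⟩
  set V := V₀ * W
  have hinv : P⁻¹ = V * Vᵀ := by
    have h3 : (P * V) * Vᵀ = 1 := mul_eq_one_comm.1 (by rw [← Matrix.mul_assoc]; exact e1)
    exact inv_eq_right_inv (by rw [← Matrix.mul_assoc]; exact h3)
  have hchar : (P⁻¹ * R).charpoly = (diagonal hH.eigenvalues).charpoly := by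
    rw [hinv, Matrix.mul_assoc, charpoly_mul_comm, e2]
  unfold eigs
  rw [charpoly_map, hchar, charpoly_diagonal, Polynomial.map_prod]
  simp only [Polynomial.map_sub, Polynomial.map_X, Polynomial.map_C]
  rw [Polynomial.roots_prod]
  · simp
  · simp [Finset.prod_ne_zero_iff, Polynomial.X_sub_C_ne_zero]

open Matrix in
theorem dotProduct_congr_mulVec {ι : Type*} [Fintype ι] (P V : Matrix ι ι ℝ) (z : ι → ℝ) :
    (V *ᵥ z) ⬝ᵥ (P *ᵥ (V *ᵥ z)) = z ⬝ᵥ ((Vᵀ * P * V) *ᵥ z) := by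
  simp only [mulVec_mulVec]
  rw [dotProduct_comm, dotProduct_mulVec, ← mulVec_transpose, mulVec_mulVec, dotProduct_comm]
  simp only [Matrix.mul_assoc]

open Matrix in
/-- Bounds for the Rayleigh quotient of a symmetric pair bound the eigenvalues of `P⁻¹ R`. -/
theorem eigsIn_of_form_bounds {ι : Type*} [Fintype ι] [DecidableEq ι]
    {P R : Matrix ι ι ℝ} (hP : P.PosDef) (hR : R.IsHermitian) {d D : ℝ}
    (hd : ∀ x : ι → ℝ, d * (x ⬝ᵥ (P *ᵥ x)) ≤ x ⬝ᵥ (R *ᵥ x))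
    (hD : ∀ x : ι → ℝ, x ⬝ᵥ (R *ᵥ x) ≤ D * (x ⬝ᵥ (P *ᵥ x))) :
    EigsIn (P⁻¹ * R) d D := by
  obtain ⟨μ, V, h1, h2, h3⟩ := exists_simultaneous_diagonal hP hR
  intro z hz
  rw [h3, Multiset.mem_map] at hz
  obtain ⟨i, -, rfl⟩ := hz
  have hd' := hd (V *ᵥ Pi.single i 1)
  have hD' := hD (V *ᵥ Pi.single i 1)
  rw [dotProduct_congr_mulVec, dotProduct_congr_mulVec, h1, h2] at hd' hD'
  simp at hd' hD'
  exact ⟨μ i, ⟨hd', hD'⟩, rfl⟩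

open Matrix in
theorem exists_eigsIn_of_posDef {ι : Type*} [Fintype ι] [DecidableEq ι]
    {P R : Matrix ι ι ℝ} (hP : P.PosDef) (hR : R.PosDef) :
    ∃ d D : ℝ, 0 < d ∧ EigsIn (P⁻¹ * R) d D := by
  obtain ⟨μ, V, h1, h2, h3⟩ := exists_simultaneous_diagonal hP hR.1
  have hμ : ∀ i, 0 < μ i := by
    intro i
    have hne : V *ᵥ Pi.single i 1 ≠ 0 := by
      intro h0
      have := dotProduct_congr_mulVec P V (Pi.single i 1)
      rw [h0, h1] at this
      simp at this
    have := hR.dotProduct_mulVec_pos hne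
    rw [star_trivial, dotProduct_congr_mulVec, h2] at this
    simpa using this
  obtain ⟨D, hD⟩ := (Set.finite_range μ).bddAbove
  obtain ⟨E, hE⟩ := (Set.finite_range fun i => (μ i)⁻¹).bddAbove
  refine ⟨(max E 1)⁻¹, D, by positivity, ?_⟩
  intro z hz
  rw [h3, Multiset.mem_map] at hz
  obtain ⟨i, -, rfl⟩ := hz
  refine ⟨μ i, ⟨?_, hD ⟨i, rfl⟩⟩, rfl⟩
  exact inv_le_of_inv_le₀ (hμ i) ((hE ⟨i, rfl⟩).trans (le_max_left _ _))

theorem EigsIn.mono {ι : Type*} [Fintype ι] [DecidableEq ι] {M : Matrix ι ι ℝ} {d D d' D' : ℝ}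
    (h : EigsIn M d D) (hd : d' ≤ d) (hD : D ≤ D') : EigsIn M d' D' := fun z hz =>
  let ⟨t, ht, e⟩ := h z hz
  ⟨t, ⟨hd.trans ht.1, ht.2.trans hD⟩, e⟩

/-- More indices than linear constraints leave a nonzero vector supported on those indices which
satisfies the constraints. -/
theorem exists_ne_zero_supported_of_card_lt {ι κ : Type*} [Fintype ι] [DecidableEq ι] [Fintype κ]
    (f : (ι → ℝ) →ₗ[ℝ] (κ → ℝ)) (s : Finset ι) (hs : Fintype.card κ < s.card) :
    ∃ z : ι → ℝ, z ≠ 0 ∧ (∀ i ∉ s, z i = 0) ∧ f z = 0 := by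
  let g : (s → ℝ) →ₗ[ℝ] (ι → ℝ) := LinearMap.pi fun i =>
    if h : i ∈ s then LinearMap.proj (⟨i, h⟩ : s) else 0
  have hker : LinearMap.ker (f ∘ₗ g) ≠ ⊥ := by
    apply LinearMap.ker_ne_bot_of_finrank_lt
    simpa using hs
  obtain ⟨w, hw, hw0⟩ := (Submodule.ne_bot_iff _).1 hker
  refine ⟨g w, ?_, ?_, by simpa using hw⟩
  · obtain ⟨i, hi⟩ := Function.ne_iff.1 hw0
    intro h0
    apply hi
    have := congrFun h0 i.1
    simpa [g] using this
  · intro i hi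
    simp [g, hi]

open Matrix in
/-- Courant–Fischer counting: if `R` is `ε`-close to `P` relative to `P` on the common kernel of
`k` linear functionals, then at most `k` eigenvalues of `P⁻¹ R` exceed `1 + ε` and at most `k`
lie below `1 - ε`. -/
theorem card_eigs_filter_le {ι κ : Type*} [Fintype ι] [DecidableEq ι] [Fintype κ]
    {P R : Matrix ι ι ℝ} (hP : P.PosDef) (hR : R.IsHermitian) {ε : ℝ}
    (f : (ι → ℝ) →ₗ[ℝ] (κ → ℝ))
    (hf : ∀ x : ι → ℝ, f x = 0 → x ≠ 0 →
      |x ⬝ᵥ (R *ᵥ x) - x ⬝ᵥ (P *ᵥ x)| < ε * (x ⬝ᵥ (P *ᵥ x)))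
    (p : ℂ → Prop) [DecidablePred p] (hp : ∀ z, p z → z ∉ Metric.ball (1 : ℂ) ε) :
    Multiset.card ((eigs (P⁻¹ * R)).filter p) ≤ 2 * Fintype.card κ := by
  classical
  obtain ⟨μ, V, h1, h2, h3⟩ := exists_simultaneous_diagonal hP hR
  have hVinj : ∀ z : ι → ℝ, z ≠ 0 → V *ᵥ z ≠ 0 := by
    intro z hz h0
    apply hz
    have : (Vᵀ * P * V) *ᵥ z = 0 := by
      rw [← mulVec_mulVec, h0, mulVec_zero]
    simpa [h1] using this
  have hR' : ∀ z : ι → ℝ, (V *ᵥ z) ⬝ᵥ (R *ᵥ (V *ᵥ z)) = ∑ i, μ i * z i ^ 2 := by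
    intro z
    rw [dotProduct_congr_mulVec, h2]
    simp only [dotProduct, mulVec_diagonal]
    exact Finset.sum_congr rfl fun i _ => by ring
  have hP' : ∀ z : ι → ℝ, (V *ᵥ z) ⬝ᵥ (P *ᵥ (V *ᵥ z)) = ∑ i, z i ^ 2 := by
    intro z
    rw [dotProduct_congr_mulVec, h1]
    simp only [dotProduct, one_mulVec]
    exact Finset.sum_congr rfl fun i _ => by ring
  -- a coordinate subspace on which `R - P` has a definite sign of size `ε` meets the kernel in `0`
  have key : ∀ s : Finset ι, (∀ z : ι → ℝ, (∀ i ∉ s, z i = 0) →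
      ε * ∑ i, z i ^ 2 ≤ |∑ i, μ i * z i ^ 2 - ∑ i, z i ^ 2|) → s.card ≤ Fintype.card κ := by
    intro s hs
    by_contra! hlt
    obtain ⟨z, hz0, hzs, hz⟩ := exists_ne_zero_supported_of_card_lt (f ∘ₗ V.mulVecLin) s hlt
    have := hf (V *ᵥ z) (by simpa using hz) (hVinj z hz0)
    rw [hR', hP'] at this
    exact absurd (hs z hzs) (not_le.2 this)
  have hup : (Finset.univ.filter fun i => 1 + ε ≤ μ i).card ≤ Fintype.card κ := by
    apply key
    intro z hz
    refine le_trans ?_ (le_abs_self _)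
    rw [← Finset.sum_sub_distrib, Finset.mul_sum]
    refine Finset.sum_le_sum fun i _ => ?_
    by_cases hi : 1 + ε ≤ μ i
    · nlinarith [sq_nonneg (z i)]
    · simp [hz i (by simpa using hi)]
  have hdown : (Finset.univ.filter fun i => μ i ≤ 1 - ε).card ≤ Fintype.card κ := by
    apply key
    intro z hz
    refine le_trans ?_ (neg_le_abs _)
    rw [← Finset.sum_sub_distrib, Finset.mul_sum, ← Finset.sum_neg_distrib]
    refine Finset.sum_le_sum fun i _ => ?_
    by_cases hi : μ i ≤ 1 - ε
    · nlinarith [sq_nonneg (z i)]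
    · simp [hz i (by simpa using hi)]
  rw [h3, Multiset.filter_map, Multiset.card_map]
  have hcard : Multiset.card (Multiset.filter (p ∘ fun i => (μ i : ℂ)) (Finset.univ : Finset ι).val)
      = (Finset.univ.filter fun i => p (μ i : ℂ)).card := rfl
  rw [hcard]
  calc (Finset.univ.filter fun i => p (μ i : ℂ)).card
      ≤ ((Finset.univ.filter fun i => 1 + ε ≤ μ i) ∪
          (Finset.univ.filter fun i => μ i ≤ 1 - ε)).card := by
        apply Finset.card_le_card
        intro i hi
        simp only [Finset.mem_filter, Finset.mem_univ, true_and, Finset.mem_union] at hi ⊢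
        have h4 := hp _ hi
        rw [Metric.mem_ball, not_lt, Complex.dist_eq, ← Complex.ofReal_one, ← Complex.ofReal_sub,
          Complex.norm_real, Real.norm_eq_abs, le_abs] at h4
        rcases h4 with h4 | h4
        · left; linarith
        · right; linarith
    _ ≤ _ := Finset.card_union_le _ _
    _ ≤ _ := by omega

theorem card_eigs_le {ι : Type*} [Fintype ι] [DecidableEq ι] (M : Matrix ι ι ℝ)
    (p : ℂ → Prop) [DecidablePred p] :
    Multiset.card ((eigs M).filter p) ≤ Fintype.card ι := by
  refine (Multiset.card_le_card (Multiset.filter_le _ _)).trans ?_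
  refine (Polynomial.card_roots' _).trans ?_
  rw [Matrix.charpoly_natDegree_eq_dim]

/-! ### Lattice functions, their energy and discrete Poincaré inequalities -/

/-- The quadratic form `A² + A B + B²` in the two increments `A`, `B` of the lattice function `u`
along the vertices of `T`; up to the factor `4 / (3 h²)` it is the squared gradient of the affine
interpolant of `u` on `T`. -/
def triEnergy (u : ℤ × ℤ → ℝ) (T : Tri) : ℝ :=
  (u (T.vertex 1) - u (T.vertex 0)) ^ 2 +
    (u (T.vertex 1) - u (T.vertex 0)) * (u (T.vertex 2) - u (T.vertex 1)) +
    (u (T.vertex 2) - u (T.vertex 1)) ^ 2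

/-- The sum of the squared vertex values of a lattice function on a triangle. -/
def triMass (u : ℤ × ℤ → ℝ) (T : Tri) : ℝ := ∑ k, u (T.vertex k) ^ 2

/-- The Dirichlet energy of a lattice function, up to the factor `1 / √3`. -/
def energy (m : ℕ) (u : ℤ × ℤ → ℝ) : ℝ := ∑ T ∈ triangles m, triEnergy u T

/-- Extension by zero of a vector of nodal values to the whole lattice. -/
def zeroExt (m : ℕ) : (Idx m → ℝ) →ₗ[ℝ] (ℤ × ℤ → ℝ) :=
  LinearMap.pi fun p => if h : p ∈ innerNodes m then LinearMap.proj (⟨p, h⟩ : Idx m) else 0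

theorem zeroExt_coe {m : ℕ} (x : Idx m → ℝ) (i : Idx m) : zeroExt m x i.1 = x i := by
  simp [zeroExt]

theorem zeroExt_of_notMem {m : ℕ} (x : Idx m → ℝ) {p : ℤ × ℤ} (hp : p ∉ innerNodes m) :
    zeroExt m x p = 0 := by
  simp [zeroExt, hp]

theorem sum_innerNodes_zeroExt_sq {m : ℕ} (x : Idx m → ℝ) :
    ∑ p ∈ innerNodes m, zeroExt m x p ^ 2 = ∑ i, x i ^ 2 := by
  rw [← Finset.sum_coe_sort]
  exact Finset.sum_congr rfl fun i _ => by rw [zeroExt_coe]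

theorem mem_innerNodes {m : ℕ} {p : ℤ × ℤ} :
    p ∈ innerNodes m ↔ |p.1| < m ∧ |p.2| < m ∧ |p.1 - p.2| < m := by
  simp only [innerNodes, hexGaugeInt, Finset.mem_filter, Finset.mem_product, Finset.mem_Icc,
    max_lt_iff, and_iff_right_iff_imp]
  intro ⟨h1, h2, h3⟩
  rw [abs_lt] at h1 h2
  omega

theorem mem_triangles {m : ℕ} {T : Tri} :
    T ∈ triangles m ↔ ∀ k, |(T.vertex k).1| ≤ m ∧ |(T.vertex k).2| ≤ m ∧
      |(T.vertex k).1 - (T.vertex k).2| ≤ m := by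
  simp only [triangles, hexGaugeInt, Finset.mem_filter, Finset.mem_product, Finset.mem_Icc,
    max_le_iff, Finset.mem_univ, and_true, and_iff_right_iff_imp]
  intro h
  have := h 0
  simp only [Tri.vertex, Matrix.cons_val_zero, abs_le] at this
  omega

/-- Every lattice triangle which has an internal node as a vertex belongs to the mesh. -/
theorem mem_triangles_of_vertex_mem {m : ℕ} {T : Tri} {k : Fin 3}
    (h : T.vertex k ∈ innerNodes m) : T ∈ triangles m := by
  obtain ⟨⟨p, q⟩, b⟩ := T
  rw [mem_innerNodes] at h
  rw [mem_triangles]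
  intro l
  cases b <;> fin_cases k <;> fin_cases l <;>
    simp [Tri.vertex, abs_lt, abs_le] at h ⊢ <;> omega

theorem triEnergy_nonneg (u : ℤ × ℤ → ℝ) (T : Tri) : 0 ≤ triEnergy u T := by
  unfold triEnergy
  nlinarith [sq_nonneg ((u (T.vertex 1) - u (T.vertex 0)) + (u (T.vertex 2) - u (T.vertex 1))),
    sq_nonneg (u (T.vertex 1) - u (T.vertex 0)), sq_nonneg (u (T.vertex 2) - u (T.vertex 1))]

theorem triMass_nonneg (u : ℤ × ℤ → ℝ) (T : Tri) : 0 ≤ triMass u T :=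
  Finset.sum_nonneg fun _ _ => sq_nonneg _

theorem energy_nonneg (m : ℕ) (u : ℤ × ℤ → ℝ) : 0 ≤ energy m u :=
  Finset.sum_nonneg fun _ _ => triEnergy_nonneg _ _

theorem sq_le_two_mul_triEnergy (u : ℤ × ℤ → ℝ) (T : Tri) :
    (u (T.vertex 1) - u (T.vertex 0)) ^ 2 ≤ 2 * triEnergy u T := by
  unfold triEnergy
  nlinarith [sq_nonneg ((u (T.vertex 1) - u (T.vertex 0)) + (u (T.vertex 2) - u (T.vertex 1))),
    sq_nonneg (u (T.vertex 1) - u (T.vertex 0)), sq_nonneg (u (T.vertex 2) - u (T.vertex 1))]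

theorem vertex_injective (b : Bool) (k : Fin 3) :
    Function.Injective fun p : ℤ × ℤ => Tri.vertex (p, b) k := by
  intro p q h
  cases b <;> fin_cases k <;> simpa [Tri.vertex] using h

/-- Each node is a vertex of at most six triangles. -/
theorem sum_triMass_le {m : ℕ} {u : ℤ × ℤ → ℝ} (hu : ∀ p ∉ innerNodes m, u p = 0) :
    ∑ T ∈ triangles m, triMass u T ≤ 6 * ∑ p ∈ innerNodes m, u p ^ 2 := by
  classical
  have hsub : triangles m ⊆ ((triangles m).image Prod.fst) ×ˢ (Finset.univ : Finset Bool) := by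
    intro T hT
    simp only [Finset.mem_product, Finset.mem_univ, and_true]
    exact Finset.mem_image_of_mem _ hT
  refine (Finset.sum_le_sum_of_subset_of_nonneg hsub fun _ _ _ => triMass_nonneg _ _).trans ?_
  rw [Finset.sum_product]
  simp only [triMass]
  rw [Finset.sum_comm]
  have h1 : ∀ b : Bool, ∀ k : Fin 3,
      ∑ p ∈ (triangles m).image Prod.fst, u (Tri.vertex (p, b) k) ^ 2
        ≤ ∑ p ∈ innerNodes m, u p ^ 2 := by
    intro b k
    rw [← Finset.sum_image (f := fun q => u q ^ 2) (fun p _ q _ h => vertex_injective b k h)]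
    rw [← Finset.sum_filter_add_sum_filter_not _ (fun q => q ∈ innerNodes m)]
    rw [Finset.sum_eq_zero (s := Finset.filter (fun q => q ∉ innerNodes m) _), add_zero]
    · exact Finset.sum_le_sum_of_subset_of_nonneg
        (fun q hq => (Finset.mem_filter.1 hq).2) fun _ _ _ => sq_nonneg _
    · intro q hq
      rw [hu q (Finset.mem_filter.1 hq).2]; simp
  calc _ = ∑ b : Bool, ∑ k : Fin 3,
        ∑ p ∈ (triangles m).image Prod.fst, u (Tri.vertex (p, b) k) ^ 2 :=
        Finset.sum_congr rfl fun b _ => Finset.sum_comm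
    _ ≤ ∑ b : Bool, ∑ k : Fin 3, ∑ p ∈ innerNodes m, u p ^ 2 :=
        Finset.sum_le_sum fun b _ => Finset.sum_le_sum fun k _ => h1 b k
    _ = _ := by simp; ring

/-- The increments of a lattice function along the two basis directions are controlled by its
energy. -/
theorem sum_edges_le {m : ℕ} {u : ℤ × ℤ → ℝ} (hu : ∀ p ∉ innerNodes m, u p = 0)
    (F : Finset (ℤ × ℤ)) :
    ∑ p ∈ F, (u (p + (1, 0)) - u p) ^ 2 + ∑ p ∈ F, (u (p + (0, 1)) - u p) ^ 2
      ≤ 2 * energy m u := by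
  classical
  have h1 : ∑ p ∈ F, (u (p + (1, 0)) - u p) ^ 2 + ∑ p ∈ F, (u (p + (0, 1)) - u p) ^ 2
      = ∑ T ∈ F ×ˢ (Finset.univ : Finset Bool), (u (Tri.vertex T 1) - u (Tri.vertex T 0)) ^ 2 := by
    rw [Finset.sum_product, ← Finset.sum_add_distrib]
    exact Finset.sum_congr rfl fun p _ => by simp [Tri.vertex]
  rw [h1, ← Finset.sum_filter_add_sum_filter_not _ (fun T => T ∈ triangles m)]
  rw [Finset.sum_eq_zero (s := Finset.filter (fun q => q ∉ triangles m) _), add_zero]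
  · rw [energy, Finset.mul_sum]
    refine (Finset.sum_le_sum fun T _ => sq_le_two_mul_triEnergy u T).trans ?_
    exact Finset.sum_le_sum_of_subset_of_nonneg (fun q hq => (Finset.mem_filter.1 hq).2)
      fun T _ _ => mul_nonneg zero_le_two (triEnergy_nonneg _ _)
  · intro T hT
    have hT' := (Finset.mem_filter.1 hT).2
    have h2 : ∀ k, u (T.vertex k) = 0 := fun k => hu _ fun hk => hT' (mem_triangles_of_vertex_mem hk)
    simp [h2]

theorem sq_sub_le_sum_increments (f : ℕ → ℝ) {N i j : ℕ} (hi : i ≤ N) (hj : j ≤ N) :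
    (f i - f j) ^ 2 ≤ N * ∑ k ∈ Finset.range N, (f (k + 1) - f k) ^ 2 := by
  wlog hij : i ≤ j generalizing i j
  · rw [show (f i - f j) ^ 2 = (f j - f i) ^ 2 by ring]
    exact this hj hi (le_of_not_ge hij)
  have h1 : f j - f i = ∑ k ∈ Finset.Ico i j, (f (k + 1) - f k) := by
    rw [Finset.sum_Ico_eq_sub _ hij, Finset.sum_range_sub, Finset.sum_range_sub]; ring
  have h2 : (∑ k ∈ Finset.Ico i j, (f (k + 1) - f k)) ^ 2
      ≤ (Finset.Ico i j).card * ∑ k ∈ Finset.Ico i j, (f (k + 1) - f k) ^ 2 :=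
    sq_sum_le_card_mul_sum_sq
  have h3 : ∑ k ∈ Finset.Ico i j, (f (k + 1) - f k) ^ 2
      ≤ ∑ k ∈ Finset.range N, (f (k + 1) - f k) ^ 2 := by
    apply Finset.sum_le_sum_of_subset_of_nonneg
    · intro k hk
      simp only [Finset.mem_Ico, Finset.mem_range] at hk ⊢
      omega
    · exact fun _ _ _ => sq_nonneg _
  have h4 : ((Finset.Ico i j).card : ℝ) ≤ N := by
    rw [Nat.card_Ico]; exact_mod_cast (Nat.sub_le _ _).trans hj
  rw [show (f i - f j) ^ 2 = (f j - f i) ^ 2 by ring, h1]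
  refine h2.trans (mul_le_mul h4 h3 (Finset.sum_nonneg fun _ _ => sq_nonneg _) (Nat.cast_nonneg _))

/-- Poincaré inequality on a square grid for functions of mean zero. -/
theorem grid_poincare (U : ℕ → ℕ → ℝ) (N : ℕ)
    (h0 : ∑ i ∈ Finset.range N, ∑ j ∈ Finset.range N, U i j = 0) :
    ∑ i ∈ Finset.range N, ∑ j ∈ Finset.range N, U i j ^ 2 ≤
      2 * N ^ 2 * (∑ i ∈ Finset.range N, ∑ j ∈ Finset.range N, (U (i + 1) j - U i j) ^ 2 +
        ∑ i ∈ Finset.range N, ∑ j ∈ Finset.range N, (U i (j + 1) - U i j) ^ 2) := by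
  rcases Nat.eq_zero_or_pos N with rfl | hN
  · simp
  have hN' : (0 : ℝ) < N := by exact_mod_cast hN
  set R : ℕ → ℝ := fun j => ∑ i ∈ Finset.range N, (U (i + 1) j - U i j) ^ 2 with hR
  set S : ℕ → ℝ := fun i => ∑ j ∈ Finset.range N, (U i (j + 1) - U i j) ^ 2 with hS
  have hRsum : ∑ i ∈ Finset.range N, ∑ j ∈ Finset.range N, (U (i + 1) j - U i j) ^ 2
      = ∑ j ∈ Finset.range N, R j := Finset.sum_comm
  rw [hRsum]
  set ER := ∑ j ∈ Finset.range N, R j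
  set ES := ∑ i ∈ Finset.range N, S i
  change _ ≤ 2 * (N : ℝ) ^ 2 * (ER + ES)
  have hpt : ∀ i ∈ Finset.range N, ∀ j ∈ Finset.range N,
      (N : ℝ) ^ 2 * U i j ^ 2 ≤ 2 * N * (N ^ 2 * R j + N * ES) := by
    intro i hi j hj
    have hi' := (Finset.mem_range.1 hi).le
    have hj' := (Finset.mem_range.1 hj).le
    have e1 : (N : ℝ) ^ 2 * U i j
        = ∑ q ∈ Finset.range N ×ˢ Finset.range N, (U i j - U q.1 q.2) := by
      rw [Finset.sum_sub_distrib, Finset.sum_product, Finset.sum_product, h0]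
      simp; ring
    have e2 : ((N : ℝ) ^ 2 * U i j) ^ 2
        ≤ N ^ 2 * ∑ q ∈ Finset.range N ×ˢ Finset.range N, (U i j - U q.1 q.2) ^ 2 := by
      rw [e1]
      refine sq_sum_le_card_mul_sum_sq.trans (le_of_eq ?_)
      simp [sq]
    have e3 : ∑ q ∈ Finset.range N ×ˢ Finset.range N, (U i j - U q.1 q.2) ^ 2
        ≤ ∑ q ∈ Finset.range N ×ˢ Finset.range N, (2 * (N * R j) + 2 * (N * S q.1)) := by
      apply Finset.sum_le_sum
      intro q hq
      rw [Finset.mem_product, Finset.mem_range, Finset.mem_range] at hq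
      have a1 := sq_sub_le_sum_increments (fun k => U k j) hi' hq.1.le
      have a2 := sq_sub_le_sum_increments (fun k => U q.1 k) hj' hq.2.le
      change _ ≤ (N : ℝ) * R j at a1
      change _ ≤ (N : ℝ) * S q.1 at a2
      nlinarith [sq_nonneg ((U i j - U q.1 j) - (U q.1 j - U q.1 q.2))]
    have e4 : ∑ q ∈ Finset.range N ×ˢ Finset.range N, (2 * (N * R j) + 2 * (N * S q.1))
        = 2 * N * (N ^ 2 * R j + N * ES) := by
      rw [Finset.sum_product]
      simp only [Finset.sum_const, Finset.card_range, nsmul_eq_mul, ← Finset.mul_sum,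
        Finset.sum_add_distrib]
      simp only [ES]
      ring
    have e5 : (N : ℝ) ^ 2 * ((N : ℝ) ^ 2 * U i j ^ 2)
        ≤ (N : ℝ) ^ 2 * (2 * N * (N ^ 2 * R j + N * ES)) := by
      rw [← e4]
      calc _ = ((N : ℝ) ^ 2 * U i j) ^ 2 := by ring
        _ ≤ _ := e2.trans (mul_le_mul_of_nonneg_left e3 (by positivity))
    exact le_of_mul_le_mul_left e5 (by positivity)
  have hsum := Finset.sum_le_sum fun i hi => Finset.sum_le_sum fun j hj => hpt i hi j hj
  have hr : ∑ i ∈ Finset.range N, ∑ j ∈ Finset.range N, 2 * (N : ℝ) * (N ^ 2 * R j + N * ES)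
      = (N : ℝ) ^ 2 * (2 * N ^ 2 * (ER + ES)) := by
    simp only [← Finset.mul_sum, Finset.sum_add_distrib, Finset.sum_const, Finset.card_range,
      nsmul_eq_mul]
    simp only [ER]
    ring
  rw [hr] at hsum
  simp only [← Finset.mul_sum] at hsum
  exact le_of_mul_le_mul_left hsum (by positivity)

/-- Poincaré inequality for lattice functions vanishing outside the internal nodes. -/
theorem sum_sq_le_energy {m : ℕ} {u : ℤ × ℤ → ℝ} (hu : ∀ p ∉ innerNodes m, u p = 0) :
    ∑ p ∈ innerNodes m, u p ^ 2 ≤ 8 * (m : ℝ) ^ 2 * energy m u := by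
  classical
  set N := 2 * m with hN
  let g : ℕ × ℕ → ℤ × ℤ := fun q => (-(m : ℤ) + q.1, -(m : ℤ) + q.2)
  have hg : Function.Injective g := by
    rintro ⟨a, b⟩ ⟨a', b'⟩ h
    simp only [g, Prod.mk.injEq] at h ⊢
    omega
  have hsub : innerNodes m ⊆ (Finset.range N ×ˢ Finset.range N).image g := by
    intro p hp
    rw [mem_innerNodes, abs_lt, abs_lt] at hp
    rw [Finset.mem_image]
    refine ⟨((p.1 + m).toNat, (p.2 + m).toNat), ?_, ?_⟩
    · simp only [Finset.mem_product, Finset.mem_range]; omega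
    · ext <;> simp only [g] <;> omega
  have hpt : ∀ q ∈ Finset.range N ×ˢ Finset.range N, u (g q) ^ 2 ≤
      N * ∑ k ∈ Finset.range N, (u (g (k, q.2) + (1, 0)) - u (g (k, q.2))) ^ 2 := by
    intro q hq
    rw [Finset.mem_product, Finset.mem_range, Finset.mem_range] at hq
    have h := sq_sub_le_sum_increments (fun k => u (g (k, q.2))) hq.1.le (Nat.zero_le N)
    have h0 : u (g (0, q.2)) = 0 := by
      apply hu
      rw [mem_innerNodes, abs_lt]
      simp [g]
    have h1 : ∀ k, g (k + 1, q.2) = g (k, q.2) + (1, 0) := by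
      intro k; simp [g]; ring
    simp only [h0, sub_zero, h1] at h
    exact h
  have hedge := sum_edges_le hu ((Finset.range N ×ˢ Finset.range N).image g)
  have hedge' : ∑ k ∈ Finset.range N, ∑ j ∈ Finset.range N,
      (u (g (k, j) + (1, 0)) - u (g (k, j))) ^ 2 ≤ 2 * energy m u := by
    rw [Finset.sum_image fun a _ b _ h => hg h, Finset.sum_product] at hedge
    have : 0 ≤ ∑ p ∈ (Finset.range N ×ˢ Finset.range N).image g, (u (p + (0, 1)) - u p) ^ 2 :=
      Finset.sum_nonneg fun _ _ => sq_nonneg _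
    linarith
  calc ∑ p ∈ innerNodes m, u p ^ 2
      ≤ ∑ p ∈ (Finset.range N ×ˢ Finset.range N).image g, u p ^ 2 :=
        Finset.sum_le_sum_of_subset_of_nonneg hsub fun _ _ _ => sq_nonneg _
    _ = ∑ q ∈ Finset.range N ×ˢ Finset.range N, u (g q) ^ 2 :=
        Finset.sum_image fun a _ b _ h => hg h
    _ ≤ ∑ q ∈ Finset.range N ×ˢ Finset.range N,
          N * ∑ k ∈ Finset.range N, (u (g (k, q.2) + (1, 0)) - u (g (k, q.2))) ^ 2 :=
        Finset.sum_le_sum hpt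
    _ = N ^ 2 * ∑ k ∈ Finset.range N, ∑ j ∈ Finset.range N,
          (u (g (k, j) + (1, 0)) - u (g (k, j))) ^ 2 := by
        rw [Finset.sum_product]
        simp only [Finset.sum_const, Finset.card_range, nsmul_eq_mul, ← Finset.mul_sum]
        rw [Finset.sum_comm]
        ring
    _ ≤ N ^ 2 * (2 * energy m u) := mul_le_mul_of_nonneg_left hedge' (by positivity)
    _ = _ := by rw [hN]; push_cast; ring

/-- The lattice point number `(i, j)` of the box number `(k, l)`, when the square
`[-m, m] × [-m, m]` is covered by boxes with `N` points per side. -/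
def boxPoint (m N : ℕ) (k l i j : ℕ) : ℤ × ℤ :=
  (-(m : ℤ) + (k * N + i : ℕ), -(m : ℤ) + (l * N + j : ℕ))

/-- The sums of a lattice function over the boxes of a `K × K` partition into boxes of side `N`. -/
def boxSums (m N K : ℕ) : (Idx m → ℝ) →ₗ[ℝ] (Fin K × Fin K → ℝ) :=
  LinearMap.pi fun q => ∑ i ∈ Finset.range N, ∑ j ∈ Finset.range N,
    LinearMap.proj (boxPoint m N q.1 q.2 i j) ∘ₗ zeroExt m

theorem boxSums_apply (m N K : ℕ) (x : Idx m → ℝ) (q : Fin K × Fin K) :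
    boxSums m N K x q = ∑ i ∈ Finset.range N, ∑ j ∈ Finset.range N,
      zeroExt m x (boxPoint m N q.1 q.2 i j) := by
  simp [boxSums, LinearMap.sum_apply]

/-- On the common kernel of the `K²` box sums, the constant in the Poincaré inequality improves
by the factor `K⁻²`; this is what confines outlying eigenvalues to a bounded number. -/
theorem sum_sq_le_energy_of_boxSums_eq_zero {m K : ℕ} (hK : 1 ≤ K) (hKm : K ≤ m)
    (x : Idx m → ℝ) (hx : boxSums m (2 * m / K + 1) K x = 0) :
    ∑ i, x i ^ 2 ≤ 36 * (m / K : ℝ) ^ 2 * energy m (zeroExt m x) := by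
  classical
  set N := 2 * m / K + 1 with hN
  set u := zeroExt m x with hu'
  have hu : ∀ p ∉ innerNodes m, u p = 0 := fun p hp => zeroExt_of_notMem x hp
  have hNpos : 0 < N := Nat.succ_pos _
  set F := (Finset.range K ×ˢ Finset.range K) ×ˢ (Finset.range N ×ˢ Finset.range N) with hF
  let g : (ℕ × ℕ) × (ℕ × ℕ) → ℤ × ℤ := fun r => boxPoint m N r.1.1 r.1.2 r.2.1 r.2.2
  have hdm : ∀ k i k' i' : ℕ, i < N → i' < N → k * N + i = k' * N + i' → k = k' ∧ i = i' := by
    intro k i k' i' hi hi' h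
    have h1 : (k * N + i) / N = k := by
      rw [mul_comm, Nat.mul_add_div hNpos, Nat.div_eq_of_lt hi, add_zero]
    have h2 : (k' * N + i') / N = k' := by
      rw [mul_comm, Nat.mul_add_div hNpos, Nat.div_eq_of_lt hi', add_zero]
    have h3 : k = k' := by rw [← h1, ← h2, h]
    subst h3
    exact ⟨rfl, by omega⟩
  have hg : Set.InjOn g F := by
    rintro ⟨⟨k, l⟩, ⟨i, j⟩⟩ hr ⟨⟨k', l'⟩, ⟨i', j'⟩⟩ hr' h
    simp only [hF, Finset.coe_product, Finset.coe_range, Set.mem_prod, Set.mem_Iio] at hr hr'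
    simp only [g, boxPoint, Prod.mk.injEq] at h
    obtain ⟨a1, a2⟩ := hdm k i k' i' hr.2.1 hr'.2.1 (by omega)
    obtain ⟨b1, b2⟩ := hdm l j l' j' hr.2.2 hr'.2.2 (by omega)
    simp [a1, a2, b1, b2]
  have hKN : 2 * m < K * N := by
    have := Nat.div_add_mod (2 * m) K
    have h2 := Nat.mod_lt (2 * m) (show 0 < K by omega)
    rw [hN, mul_add, mul_one]
    omega
  have hsub : innerNodes m ⊆ F.image g := by
    intro p hp
    rw [mem_innerNodes, abs_lt, abs_lt] at hp
    rw [Finset.mem_image]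
    have hlt : ∀ s : ℕ, s ≤ 2 * m → s / N < K ∧ s % N < N := fun s hs =>
      ⟨(Nat.div_lt_iff_lt_mul hNpos).2 (by omega), Nat.mod_lt _ hNpos⟩
    have h1 := hlt (p.1 + m).toNat (by omega)
    have h2 := hlt (p.2 + m).toNat (by omega)
    refine ⟨(((p.1 + m).toNat / N, (p.2 + m).toNat / N),
      ((p.1 + m).toNat % N, (p.2 + m).toNat % N)), ?_, ?_⟩
    · simp only [hF, Finset.mem_product, Finset.mem_range]
      exact ⟨⟨h1.1, h2.1⟩, h1.2, h2.2⟩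
    · have e1 := Nat.div_add_mod (p.1 + m).toNat N
      have e2 := Nat.div_add_mod (p.2 + m).toNat N
      ext <;> simp only [g, boxPoint]
      · rw [mul_comm, e1]; omega
      · rw [mul_comm, e2]; omega
  have hedge := sum_edges_le hu (F.image g)
  rw [Finset.sum_image hg, Finset.sum_image hg] at hedge
  have hbox : ∀ q ∈ Finset.range K ×ˢ Finset.range K,
      ∑ r ∈ Finset.range N ×ˢ Finset.range N, u (g (q, r)) ^ 2 ≤
      2 * N ^ 2 * (∑ r ∈ Finset.range N ×ˢ Finset.range N,
          (u (g (q, r) + (1, 0)) - u (g (q, r))) ^ 2 +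
        ∑ r ∈ Finset.range N ×ˢ Finset.range N,
          (u (g (q, r) + (0, 1)) - u (g (q, r))) ^ 2) := by
    intro q hq
    rw [Finset.mem_product, Finset.mem_range, Finset.mem_range] at hq
    have h0 := congrFun hx (⟨q.1, hq.1⟩, ⟨q.2, hq.2⟩)
    rw [boxSums_apply] at h0
    have h := grid_poincare (fun i j => u (g (q, (i, j)))) N h0
    have s1 : ∀ i j, g (q, (i + 1, j)) = g (q, (i, j)) + (1, 0) := by
      intro i j; simp [g, boxPoint]; ring
    have s2 : ∀ i j, g (q, (i, j + 1)) = g (q, (i, j)) + (0, 1) := by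
      intro i j; simp [g, boxPoint]; ring
    simp only [s1, s2] at h
    rw [Finset.sum_product, Finset.sum_product, Finset.sum_product]
    exact h
  have hNr : (N : ℝ) ≤ 3 * (m / K : ℝ) := by
    have hK' : (0 : ℝ) < K := by exact_mod_cast hK
    have h1 : ((2 * m / K : ℕ) : ℝ) ≤ ((2 * m : ℕ) : ℝ) / K := Nat.cast_div_le
    have h2 : (1 : ℝ) ≤ m / K := by
      rw [le_div_iff₀ hK', one_mul]; exact_mod_cast hKm
    rw [hN]; push_cast at h1 ⊢
    rw [mul_div_assoc] at h1
    linarith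
  calc ∑ i, x i ^ 2 = ∑ p ∈ innerNodes m, u p ^ 2 := (sum_innerNodes_zeroExt_sq x).symm
    _ ≤ ∑ p ∈ F.image g, u p ^ 2 :=
        Finset.sum_le_sum_of_subset_of_nonneg hsub fun _ _ _ => sq_nonneg _
    _ = ∑ q ∈ Finset.range K ×ˢ Finset.range K,
          ∑ r ∈ Finset.range N ×ˢ Finset.range N, u (g (q, r)) ^ 2 := by
        rw [Finset.sum_image hg, hF, Finset.sum_product]
    _ ≤ _ := Finset.sum_le_sum hbox
    _ = 2 * N ^ 2 * (∑ r ∈ F, (u (g r + (1, 0)) - u (g r)) ^ 2 +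
          ∑ r ∈ F, (u (g r + (0, 1)) - u (g r)) ^ 2) := by
        rw [← Finset.mul_sum, Finset.sum_add_distrib, hF,
          Finset.sum_product (Finset.range K ×ˢ Finset.range K),
          Finset.sum_product (Finset.range K ×ˢ Finset.range K)]
    _ ≤ 2 * N ^ 2 * (2 * energy m u) := mul_le_mul_of_nonneg_left hedge (by positivity)
    _ ≤ 2 * (3 * (m / K : ℝ)) ^ 2 * (2 * energy m u) := by
        have := energy_nonneg m u
        gcongr
    _ = _ := by ring

/-! ### Barycentric coordinates and the basis functions on a triangle -/

/-- First lattice coordinate of a point, for the mesh with `m` subdivisions per side. -/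
def latS (c : ℝ × ℝ) (L : ℝ) (m : ℕ) (x : ℝ × ℝ) : ℝ := (meshSize L m)⁻¹ * coordS (x - c)

/-- Second lattice coordinate of a point, for the mesh with `m` subdivisions per side. -/
def latT (c : ℝ × ℝ) (L : ℝ) (m : ℕ) (x : ℝ × ℝ) : ℝ := (meshSize L m)⁻¹ * coordT (x - c)

/-- The barycentric coordinates of a point with respect to the triangle `T`. -/
def bary (c : ℝ × ℝ) (L : ℝ) (m : ℕ) (T : Tri) (x : ℝ × ℝ) : Fin 3 → ℝ :=
  if T.2 then
    ![1 - (latS c L m x - T.1.1), (latS c L m x - T.1.1) - (latT c L m x - T.1.2),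
      latT c L m x - T.1.2]
  else
    ![1 - (latT c L m x - T.1.2), (latT c L m x - T.1.2) - (latS c L m x - T.1.1),
      latS c L m x - T.1.1]

/-- The gradients of the barycentric coordinates of `T`. -/
def baryGrad (L : ℝ) (m : ℕ) (T : Tri) : Fin 3 → ℝ × ℝ :=
  if T.2 then
    ![(meshSize L m)⁻¹ • (-1, -(√3)⁻¹), (meshSize L m)⁻¹ • (1, -(√3)⁻¹),
      (meshSize L m)⁻¹ • (0, 2 * (√3)⁻¹)]
  else
    ![(meshSize L m)⁻¹ • (0, -2 * (√3)⁻¹), (meshSize L m)⁻¹ • (-1, (√3)⁻¹),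
      (meshSize L m)⁻¹ • (1, (√3)⁻¹)]

/-- The gradient on `T` of the piecewise linear interpolant of the lattice function `u`. -/
def interpGrad (L : ℝ) (m : ℕ) (u : ℤ × ℤ → ℝ) (T : Tri) : ℝ × ℝ :=
  ∑ k, u (T.vertex k) • baryGrad L m T k

/-- The open triangle represented by `T`. -/
def openTri (c : ℝ × ℝ) (L : ℝ) (m : ℕ) (T : Tri) : Set (ℝ × ℝ) := {x | ∀ k, 0 < bary c L m T x k}

theorem meshSize_pos {L : ℝ} (hL : 0 < L) {m : ℕ} (hm : 1 ≤ m) : 0 < meshSize L m :=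
  div_pos hL (by exact_mod_cast hm)

theorem bary_add_sub (c : ℝ × ℝ) (L : ℝ) (m : ℕ) (T : Tri) (x y : ℝ × ℝ) (k : Fin 3) :
    bary c L m T y k = bary c L m T x k + dot (baryGrad L m T k) (y - x) := by
  obtain ⟨p, b⟩ := T
  cases b <;> fin_cases k <;>
    simp [bary, baryGrad, dot, latS, latT, coordS, coordT] <;> ring

theorem hasFDerivAt_bary (c : ℝ × ℝ) (L : ℝ) (m : ℕ) (T : Tri) (x : ℝ × ℝ) (k : Fin 3) :
    HasFDerivAt (fun y => bary c L m T y k)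
      ((baryGrad L m T k).1 • ContinuousLinearMap.fst ℝ ℝ ℝ +
        (baryGrad L m T k).2 • ContinuousLinearMap.snd ℝ ℝ ℝ) x := by
  have h : (fun y => bary c L m T y k) = fun y =>
      ((baryGrad L m T k).1 • ContinuousLinearMap.fst ℝ ℝ ℝ +
        (baryGrad L m T k).2 • ContinuousLinearMap.snd ℝ ℝ ℝ) y + bary c L m T 0 k := by
    ext y
    rw [bary_add_sub c L m T 0 y k]
    simp [dot]; ring
  rw [h]
  exact (ContinuousLinearMap.hasFDerivAt _).add_const _

theorem continuous_bary (c : ℝ × ℝ) (L : ℝ) (m : ℕ) (T : Tri) (k : Fin 3) :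
    Continuous fun y => bary c L m T y k :=
  continuous_iff_continuousAt.2 fun x => (hasFDerivAt_bary c L m T x k).continuousAt

theorem sum_bary (c : ℝ × ℝ) (L : ℝ) (m : ℕ) (T : Tri) (x : ℝ × ℝ) :
    ∑ k, bary c L m T x k = 1 := by
  obtain ⟨p, b⟩ := T
  cases b <;> simp [bary, Fin.sum_univ_three]

theorem isOpen_openTri (c : ℝ × ℝ) (L : ℝ) (m : ℕ) (T : Tri) : IsOpen (openTri c L m T) := by
  simp only [openTri, Set.ofPred_forall]
  exact isOpen_iInter_of_finite fun k => isOpen_lt continuous_const (continuous_bary c L m T k)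

theorem hexGauge_smul_sub_node {L : ℝ} (hL : 0 < L) {m : ℕ} (hm : 1 ≤ m) (c : ℝ × ℝ)
    (p : ℤ × ℤ) (x : ℝ × ℝ) :
    hexGauge ((meshSize L m)⁻¹ • (x - node c L m p)) =
      max |latS c L m x - p.1| (max |latT c L m x - p.2|
        |(latS c L m x - p.1) - (latT c L m x - p.2)|) := by
  have hh := meshSize_pos hL hm
  have h3 : (0 : ℝ) < √3 := by positivity
  have h1 : coordS ((meshSize L m)⁻¹ • (x - node c L m p)) = latS c L m x - p.1 := by
    simp only [coordS, latS, node, Prod.smul_fst, Prod.smul_snd, Prod.fst_sub, Prod.snd_sub,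
      smul_eq_mul]
    field_simp
    ring
  have h2 : coordT ((meshSize L m)⁻¹ • (x - node c L m p)) = latT c L m x - p.2 := by
    simp only [coordT, latT, node, Prod.smul_snd, Prod.snd_sub, smul_eq_mul]
    field_simp
    ring
  rw [hexGauge, h1, h2]

/-- The basis functions on the triangle `0 ≤ τ ≤ σ ≤ 1` in lattice coordinates. -/
theorem hat_formula_of_le {σ τ : ℝ} (h0 : 0 ≤ τ) (h1 : τ ≤ σ) (h2 : σ ≤ 1) (a b : ℤ) :
    max 0 (1 - max |σ - a| (max |τ - b| |(σ - a) - (τ - b)|)) =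
      (if a = 0 ∧ b = 0 then 1 - σ else 0) + (if a = 1 ∧ b = 0 then σ - τ else 0) +
        (if a = 1 ∧ b = 1 then τ else 0) := by
  by_cases hlt : max |σ - a| (max |τ - b| |(σ - a) - (τ - b)|) < 1
  · have hlt' := hlt
    rw [max_lt_iff, max_lt_iff, abs_lt, abs_lt, abs_lt] at hlt
    obtain ⟨⟨a1, a2⟩, ⟨b1, b2⟩, ab1, ab2⟩ := hlt
    have i1 : (-1 : ℤ) < a := by
      have : (-1 : ℝ) < a := by linarith
      exact_mod_cast this
    have i2 : a < 2 := by
      have : (a : ℝ) < 2 := by linarith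
      exact_mod_cast this
    have i3 : (-1 : ℤ) < b := by
      have : (-1 : ℝ) < b := by linarith
      exact_mod_cast this
    have i4 : b < 2 := by
      have : (b : ℝ) < 2 := by linarith
      exact_mod_cast this
    have i5 : (-1 : ℤ) < a - b := by
      have : (-1 : ℝ) < a - b := by linarith
      exact_mod_cast this
    rw [max_eq_right (by linarith)]
    have hcases : (a = 0 ∧ b = 0) ∨ (a = 1 ∧ b = 0) ∨ (a = 1 ∧ b = 1) := by omega
    rcases hcases with ⟨rfl, rfl⟩ | ⟨rfl, rfl⟩ | ⟨rfl, rfl⟩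
    · norm_num
      rw [abs_of_nonneg (h0.trans h1), abs_of_nonneg h0, abs_of_nonneg (by linarith),
        max_eq_left (max_le h1 (by linarith))]
    · norm_num
      rw [abs_of_nonpos (by linarith : σ - 1 ≤ 0), abs_of_nonneg h0,
        abs_of_nonpos (by linarith : σ - 1 - τ ≤ 0),
        max_eq_right (le_max_of_le_right (by linarith)), max_eq_right (by linarith)]
      ring
    · norm_num
      rw [abs_of_nonpos (by linarith : σ - 1 ≤ 0), abs_of_nonpos (by linarith : τ - 1 ≤ 0),
        abs_of_nonneg (by linarith : 0 ≤ σ - τ),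
        max_eq_right (le_max_of_le_left (by linarith)), max_eq_left (by linarith)]
      ring
  · rw [max_eq_left (by linarith [not_lt.1 hlt])]
    have n0 : ¬ (a = 0 ∧ b = 0) ∨ 1 - σ = 0 := by
      by_contra! h
      obtain ⟨⟨rfl, rfl⟩, h⟩ := h
      apply hlt
      have : σ < 1 := lt_of_le_of_ne h2 (fun e => h (by linarith))
      simp only [max_lt_iff, abs_lt]
      push_cast
      refine ⟨⟨?_, ?_⟩, ⟨?_, ?_⟩, ?_, ?_⟩ <;> linarith
    have n1 : ¬ (a = 1 ∧ b = 0) ∨ σ - τ = 0 := by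
      by_contra! h
      obtain ⟨⟨rfl, rfl⟩, h⟩ := h
      apply hlt
      have : τ < σ := lt_of_le_of_ne h1 (fun e => h (by linarith))
      simp only [max_lt_iff, abs_lt]
      push_cast
      refine ⟨⟨?_, ?_⟩, ⟨?_, ?_⟩, ?_, ?_⟩ <;> linarith
    have n2 : ¬ (a = 1 ∧ b = 1) ∨ τ = 0 := by
      by_contra! h
      obtain ⟨⟨rfl, rfl⟩, h⟩ := h
      apply hlt
      have : 0 < τ := lt_of_le_of_ne h0 (fun e => h e.symm)
      simp only [max_lt_iff, abs_lt]
      push_cast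
      refine ⟨⟨?_, ?_⟩, ⟨?_, ?_⟩, ?_, ?_⟩ <;> linarith
    rcases n0 with n0 | n0 <;> rcases n1 with n1 | n1 <;> rcases n2 with n2 | n2 <;>
      simp [n0, n1, n2] <;> intros <;> linarith

/-- On a closed triangle of the lattice the basis function of `p` is the barycentric coordinate
attached to the vertex `p`, or zero if `p` is not a vertex. -/
theorem hat_eq_sum_bary {L : ℝ} (hL : 0 < L) {m : ℕ} (hm : 1 ≤ m) (c : ℝ × ℝ) {T : Tri}
    {x : ℝ × ℝ} (hx : ∀ k, 0 ≤ bary c L m T x k) (p : ℤ × ℤ) :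
    hat c L m p x = ∑ k, (if T.vertex k = p then 1 else 0) * bary c L m T x k := by
  rw [hat, hexGauge_smul_sub_node hL hm]
  obtain ⟨⟨q₁, q₂⟩, b⟩ := T
  obtain ⟨p₁, p₂⟩ := p
  set s := latS c L m x
  set t := latT c L m x
  have e1 : s - p₁ = (s - q₁) - ((p₁ - q₁ : ℤ) : ℝ) := by push_cast; ring
  have e2 : t - p₂ = (t - q₂) - ((p₂ - q₂ : ℤ) : ℝ) := by push_cast; ring
  have h0 := hx 0
  have h1 := hx 1
  have h2 := hx 2
  cases b
  · simp [bary] at h0 h1 h2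
    have key := hat_formula_of_le (σ := t - q₂) (τ := s - q₁) (by linarith) (by linarith)
      (by linarith) (p₂ - q₂) (p₁ - q₁)
    simp only
    rw [e1, e2, ← max_assoc, max_comm |_| |_|, max_assoc, abs_sub_comm (s - q₁ - _) _, key]
    have v0 : Tri.vertex ((q₁, q₂), false) 0 = (p₁, p₂) ↔ p₂ - q₂ = 0 ∧ p₁ - q₁ = 0 := by
      simp [Tri.vertex]; omega
    have v1 : Tri.vertex ((q₁, q₂), false) 1 = (p₁, p₂) ↔ p₂ - q₂ = 1 ∧ p₁ - q₁ = 0 := by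
      simp [Tri.vertex]; omega
    have v2 : Tri.vertex ((q₁, q₂), false) 2 = (p₁, p₂) ↔ p₂ - q₂ = 1 ∧ p₁ - q₁ = 1 := by
      simp [Tri.vertex]; omega
    have b0 : bary c L m ((q₁, q₂), false) x 0 = 1 - (t - q₂) := by simp [bary, t]
    have b1 : bary c L m ((q₁, q₂), false) x 1 = (t - q₂) - (s - q₁) := by simp [bary, s, t]
    have b2 : bary c L m ((q₁, q₂), false) x 2 = (s - q₁) := by simp [bary, s]
    simp only [Fin.sum_univ_three, v0, v1, v2, b0, b1, b2, ite_mul, one_mul, zero_mul]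
  · simp [bary] at h0 h1 h2
    have key := hat_formula_of_le (σ := s - q₁) (τ := t - q₂) (by linarith) (by linarith)
      (by linarith) (p₁ - q₁) (p₂ - q₂)
    simp only
    rw [e1, e2, key]
    have v0 : Tri.vertex ((q₁, q₂), true) 0 = (p₁, p₂) ↔ p₁ - q₁ = 0 ∧ p₂ - q₂ = 0 := by
      simp [Tri.vertex]; omega
    have v1 : Tri.vertex ((q₁, q₂), true) 1 = (p₁, p₂) ↔ p₁ - q₁ = 1 ∧ p₂ - q₂ = 0 := by
      simp [Tri.vertex]; omega
    have v2 : Tri.vertex ((q₁, q₂), true) 2 = (p₁, p₂) ↔ p₁ - q₁ = 1 ∧ p₂ - q₂ = 1 := by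
      simp [Tri.vertex]; omega
    have b0 : bary c L m ((q₁, q₂), true) x 0 = 1 - (s - q₁) := by simp [bary, s]
    have b1 : bary c L m ((q₁, q₂), true) x 1 = (s - q₁) - (t - q₂) := by simp [bary, s, t]
    have b2 : bary c L m ((q₁, q₂), true) x 2 = (t - q₂) := by simp [bary, t]
    simp only [Fin.sum_univ_three, v0, v1, v2, b0, b1, b2, ite_mul, one_mul, zero_mul]

theorem hasFDerivAt_hat {L : ℝ} (hL : 0 < L) {m : ℕ} (hm : 1 ≤ m) (c : ℝ × ℝ) {T : Tri}
    {x : ℝ × ℝ} (hx : x ∈ openTri c L m T) (p : ℤ × ℤ) :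
    HasFDerivAt (hat c L m p)
      (∑ k, (if T.vertex k = p then (1 : ℝ) else 0) •
        ((baryGrad L m T k).1 • ContinuousLinearMap.fst ℝ ℝ ℝ +
          (baryGrad L m T k).2 • ContinuousLinearMap.snd ℝ ℝ ℝ)) x := by
  have h1 : HasFDerivAt (fun y => ∑ k, (if T.vertex k = p then (1 : ℝ) else 0) * bary c L m T y k)
      (∑ k, (if T.vertex k = p then (1 : ℝ) else 0) •
        ((baryGrad L m T k).1 • ContinuousLinearMap.fst ℝ ℝ ℝ +
          (baryGrad L m T k).2 • ContinuousLinearMap.snd ℝ ℝ ℝ)) x :=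
    HasFDerivAt.fun_sum fun k _ => (hasFDerivAt_bary c L m T x k).const_mul _
  refine h1.congr_of_eventuallyEq ?_
  filter_upwards [(isOpen_openTri c L m T).mem_nhds hx] with y hy
  exact hat_eq_sum_bary hL hm c (fun k => (hy k).le) p

theorem grad_hat {L : ℝ} (hL : 0 < L) {m : ℕ} (hm : 1 ≤ m) (c : ℝ × ℝ) {T : Tri}
    {x : ℝ × ℝ} (hx : x ∈ openTri c L m T) (p : ℤ × ℤ) :
    grad (hat c L m p) x = interpGrad L m (Pi.single p 1) T := by
  rw [grad, (hasFDerivAt_hat hL hm c hx p).fderiv, interpGrad]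
  ext <;> simp only [Pi.single_apply, Prod.fst_sum, Prod.snd_sum, sum_apply] <;>
    refine Finset.sum_congr rfl fun k _ => ?_ <;> split_ifs <;> simp

theorem latS_node {L : ℝ} (hL : 0 < L) {m : ℕ} (hm : 1 ≤ m) (c : ℝ × ℝ) (p : ℤ × ℤ) :
    latS c L m (node c L m p) = p.1 := by
  have hh := meshSize_pos hL hm
  have h3 : (0 : ℝ) < √3 := by positivity
  simp only [latS, coordS, node, Prod.fst_sub, Prod.snd_sub]
  field_simp
  ring

theorem latT_node {L : ℝ} (hL : 0 < L) {m : ℕ} (hm : 1 ≤ m) (c : ℝ × ℝ) (p : ℤ × ℤ) :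
    latT c L m (node c L m p) = p.2 := by
  have hh := meshSize_pos hL hm
  have h3 : (0 : ℝ) < √3 := by positivity
  simp only [latT, coordT, node, Prod.snd_sub]
  field_simp
  ring

theorem bary_node {L : ℝ} (hL : 0 < L) {m : ℕ} (hm : 1 ≤ m) (c : ℝ × ℝ) (T : Tri) (k l : Fin 3) :
    bary c L m T (node c L m (T.vertex k)) l = if k = l then 1 else 0 := by
  obtain ⟨p, b⟩ := T
  cases b <;> fin_cases k <;> fin_cases l <;>
    simp [bary, latS_node hL hm, latT_node hL hm, Tri.vertex]

/-- A point is the combination of the vertices with its barycentric coordinates as weights. -/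
theorem sum_bary_smul_node {L : ℝ} (hL : 0 < L) {m : ℕ} (hm : 1 ≤ m) (c : ℝ × ℝ) (T : Tri)
    (x : ℝ × ℝ) : ∑ k, bary c L m T x k • node c L m (T.vertex k) = x := by
  have hh := meshSize_pos hL hm
  have h3 : (0 : ℝ) < √3 := by positivity
  have h33 : √3 * √3 = 3 := Real.mul_self_sqrt (by norm_num)
  obtain ⟨⟨p, q⟩, b⟩ := T
  have hs : meshSize L m * latS c L m x = (x.1 - c.1) + (x.2 - c.2) / √3 := by
    rw [latS, mul_inv_cancel_left₀ hh.ne']; rfl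
  have ht : meshSize L m * latT c L m x = 2 * (x.2 - c.2) / √3 := by
    rw [latT, mul_inv_cancel_left₀ hh.ne']; rfl
  have ht' : √3 / 2 * (meshSize L m * latT c L m x) = x.2 - c.2 := by
    rw [ht]; field_simp
  have hs' : meshSize L m * latS c L m x - meshSize L m * latT c L m x / 2 = x.1 - c.1 := by
    rw [hs, ht]; ring
  cases b
  · ext
    · simp only [Fin.sum_univ_three, bary, Tri.vertex, node, Prod.fst_add, Prod.smul_fst]
      simp
      linear_combination hs'
    · simp only [Fin.sum_univ_three, bary, Tri.vertex, node, Prod.snd_add, Prod.smul_snd]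
      simp
      linear_combination ht'
  · ext
    · simp only [Fin.sum_univ_three, bary, Tri.vertex, node, Prod.fst_add, Prod.smul_fst]
      simp
      linear_combination hs'
    · simp only [Fin.sum_univ_three, bary, Tri.vertex, node, Prod.snd_add, Prod.smul_snd]
      simp
      linear_combination ht'

theorem mem_triSet_iff {L : ℝ} (hL : 0 < L) {m : ℕ} (hm : 1 ≤ m) (c : ℝ × ℝ) (T : Tri)
    (x : ℝ × ℝ) : x ∈ triSet c L m T ↔ ∀ k, 0 ≤ bary c L m T x k := by
  constructor
  · intro hx
    have hconv : Convex ℝ {y | ∀ k, 0 ≤ bary c L m T y k} := by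
      intro y hy z hz α β hα hβ hαβ k
      have e : bary c L m T (α • y + β • z) k = α * bary c L m T y k + β * bary c L m T z k := by
        rw [bary_add_sub c L m T 0 (α • y + β • z), bary_add_sub c L m T 0 y,
          bary_add_sub c L m T 0 z]
        simp [dot]
        linear_combination (-bary c L m T 0 k) * hαβ
      rw [e]
      exact add_nonneg (mul_nonneg hα (hy k)) (mul_nonneg hβ (hz k))
    refine convexHull_min ?_ hconv hx
    rintro _ ⟨k, rfl⟩ l
    rw [bary_node hL hm]
    split_ifs <;> norm_num
  · intro hx
    rw [← sum_bary_smul_node hL hm c T x]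
    exact (convex_convexHull ℝ _).sum_mem (fun k _ => hx k) (sum_bary c L m T x)
      fun k _ => subset_convexHull ℝ _ ⟨k, rfl⟩

theorem barycentre_mem_openTri {L : ℝ} (hL : 0 < L) {m : ℕ} (hm : 1 ≤ m) (c : ℝ × ℝ) (T : Tri) :
    barycentre c L m T ∈ openTri c L m T := by
  have h : ∀ k, bary c L m T (barycentre c L m T) k
      = (1 / 3 : ℝ) * ∑ l, bary c L m T (node c L m (T.vertex l)) k := by
    intro k
    rw [bary_add_sub c L m T 0]
    simp only [fun l => bary_add_sub c L m T 0 (node c L m (T.vertex l)) k]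
    simp [barycentre, Fin.sum_univ_three, dot]
    ring
  intro k
  rw [h, Finset.sum_congr rfl fun l _ => bary_node hL hm c T l k]
  simp

theorem hatGrad_eq {L : ℝ} (hL : 0 < L) {m : ℕ} (hm : 1 ≤ m) (c : ℝ × ℝ) (p : ℤ × ℤ) (T : Tri) :
    hatGrad c L m p T = interpGrad L m (Pi.single p 1) T :=
  grad_hat hL hm c (barycentre_mem_openTri hL hm c T) p

theorem dot_interpGrad_self {L : ℝ} (m : ℕ) (u : ℤ × ℤ → ℝ) (T : Tri) :
    dot (interpGrad L m u T) (interpGrad L m u T)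
      = 4 / 3 * (meshSize L m)⁻¹ ^ 2 * triEnergy u T := by
  have h33 : (√3)⁻¹ * (√3)⁻¹ = (1 / 3 : ℝ) := by
    rw [← mul_inv, Real.mul_self_sqrt (by norm_num)]; norm_num
  obtain ⟨p, b⟩ := T
  cases b
  · simp [dot, interpGrad, Fin.sum_univ_three, baryGrad, triEnergy]
    ring_nf
    rw [show (√3)⁻¹ ^ 2 = (1 / 3 : ℝ) by rw [sq, h33]]
    ring
  · simp [dot, interpGrad, Fin.sum_univ_three, baryGrad, triEnergy]
    ring_nf
    rw [show (√3)⁻¹ ^ 2 = (1 / 3 : ℝ) by rw [sq, h33]]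
    ring

/-! ### The hexagon as an almost disjoint union of triangles -/

theorem mem_openTri {c : ℝ × ℝ} {L : ℝ} {m : ℕ} {T : Tri} {x : ℝ × ℝ} :
    x ∈ openTri c L m T ↔
      if T.2 then (T.1.2 : ℝ) < latT c L m x ∧
        latT c L m x - T.1.2 < latS c L m x - T.1.1 ∧ latS c L m x < T.1.1 + 1
      else (T.1.1 : ℝ) < latS c L m x ∧
        latS c L m x - T.1.1 < latT c L m x - T.1.2 ∧ latT c L m x < T.1.2 + 1 := by
  obtain ⟨p, b⟩ := T
  cases b
  · simp only [openTri, Set.mem_ofPred_eq, Fin.forall_fin_succ, bary]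
    simp
    constructor
    · rintro ⟨h1, h2, h3⟩; refine ⟨?_, ?_, ?_⟩ <;> linarith
    · rintro ⟨h1, h2, h3⟩; refine ⟨?_, ?_, ?_⟩ <;> linarith
  · simp only [openTri, Set.mem_ofPred_eq, Fin.forall_fin_succ, bary]
    simp
    constructor
    · rintro ⟨h1, h2, h3⟩; refine ⟨?_, ?_, ?_⟩ <;> linarith
    · rintro ⟨h1, h2, h3⟩; refine ⟨?_, ?_, ?_⟩ <;> linarith

/-- The integer and fractional parts of the lattice coordinates of a point determine the open triangle
containing it. -/
theorem floor_of_mem_openTri {c : ℝ × ℝ} {L : ℝ} {m : ℕ} {T : Tri} {x : ℝ × ℝ}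
    (hx : x ∈ openTri c L m T) :
    T = ((⌊latS c L m x⌋, ⌊latT c L m x⌋),
      decide (latT c L m x - ⌊latT c L m x⌋ < latS c L m x - ⌊latS c L m x⌋)) := by
  rw [mem_openTri] at hx
  obtain ⟨⟨p, q⟩, b⟩ := T
  cases b
  · simp only [Bool.false_eq_true, if_false] at hx
    have h1 : ⌊latS c L m x⌋ = p := by rw [Int.floor_eq_iff]; constructor <;> linarith [hx.1, hx.2.1, hx.2.2]
    have h2 : ⌊latT c L m x⌋ = q := by rw [Int.floor_eq_iff]; constructor <;> linarith [hx.1, hx.2.1, hx.2.2]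
    rw [h1, h2]
    simp [hx.2.1.le]
  · simp only [if_true] at hx
    have h1 : ⌊latS c L m x⌋ = p := by rw [Int.floor_eq_iff]; constructor <;> linarith [hx.1, hx.2.1, hx.2.2]
    have h2 : ⌊latT c L m x⌋ = q := by rw [Int.floor_eq_iff]; constructor <;> linarith [hx.1, hx.2.1, hx.2.2]
    rw [h1, h2]
    simp [hx.2.1]

theorem pairwise_disjoint_openTri (c : ℝ × ℝ) (L : ℝ) (m : ℕ) :
    Pairwise (Function.onFun Disjoint (openTri c L m)) := by
  intro T T' hne
  rw [Function.onFun, Set.disjoint_left]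
  intro x hx hx'
  exact hne ((floor_of_mem_openTri hx).trans (floor_of_mem_openTri hx').symm)

theorem mem_hexagon_iff {L : ℝ} (hL : 0 < L) {m : ℕ} (hm : 1 ≤ m) (c x : ℝ × ℝ) :
    x ∈ hexagon c L ↔ |latS c L m x| < m ∧ |latT c L m x| < m ∧
      |latS c L m x - latT c L m x| < m := by
  have hh := meshSize_pos hL hm
  have hm' : (0 : ℝ) < m := by exact_mod_cast hm
  have key : ∀ r : ℝ, |(meshSize L m)⁻¹ * r| < m ↔ |r| < L := by
    intro r
    rw [abs_mul, abs_of_pos (inv_pos.2 hh), inv_mul_lt_iff₀ hh, meshSize,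
      div_mul_cancel₀ _ hm'.ne']
  rw [latS, latT, ← mul_sub, key, key, key]
  simp [hexagon, hexGauge]

theorem mem_closedHexagon_iff {L : ℝ} (hL : 0 < L) {m : ℕ} (hm : 1 ≤ m) (c x : ℝ × ℝ) :
    x ∈ closedHexagon c L ↔ |latS c L m x| ≤ m ∧ |latT c L m x| ≤ m ∧
      |latS c L m x - latT c L m x| ≤ m := by
  have hh := meshSize_pos hL hm
  have hm' : (0 : ℝ) < m := by exact_mod_cast hm
  have key : ∀ r : ℝ, |(meshSize L m)⁻¹ * r| ≤ m ↔ |r| ≤ L := by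
    intro r
    rw [abs_mul, abs_of_pos (inv_pos.2 hh), inv_mul_le_iff₀ hh, meshSize,
      div_mul_cancel₀ _ hm'.ne']
  rw [latS, latT, ← mul_sub, key, key, key]
  simp [closedHexagon, hexGauge]

theorem triSet_subset_closedHexagon {L : ℝ} (hL : 0 < L) {m : ℕ} (hm : 1 ≤ m) (c : ℝ × ℝ) {T : Tri}
    (hT : T ∈ triangles m) : triSet c L m T ⊆ closedHexagon c L := by
  intro x hx
  rw [mem_triSet_iff hL hm] at hx
  rw [mem_closedHexagon_iff hL hm]
  rw [mem_triangles] at hT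
  have h0 := hx 0
  have h1 := hx 1
  have h2 := hx 2
  have hT0 := hT 0
  have hT1 := hT 1
  have hT2 := hT 2
  obtain ⟨⟨p, q⟩, b⟩ := T
  set s := latS c L m x
  set t := latT c L m x
  cases b
  · simp [bary] at h0 h1 h2
    simp [Tri.vertex, abs_le] at hT0 hT1 hT2
    have a1 : (-(m : ℝ)) ≤ p := by have : -(m : ℤ) ≤ p := by omega
                                   exact_mod_cast this
    have a2 : (p : ℝ) + 1 ≤ m := by have : p + 1 ≤ (m : ℤ) := by omega
                                    exact_mod_cast this
    have a3 : (-(m : ℝ)) ≤ q := by have : -(m : ℤ) ≤ q := by omega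
                                   exact_mod_cast this
    have a4 : (q : ℝ) + 1 ≤ m := by have : q + 1 ≤ (m : ℤ) := by omega
                                    exact_mod_cast this
    have a5 : (-(m : ℝ)) ≤ p - q - 1 := by have : -(m : ℤ) ≤ p - q - 1 := by omega
                                           exact_mod_cast this
    have a6 : (p : ℝ) - q ≤ m := by have : p - q ≤ (m : ℤ) := by omega
                                    exact_mod_cast this
    simp only [abs_le]
    refine ⟨⟨?_, ?_⟩, ⟨?_, ?_⟩, ?_, ?_⟩ <;> linarith
  · simp [bary] at h0 h1 h2
    simp [Tri.vertex, abs_le] at hT0 hT1 hT2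
    have a1 : (-(m : ℝ)) ≤ p := by have : -(m : ℤ) ≤ p := by omega
                                   exact_mod_cast this
    have a2 : (p : ℝ) + 1 ≤ m := by have : p + 1 ≤ (m : ℤ) := by omega
                                    exact_mod_cast this
    have a3 : (-(m : ℝ)) ≤ q := by have : -(m : ℤ) ≤ q := by omega
                                   exact_mod_cast this
    have a4 : (q : ℝ) + 1 ≤ m := by have : q + 1 ≤ (m : ℤ) := by omega
                                    exact_mod_cast this
    have a5 : (-(m : ℝ)) ≤ p - q := by have : -(m : ℤ) ≤ p - q := by omega
                                       exact_mod_cast this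
    have a6 : (p : ℝ) - q + 1 ≤ m := by have : p - q + 1 ≤ (m : ℤ) := by omega
                                        exact_mod_cast this
    simp only [abs_le]
    refine ⟨⟨?_, ?_⟩, ⟨?_, ?_⟩, ?_, ?_⟩ <;> linarith

theorem openTri_subset_triSet {L : ℝ} (hL : 0 < L) {m : ℕ} (hm : 1 ≤ m) (c : ℝ × ℝ) (T : Tri) :
    openTri c L m T ⊆ triSet c L m T := fun _ hx =>
  (mem_triSet_iff hL hm c T _).2 fun k => (hx k).le

theorem continuous_coordS : Continuous coordS := by unfold coordS; fun_prop

theorem continuous_coordT : Continuous coordT := by unfold coordT; fun_prop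

theorem continuous_hexGauge : Continuous hexGauge := by
  unfold hexGauge
  have := continuous_coordS
  have := continuous_coordT
  fun_prop

theorem isOpen_hexagon (c : ℝ × ℝ) (L : ℝ) : IsOpen (hexagon c L) :=
  isOpen_lt (continuous_hexGauge.comp (continuous_id.sub continuous_const)) continuous_const

theorem isClosed_closedHexagon (c : ℝ × ℝ) (L : ℝ) : IsClosed (closedHexagon c L) :=
  isClosed_le (continuous_hexGauge.comp (continuous_id.sub continuous_const)) continuous_const

theorem hexagon_subset_closedHexagon (c : ℝ × ℝ) (L : ℝ) : hexagon c L ⊆ closedHexagon c L :=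
  fun _ hx => le_of_lt (show hexGauge _ < L from hx)

theorem convex_closedHexagon (c : ℝ × ℝ) (L : ℝ) : Convex ℝ (closedHexagon c L) := by
  intro x hx y hy α β hα hβ hαβ
  simp only [closedHexagon, hexGauge, Set.mem_ofPred_eq, max_le_iff] at hx hy ⊢
  have e1 : coordS (α • x + β • y - c) = α * coordS (x - c) + β * coordS (y - c) := by
    obtain rfl : β = 1 - α := by linarith
    simp [coordS]; ring
  have e2 : coordT (α • x + β • y - c) = α * coordT (x - c) + β * coordT (y - c) := by
    obtain rfl : β = 1 - α := by linarith
    simp [coordT]; ring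
  have key : ∀ r s : ℝ, |r| ≤ L → |s| ≤ L → |α * r + β * s| ≤ L := by
    intro r s hr hs
    have := convex_Icc (-L) L (abs_le.1 hr) (abs_le.1 hs) hα hβ hαβ
    exact abs_le.2 this
  rw [e1, e2]
  refine ⟨key _ _ hx.1 hy.1, key _ _ hx.2.1 hy.2.1, ?_⟩
  rw [show α * coordS (x - c) + β * coordS (y - c) - (α * coordT (x - c) + β * coordT (y - c)) =
    α * (coordS (x - c) - coordT (x - c)) + β * (coordS (y - c) - coordT (y - c)) by ring]
  exact key _ _ hx.2.2 hy.2.2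

theorem isCompact_closedHexagon (c : ℝ × ℝ) (L : ℝ) : IsCompact (closedHexagon c L) := by
  refine Metric.isCompact_of_isClosed_isBounded (isClosed_closedHexagon c L) ?_
  rw [isBounded_iff_forall_norm_le]
  refine ⟨‖c‖ + 2 * L, fun x hx => ?_⟩
  simp only [closedHexagon, hexGauge, Set.mem_ofPred_eq, max_le_iff] at hx
  have h3 : (0 : ℝ) < √3 := by positivity
  have h33 : √3 ≤ 2 := by rw [Real.sqrt_le_left (by norm_num)]; norm_num
  have hT := abs_le.1 hx.2.1
  have hS := abs_le.1 hx.1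
  have eT : (x - c).2 = √3 / 2 * coordT (x - c) := by rw [coordT]; field_simp
  have eS : (x - c).1 = coordS (x - c) - coordT (x - c) / 2 := by rw [coordT, coordS]; ring
  have hL0 : 0 ≤ L := (abs_nonneg _).trans hx.1
  have hn : ‖x - c‖ ≤ 2 * L := by
    rw [Prod.norm_def, max_le_iff, Real.norm_eq_abs, Real.norm_eq_abs, eT, eS, abs_le, abs_mul,
      abs_of_pos (by positivity : 0 < √3 / 2)]
    refine ⟨⟨by linarith, by linarith⟩, ?_⟩
    calc √3 / 2 * |coordT (x - c)| ≤ 1 * L := by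
          apply mul_le_mul _ hx.2.1 (abs_nonneg _) zero_le_one; linarith
      _ ≤ _ := by linarith
  calc ‖x‖ = ‖c + (x - c)‖ := by congr 1; abel
    _ ≤ _ := (norm_add_le _ _).trans (by linarith)

theorem centre_mem_hexagon (c : ℝ × ℝ) {L : ℝ} (hL : 0 < L) : c ∈ hexagon c L := by
  simp [hexagon, hexGauge, coordS, coordT, hL]

theorem uniqueDiffOn_closedHexagon (c : ℝ × ℝ) {L : ℝ} (hL : 0 < L) :
    UniqueDiffOn ℝ (closedHexagon c L) :=
  uniqueDiffOn_convex (convex_closedHexagon c L)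
    ⟨c, interior_maximal (hexagon_subset_closedHexagon c L) (isOpen_hexagon c L)
      (centre_mem_hexagon c hL)⟩

/-- A `C¹` map on the closed hexagon is Lipschitz. -/
theorem exists_lipschitzOnWith_closedHexagon {F : Type*} [NormedAddCommGroup F] [NormedSpace ℝ F]
    {f : ℝ × ℝ → F} {c : ℝ × ℝ} {L : ℝ} (hL : 0 < L) (hf : ContDiffOn ℝ 1 f (closedHexagon c L)) :
    ∃ K, LipschitzOnWith K f (closedHexagon c L) := by
  have hcont := hf.continuousOn_fderivWithin (uniqueDiffOn_closedHexagon c hL) le_rfl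
  obtain ⟨C, hC⟩ := (isCompact_closedHexagon c L).exists_bound_of_continuousOn hcont
  refine ⟨C.toNNReal, (convex_closedHexagon c L).lipschitzOnWith_of_nnnorm_fderivWithin_le
    (𝕜 := ℝ) (hf.differentiableOn one_ne_zero) fun x hx => ?_⟩
  rw [← NNReal.coe_le_coe, coe_nnnorm]
  exact (hC x hx).trans (Real.le_coe_toNNReal C)

/-- The diameter of a mesh triangle, in the sup norm. -/
theorem norm_sub_le_of_mem_triSet {L : ℝ} (hL : 0 < L) {m : ℕ} (hm : 1 ≤ m) (c : ℝ × ℝ) {T : Tri}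
    {x y : ℝ × ℝ} (hx : x ∈ triSet c L m T) (hy : y ∈ triSet c L m T) :
    ‖x - y‖ ≤ 2 * meshSize L m := by
  have hh := meshSize_pos hL hm
  have h3 : (0 : ℝ) < √3 := by positivity
  have h33 : √3 ≤ 2 := by rw [Real.sqrt_le_left (by norm_num)]; norm_num
  rw [mem_triSet_iff hL hm] at hx hy
  have eT : (x - y).2 = √3 / 2 * (meshSize L m * (latT c L m x - latT c L m y)) := by
    simp only [latT, coordT, Prod.snd_sub]; field_simp; ring
  have eS : (x - y).1 = meshSize L m * ((latS c L m x - latS c L m y) -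
      (latT c L m x - latT c L m y) / 2) := by
    simp only [latT, coordT, latS, coordS, Prod.snd_sub, Prod.fst_sub]; field_simp; ring
  have hd : |latS c L m x - latS c L m y| ≤ 1 ∧ |latT c L m x - latT c L m y| ≤ 1 := by
    have a0 := hx 0
    have a1 := hx 1
    have a2 := hx 2
    have b0 := hy 0
    have b1 := hy 1
    have b2 := hy 2
    obtain ⟨⟨p, q⟩, b⟩ := T
    cases b <;> simp [bary] at a0 a1 a2 b0 b1 b2 <;> simp only [abs_le] <;>
      refine ⟨⟨?_, ?_⟩, ?_, ?_⟩ <;> linarith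
  have hd1 := abs_le.1 hd.1
  have hd2 := abs_le.1 hd.2
  rw [Prod.norm_def, max_le_iff, Real.norm_eq_abs, Real.norm_eq_abs, eT, eS, abs_mul, abs_mul,
    abs_mul, abs_of_pos hh, abs_of_pos (by positivity : 0 < √3 / 2)]
  constructor
  · rw [mul_comm]
    refine mul_le_mul_of_nonneg_right (abs_le.2 ⟨?_, ?_⟩) hh.le <;> linarith
  · calc √3 / 2 * (meshSize L m * |latT c L m x - latT c L m y|)
        ≤ 1 * (meshSize L m * 1) := by
          apply mul_le_mul _ (mul_le_mul_of_nonneg_left hd.2 hh.le) (by positivity) zero_le_one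
          linarith
      _ ≤ _ := by linarith

theorem volume_level_set {α β : ℝ} (h : α ≠ 0 ∨ β ≠ 0) (r : ℝ) :
    volume {x : ℝ × ℝ | α * x.1 + β * x.2 = r} = 0 := by
  let ℓ : ℝ × ℝ →ₗ[ℝ] ℝ := α • LinearMap.fst ℝ ℝ ℝ + β • LinearMap.snd ℝ ℝ ℝ
  by_cases hne : ∃ x₀ : ℝ × ℝ, α * x₀.1 + β * x₀.2 = r
  · obtain ⟨x₀, hx₀⟩ := hne
    have hsub : {x : ℝ × ℝ | α * x.1 + β * x.2 = r} = (fun x => x + -x₀) ⁻¹' (LinearMap.ker ℓ) := by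
      ext x
      simp [ℓ, LinearMap.mem_ker]
      constructor <;> intro hx <;> linarith
    rw [hsub, measure_preimage_add_right]
    apply Measure.addHaar_submodule
    intro htop
    have h1 : ((1, 0) : ℝ × ℝ) ∈ LinearMap.ker ℓ := by rw [htop]; trivial
    have h2 : ((0, 1) : ℝ × ℝ) ∈ LinearMap.ker ℓ := by rw [htop]; trivial
    simp [ℓ, LinearMap.mem_ker] at h1 h2
    tauto
  · have : {x : ℝ × ℝ | α * x.1 + β * x.2 = r} = ∅ := by
      ext x
      simp only [Set.mem_ofPred_eq, Set.mem_empty_iff_false, iff_false]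
      exact fun hx => hne ⟨x, hx⟩
    rw [this, measure_empty]

/-- Almost every point lies on none of the lines of the triangular lattice. -/
theorem ae_not_on_lines {L : ℝ} (hL : 0 < L) {m : ℕ} (hm : 1 ≤ m) (c : ℝ × ℝ) :
    ∀ᵐ x : ℝ × ℝ, ∀ n : ℤ, latS c L m x ≠ n ∧ latT c L m x ≠ n ∧
      latS c L m x - latT c L m x ≠ n := by
  have hh := meshSize_pos hL hm
  have h3 : (0 : ℝ) < √3 := by positivity
  have key : ∀ α β γ : ℝ, (α ≠ 0 ∨ β ≠ 0) → ∀ r : ℝ,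
      ∀ᵐ x : ℝ × ℝ, α * x.1 + β * x.2 + γ ≠ r := by
    intro α β γ h r
    rw [ae_iff]
    have : {x : ℝ × ℝ | ¬ (α * x.1 + β * x.2 + γ ≠ r)} =
        {x : ℝ × ℝ | α * x.1 + β * x.2 = r - γ} := by
      ext x
      simp only [ne_eq, not_not, Set.mem_ofPred_eq]
      constructor <;> intro hx <;> linarith
    rw [this]
    exact volume_level_set h _
  rw [ae_all_iff]
  intro n
  have a1 := key (meshSize L m)⁻¹ ((meshSize L m)⁻¹ / √3) (latS c L m 0)
    (Or.inl (inv_ne_zero hh.ne')) n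
  have a2 := key 0 ((meshSize L m)⁻¹ * 2 / √3) (latT c L m 0) (Or.inr (by positivity)) n
  have a3 := key (meshSize L m)⁻¹ (-(meshSize L m)⁻¹ / √3) (latS c L m 0 - latT c L m 0)
    (Or.inl (inv_ne_zero hh.ne')) n
  filter_upwards [a1, a2, a3] with x b1 b2 b3
  refine ⟨?_, ?_, ?_⟩
  · convert b1 using 1
    simp [latS, coordS]; ring
  · convert b2 using 1
    simp [latT, coordT]; ring
  · convert b3 using 1
    simp [latS, coordS, latT, coordT]; ring

/-- A point off the lattice lines lies in the hexagon if and only if it lies in an open triangle of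
the mesh. -/
theorem hexagon_ae_eq {L : ℝ} (hL : 0 < L) {m : ℕ} (hm : 1 ≤ m) (c : ℝ × ℝ) :
    (hexagon c L : Set (ℝ × ℝ)) =ᵐ[volume] ⋃ T ∈ triangles m, openTri c L m T := by
  rw [Filter.eventuallyEq_set]
  filter_upwards [ae_not_on_lines hL hm c] with x hx
  rw [mem_hexagon_iff hL hm]
  simp only [Set.mem_iUnion, exists_prop]
  set s := latS c L m x with hs
  set t := latT c L m x with ht
  constructor
  · rintro ⟨h1, h2, h3⟩
    rw [abs_lt] at h1 h2 h3
    have s1 : (⌊s⌋ : ℝ) < s := lt_of_le_of_ne (Int.floor_le s) fun e => (hx _).1 e.symm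
    have t1 : (⌊t⌋ : ℝ) < t := lt_of_le_of_ne (Int.floor_le t) fun e => (hx _).2.1 e.symm
    have s2 := Int.lt_floor_add_one s
    have t2 := Int.lt_floor_add_one t
    have b1 : -(m : ℤ) ≤ ⌊s⌋ := by rw [Int.le_floor]; push_cast; linarith
    have b2 : ⌊s⌋ < (m : ℤ) := by rw [Int.floor_lt]; push_cast; linarith
    have b3 : -(m : ℤ) ≤ ⌊t⌋ := by rw [Int.le_floor]; push_cast; linarith
    have b4 : ⌊t⌋ < (m : ℤ) := by rw [Int.floor_lt]; push_cast; linarith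
    rcases lt_or_gt_of_ne (show s - ⌊s⌋ ≠ t - ⌊t⌋ from fun e =>
        (hx (⌊s⌋ - ⌊t⌋)).2.2 (by push_cast; linarith)) with hlt | hlt
    · have b5 : -(m : ℤ) ≤ ⌊s⌋ - ⌊t⌋ - 1 := by
        have : -(m : ℤ) < ⌊s⌋ - ⌊t⌋ := by
          have : -(m : ℝ) < ⌊s⌋ - ⌊t⌋ := by linarith
          exact_mod_cast this
        omega
      have b6 : ⌊s⌋ - ⌊t⌋ ≤ (m : ℤ) := by
        have : (⌊s⌋ - ⌊t⌋ : ℝ) - 1 < m := by linarith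
        have : ⌊s⌋ - ⌊t⌋ - 1 < (m : ℤ) := by exact_mod_cast this
        omega
      refine ⟨((⌊s⌋, ⌊t⌋), false), ?_, ?_⟩
      · rw [mem_triangles]
        intro k
        fin_cases k <;> simp [Tri.vertex, abs_le] <;> omega
      · rw [mem_openTri]
        simp only [Bool.false_eq_true, if_false]
        exact ⟨s1, hlt, t2⟩
    · have b5 : -(m : ℤ) ≤ ⌊s⌋ - ⌊t⌋ := by
        have : -(m : ℝ) < (⌊s⌋ - ⌊t⌋ : ℝ) + 1 := by linarith
        have : -(m : ℤ) < ⌊s⌋ - ⌊t⌋ + 1 := by exact_mod_cast this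
        omega
      have b6 : ⌊s⌋ - ⌊t⌋ + 1 ≤ (m : ℤ) := by
        have : (⌊s⌋ - ⌊t⌋ : ℝ) < m := by linarith
        have : ⌊s⌋ - ⌊t⌋ < (m : ℤ) := by exact_mod_cast this
        omega
      refine ⟨((⌊s⌋, ⌊t⌋), true), ?_, ?_⟩
      · rw [mem_triangles]
        intro k
        fin_cases k <;> simp [Tri.vertex, abs_le] <;> omega
      · rw [mem_openTri]
        simp only [if_true]
        exact ⟨t1, hlt, s2⟩
  · rintro ⟨T, hT, hxT⟩
    have hcl := triSet_subset_closedHexagon hL hm c hT (openTri_subset_triSet hL hm c T hxT)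
    rw [mem_closedHexagon_iff hL hm] at hcl
    obtain ⟨h1, h2, h3⟩ := hcl
    have key : ∀ r : ℝ, (∀ n : ℤ, r ≠ n) → |r| ≤ m → |r| < m := by
      intro r hr hrm
      refine lt_of_le_of_ne hrm fun e => ?_
      rcases abs_choice r with h | h
      · exact hr m (by rw [← h, e]; simp)
      · exact hr (-m) (by push_cast; linarith)
    exact ⟨key _ (fun n => (hx n).1) h1, key _ (fun n => (hx n).2.1) h2,
      key _ (fun n => (hx n).2.2) h3⟩

theorem triSet_ae_eq_openTri {L : ℝ} (hL : 0 < L) {m : ℕ} (hm : 1 ≤ m) (c : ℝ × ℝ) (T : Tri) :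
    (triSet c L m T : Set (ℝ × ℝ)) =ᵐ[volume] openTri c L m T := by
  rw [Filter.eventuallyEq_set]
  filter_upwards [ae_not_on_lines hL hm c] with x hx
  refine ⟨fun h => ?_, fun h => openTri_subset_triSet hL hm c T h⟩
  rw [mem_triSet_iff hL hm] at h
  intro k
  refine lt_of_le_of_ne (h k) fun e => ?_
  obtain ⟨⟨p, q⟩, b⟩ := T
  cases b <;> fin_cases k <;> simp [bary] at e
  · exact (hx (q + 1)).2.1 (by push_cast; linarith)
  · exact (hx (p - q)).2.2 (by push_cast; linarith)
  · exact (hx p).1 (by linarith)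
  · exact (hx (p + 1)).1 (by push_cast; linarith)
  · exact (hx (p - q)).2.2 (by push_cast; linarith)
  · exact (hx q).2.1 (by linarith)

/-- Integrals over the hexagon are assembled triangle by triangle. -/
theorem setIntegral_hexagon {L : ℝ} (hL : 0 < L) {m : ℕ} (hm : 1 ≤ m) (c : ℝ × ℝ)
    {f : ℝ × ℝ → ℝ} (hf : ∀ T ∈ triangles m, IntegrableOn f (openTri c L m T)) :
    ∫ x in hexagon c L, f x = ∑ T ∈ triangles m, ∫ x in openTri c L m T, f x := by
  rw [setIntegral_congr_set (hexagon_ae_eq hL hm c)]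
  exact integral_biUnion_finset _ (fun T _ => (isOpen_openTri c L m T).measurableSet)
    ((pairwise_disjoint_openTri c L m).set_pairwise _) hf

theorem isCompact_triSet (c : ℝ × ℝ) (L : ℝ) (m : ℕ) (T : Tri) : IsCompact (triSet c L m T) :=
  (Set.finite_range _).isCompact_convexHull ℝ

/-- The unit triangles below and above the diagonal have area `1 / 2`. -/
theorem volume_unit_triangle (b : Bool) :
    volume {y : ℝ × ℝ | if b then 0 < y.2 ∧ y.2 < y.1 ∧ y.1 < 1 else 0 < y.1 ∧ y.1 < y.2 ∧ y.2 < 1}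
      = ENNReal.ofReal (1 / 2) := by
  have hint : IntegrableOn (fun x : ℝ => x) (Set.Ioo 0 1) :=
    (continuous_id.integrableOn_Icc).mono_set Set.Ioo_subset_Icc_self
  have hc : ∀ r : ℝ, IntegrableOn (fun _ : ℝ => r) (Set.Ioo 0 1) := fun r =>
    (continuous_const.integrableOn_Icc).mono_set Set.Ioo_subset_Icc_self
  cases b
  · have hset : {y : ℝ × ℝ | if false = true then 0 < y.2 ∧ y.2 < y.1 ∧ y.1 < 1
        else 0 < y.1 ∧ y.1 < y.2 ∧ y.2 < 1} =
        regionBetween (fun x => x) (fun _ => 1) (Set.Ioo 0 1) := by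
      ext y
      simp only [Bool.false_eq_true, if_false, Set.mem_ofPred_eq, regionBetween, Set.mem_Ioo]
      constructor
      · rintro ⟨h1, h2, h3⟩; exact ⟨⟨h1, by linarith⟩, h2, h3⟩
      · rintro ⟨⟨h1, -⟩, h2, h3⟩; exact ⟨h1, h2, h3⟩
    rw [hset, Measure.volume_eq_prod, volume_regionBetween_eq_integral hint (hc 1)
      measurableSet_Ioo fun x hx => hx.2.le]
    congr 1
    rw [← integral_Ioc_eq_integral_Ioo, ← intervalIntegral.integral_of_le zero_le_one]
    simp only [Pi.sub_apply]
    rw [intervalIntegral.integral_sub (by simp) (by simp), integral_id]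
    norm_num
  · have hset : {y : ℝ × ℝ | if true = true then 0 < y.2 ∧ y.2 < y.1 ∧ y.1 < 1
        else 0 < y.1 ∧ y.1 < y.2 ∧ y.2 < 1} =
        regionBetween (fun _ => 0) (fun x => x) (Set.Ioo 0 1) := by
      ext y
      simp only [if_true, Set.mem_ofPred_eq, regionBetween, Set.mem_Ioo]
      constructor
      · rintro ⟨h1, h2, h3⟩; exact ⟨⟨by linarith, h3⟩, h1, h2⟩
      · rintro ⟨⟨-, h1⟩, h2, h3⟩; exact ⟨h2, h3, h1⟩
    rw [hset, Measure.volume_eq_prod, volume_regionBetween_eq_integral (hc 0) hint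
      measurableSet_Ioo fun x hx => hx.1.le]
    congr 1
    rw [← integral_Ioc_eq_integral_Ioo, ← intervalIntegral.integral_of_le zero_le_one]
    simp

theorem triArea_pos {L : ℝ} (hL : 0 < L) {m : ℕ} (hm : 1 ≤ m) : 0 < triArea L m := by
  have := meshSize_pos hL hm
  unfold triArea
  positivity

theorem volume_openTri {L : ℝ} (hL : 0 < L) {m : ℕ} (hm : 1 ≤ m) (c : ℝ × ℝ) (T : Tri) :
    volume (openTri c L m T) = ENNReal.ofReal (triArea L m) := by
  have hh := meshSize_pos hL hm
  have h3 : (0 : ℝ) < √3 := by positivity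
  have h33 : √3 * √3 = 3 := Real.mul_self_sqrt (by norm_num)
  set h := meshSize L m with hdef
  let A : ℝ × ℝ →ₗ[ℝ] ℝ × ℝ := Matrix.toLin (Module.Basis.finTwoProd ℝ) (Module.Basis.finTwoProd ℝ)
    !![h⁻¹, h⁻¹ / √3; 0, h⁻¹ * 2 / √3]
  have hA : ∀ x, A x = (h⁻¹ * x.1 + h⁻¹ / √3 * x.2, 0 * x.1 + h⁻¹ * 2 / √3 * x.2) := fun x =>
    Matrix.toLin_finTwoProd_apply _ _ _ _ _
  have hdet : LinearMap.det A = h⁻¹ ^ 2 * 2 / √3 := by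
    rw [LinearMap.det_toLin, Matrix.det_fin_two_of]; ring
  have hdet0 : LinearMap.det A ≠ 0 := by rw [hdet]; positivity
  set U : Set (ℝ × ℝ) := {y : ℝ × ℝ | if T.2 then 0 < y.2 ∧ y.2 < y.1 ∧ y.1 < 1
    else 0 < y.1 ∧ y.1 < y.2 ∧ y.2 < 1} with hU
  set v : ℝ × ℝ := (latS c L m 0 - T.1.1, latT c L m 0 - T.1.2) with hv
  have hset : openTri c L m T = A ⁻¹' ((fun y => y + v) ⁻¹' U) := by
    ext x
    have e1 : (A x + v).1 = latS c L m x - T.1.1 := by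
      rw [hA, hv]; simp [latS, coordS, ← hdef]; ring
    have e2 : (A x + v).2 = latT c L m x - T.1.2 := by
      rw [hA, hv]; simp [latT, coordT, ← hdef]; ring
    rw [mem_openTri, Set.mem_preimage, Set.mem_preimage, hU, Set.mem_ofPred_eq, e1, e2]
    split_ifs
    · refine and_congr (by simp) (and_congr Iff.rfl ?_)
      constructor <;> intro <;> linarith
    · refine and_congr (by simp) (and_congr Iff.rfl ?_)
      constructor <;> intro <;> linarith
  rw [hset, Measure.addHaar_preimage_linearMap _ hdet0, measure_preimage_add_right, hU,
    volume_unit_triangle, ← ENNReal.ofReal_mul (abs_nonneg _), hdet,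
    abs_of_pos (by positivity)]
  congr 1
  rw [triArea, ← hdef]
  field_simp
  nlinarith

theorem setIntegral_openTri_const {L : ℝ} (hL : 0 < L) {m : ℕ} (hm : 1 ≤ m) (c : ℝ × ℝ) (T : Tri)
    (r : ℝ) : ∫ _ in openTri c L m T, r = triArea L m * r := by
  rw [setIntegral_const, measureReal_def, volume_openTri hL hm,
    ENNReal.toReal_ofReal (triArea_pos hL hm).le, smul_eq_mul]

/-! ### Assembled matrices and their quadratic forms -/

/-- `Θ` is assembled from the element stiffness matrices with the weight `α T` on `T`: this is the
diffusion matrix of a coefficient whose (exact or approximate) mean value on `T` is `α T`. -/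
def IsAssembled (L : ℝ) (m : ℕ) (α : Tri → ℝ) (Θ : Matrix (Idx m) (Idx m) ℝ) : Prop :=
  ∀ i j, Θ i j = ∑ T ∈ triangles m, triArea L m * α T *
    dot (interpGrad L m (Pi.single j.1 1) T) (interpGrad L m (Pi.single i.1 1) T)

theorem sum_smul_single {m : ℕ} (x : Idx m → ℝ) (p : ℤ × ℤ) :
    ∑ i, x i * (Pi.single i.1 (1 : ℝ) : ℤ × ℤ → ℝ) p = zeroExt m x p := by
  by_cases hp : p ∈ innerNodes m
  · rw [Finset.sum_eq_single ⟨p, hp⟩]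
    · simp [zeroExt, hp]
    · intro i _ hi
      rw [Pi.single_apply, if_neg, mul_zero]
      rintro rfl
      exact hi rfl
    · simp
  · rw [zeroExt_of_notMem x hp]
    refine Finset.sum_eq_zero fun i _ => ?_
    rw [Pi.single_apply, if_neg, mul_zero]
    rintro rfl
    exact hp i.2

theorem zeroExt_single {m : ℕ} (i : Idx m) :
    zeroExt m (Pi.single i 1) = Pi.single i.1 1 := by
  ext p
  rw [← sum_smul_single, Finset.sum_eq_single i]
  · simp
  · intro j _ hj; simp [hj]
  · simp

theorem sum_smul_interpGrad_single {m : ℕ} (L : ℝ) (x : Idx m → ℝ) (T : Tri) :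
    ∑ i, x i • interpGrad L m (Pi.single i.1 1) T = interpGrad L m (zeroExt m x) T := by
  simp only [interpGrad, Finset.smul_sum, smul_smul]
  rw [Finset.sum_comm]
  refine Finset.sum_congr rfl fun k _ => ?_
  rw [← Finset.sum_smul, sum_smul_single]

theorem dot_sum_smul_left {ι : Type*} (s : Finset ι) (x : ι → ℝ) (v : ι → ℝ × ℝ) (w : ℝ × ℝ) :
    dot (∑ i ∈ s, x i • v i) w = ∑ i ∈ s, x i * dot (v i) w := by
  simp only [dot, Prod.fst_sum, Prod.snd_sum, Prod.smul_fst, Prod.smul_snd, smul_eq_mul,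
    Finset.sum_mul]
  rw [← Finset.sum_add_distrib]
  exact Finset.sum_congr rfl fun i _ => by ring

theorem dot_comm (v w : ℝ × ℝ) : dot v w = dot w v := by simp [dot]; ring

theorem triArea_mul_dot_interpGrad {L : ℝ} (hL : 0 < L) {m : ℕ} (hm : 1 ≤ m) (u : ℤ × ℤ → ℝ)
    (T : Tri) : triArea L m * dot (interpGrad L m u T) (interpGrad L m u T)
      = (√3)⁻¹ * triEnergy u T := by
  have hh := meshSize_pos hL hm
  have h3 : (0 : ℝ) < √3 := by positivity
  have h33 : √3 ^ 2 = 3 := Real.sq_sqrt (by norm_num)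
  rw [dot_interpGrad_self, triArea]
  field_simp
  rw [h33]

open Matrix in
theorem IsAssembled.form {L : ℝ} (hL : 0 < L) {m : ℕ} (hm : 1 ≤ m) {α : Tri → ℝ}
    {Θ : Matrix (Idx m) (Idx m) ℝ} (h : IsAssembled L m α Θ) (x : Idx m → ℝ) :
    x ⬝ᵥ (Θ *ᵥ x) = (√3)⁻¹ * ∑ T ∈ triangles m, α T * triEnergy (zeroExt m x) T := by
  have e : x ⬝ᵥ (Θ *ᵥ x) = ∑ T ∈ triangles m, triArea L m * α T *
      dot (interpGrad L m (zeroExt m x) T) (interpGrad L m (zeroExt m x) T) := by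
    simp only [dotProduct, mulVec, h _ _]
    simp only [← sum_smul_interpGrad_single]
    simp only [dot_sum_smul_left, Finset.mul_sum, Finset.sum_mul]
    rw [Finset.sum_congr rfl fun i _ => Finset.sum_comm, Finset.sum_comm]
    refine Finset.sum_congr rfl fun T _ => Finset.sum_congr rfl fun i _ => ?_
    rw [dot_comm, dot_sum_smul_left, Finset.mul_sum, Finset.mul_sum]
    exact Finset.sum_congr rfl fun j _ => by ring
  rw [e, Finset.mul_sum]
  refine Finset.sum_congr rfl fun T _ => ?_
  rw [mul_right_comm, triArea_mul_dot_interpGrad hL hm]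
  ring

theorem IsAssembled.isHermitian {L : ℝ} {m : ℕ} {α : Tri → ℝ}
    {Θ : Matrix (Idx m) (Idx m) ℝ} (h : IsAssembled L m α Θ) : Θ.IsHermitian := by
  ext i j
  rw [Matrix.conjTranspose_apply, star_trivial, h, h]
  exact Finset.sum_congr rfl fun T _ => by rw [dot_comm]

theorem sum_sq_pos {ι : Type*} [Fintype ι] {x : ι → ℝ} (hx : x ≠ 0) : 0 < ∑ i, x i ^ 2 := by
  obtain ⟨i, hi⟩ := Function.ne_iff.1 hx
  exact Finset.sum_pos' (fun j _ => sq_nonneg _) ⟨i, Finset.mem_univ _, sq_pos_of_ne_zero hi⟩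

theorem poincare_zeroExt {m : ℕ} (x : Idx m → ℝ) :
    ∑ i, x i ^ 2 ≤ 8 * (m : ℝ) ^ 2 * energy m (zeroExt m x) := by
  rw [← sum_innerNodes_zeroExt_sq]
  exact sum_sq_le_energy fun p hp => zeroExt_of_notMem x hp

theorem energy_pos {m : ℕ} {x : Idx m → ℝ} (hx : x ≠ 0) : 0 < energy m (zeroExt m x) := by
  have h1 := sum_sq_pos hx
  have h2 := poincare_zeroExt x
  by_contra! h
  have : 8 * (m : ℝ) ^ 2 * energy m (zeroExt m x) ≤ 0 :=
    mul_nonpos_of_nonneg_of_nonpos (by positivity) h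
  linarith

theorem meshSize_sq_mul_sum_sq_le {L : ℝ} {m : ℕ} (hm : 1 ≤ m) (x : Idx m → ℝ) :
    meshSize L m ^ 2 * ∑ i, x i ^ 2 ≤ 8 * L ^ 2 * energy m (zeroExt m x) := by
  have hm' : (0 : ℝ) < m := by exact_mod_cast hm
  calc _ ≤ meshSize L m ^ 2 * (8 * (m : ℝ) ^ 2 * energy m (zeroExt m x)) :=
        mul_le_mul_of_nonneg_left (poincare_zeroExt x) (sq_nonneg _)
    _ = _ := by rw [meshSize]; field_simp

theorem sum_triMass_zeroExt_le {m : ℕ} (x : Idx m → ℝ) :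
    ∑ T ∈ triangles m, triMass (zeroExt m x) T ≤ 6 * ∑ i, x i ^ 2 := by
  rw [← sum_innerNodes_zeroExt_sq]
  exact sum_triMass_le fun p hp => zeroExt_of_notMem x hp

open Matrix in
theorem IsAssembled.posDef {L : ℝ} (hL : 0 < L) {m : ℕ} (hm : 1 ≤ m) {α : Tri → ℝ}
    {Θ : Matrix (Idx m) (Idx m) ℝ} (h : IsAssembled L m α Θ) {r : ℝ} (hr : 0 < r)
    (hα : ∀ T ∈ triangles m, r ≤ α T) : Θ.PosDef := by
  refine PosDef.of_dotProduct_mulVec_pos h.isHermitian fun x hx => ?_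
  rw [star_trivial, h.form hL hm]
  refine mul_pos (by positivity) (lt_of_lt_of_le (mul_pos hr (energy_pos hx)) ?_)
  rw [energy, Finset.mul_sum]
  exact Finset.sum_le_sum fun T hT => mul_le_mul_of_nonneg_right (hα T hT) (triEnergy_nonneg _ _)

open Matrix in
theorem preconditioner_form {ι : Type*} [Fintype ι] [DecidableEq ι] (Θ S : Matrix ι ι ℝ)
    (x : ι → ℝ) :
    x ⬝ᵥ (preconditioner Θ S *ᵥ x) =
      (fun i => √(Θ i i / S i i) * x i) ⬝ᵥ (S *ᵥ fun i => √(Θ i i / S i i) * x i) := by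
  have h : (diagonal fun i => √(Θ i i / S i i)) *ᵥ x = fun i => √(Θ i i / S i i) * x i := by
    ext i; rw [mulVec_diagonal]
  have := dotProduct_congr_mulVec S (diagonal fun i => √(Θ i i / S i i)) x
  rw [h, diagonal_transpose] at this
  exact this.symm

open Matrix in
theorem preconditioner_isHermitian {ι : Type*} [Fintype ι] [DecidableEq ι] (Θ : Matrix ι ι ℝ)
    {S : Matrix ι ι ℝ} (hS : S.IsHermitian) : (preconditioner Θ S).IsHermitian := by
  have hSt : Sᵀ = S := hS
  change (preconditioner Θ S)ᵀ = _
  simp only [preconditioner, transpose_mul, diagonal_transpose, hSt, Matrix.mul_assoc]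

open Matrix in
theorem preconditioner_posDef {ι : Type*} [Fintype ι] [DecidableEq ι] {Θ S : Matrix ι ι ℝ}
    (hΘ : Θ.PosDef) (hS : S.PosDef) : (preconditioner Θ S).PosDef := by
  refine PosDef.of_dotProduct_mulVec_pos (preconditioner_isHermitian Θ hS.1) fun x hx => ?_
  rw [star_trivial, preconditioner_form]
  have := hS.dotProduct_mulVec_pos (x := fun i => √(Θ i i / S i i) * x i) (by
    obtain ⟨i, hi⟩ := Function.ne_iff.1 hx
    refine Function.ne_iff.2 ⟨i, mul_ne_zero ?_ hi⟩
    exact (Real.sqrt_pos.2 (div_pos hΘ.diag_pos hS.diag_pos)).ne')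
  rwa [star_trivial] at this

open Matrix in
theorem hermPart_form {ι : Type*} [Fintype ι] (A : Matrix ι ι ℝ) (x : ι → ℝ) :
    x ⬝ᵥ (hermPart A *ᵥ x) = x ⬝ᵥ (A *ᵥ x) := by
  have h : x ⬝ᵥ (Aᴴ *ᵥ x) = x ⬝ᵥ (A *ᵥ x) := by
    rw [conjTranspose_eq_transpose_of_trivial, mulVec_transpose, dotProduct_comm,
      ← dotProduct_mulVec]
  rw [hermPart, smul_mulVec, add_mulVec, dotProduct_smul, dotProduct_add, h, smul_eq_mul]
  ring

theorem hermPart_isHermitian {ι : Type*} (A : Matrix ι ι ℝ) : (hermPart A).IsHermitian := by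
  unfold hermPart
  ext i j
  simp
  ring

/-! ### Multiplication of nodal values by a slowly varying function -/

theorem quad_nonneg (A B : ℝ) : 0 ≤ A ^ 2 + A * B + B ^ 2 := by
  nlinarith [sq_nonneg (A + B), sq_nonneg A, sq_nonneg B]

/-- Young's inequality for the mixed term of the form `A² + A B + B²`. -/
theorem abs_quad_mixed_le (A B r s g : ℝ) {η : ℝ} (hη : 0 < η) :
    |g * (2 * A * r + A * s + B * r + 2 * B * s)| ≤
      η * (A ^ 2 + A * B + B ^ 2) + g ^ 2 / η * (r ^ 2 + r * s + s ^ 2) := by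
  have p1 := quad_nonneg (η * A + g * r) (η * B + g * s)
  have p2 := quad_nonneg (η * A - g * r) (η * B - g * s)
  have e : η * (η * (A ^ 2 + A * B + B ^ 2) + g ^ 2 / η * (r ^ 2 + r * s + s ^ 2)) =
      η ^ 2 * (A ^ 2 + A * B + B ^ 2) + g ^ 2 * (r ^ 2 + r * s + s ^ 2) := by field_simp
  rw [abs_le]
  constructor
  · refine le_of_mul_le_mul_left ?_ hη
    rw [mul_neg, e]
    linarith
  · refine le_of_mul_le_mul_left ?_ hη
    rw [e]
    linarith

theorem quad_increment_le {d1 d2 u0 u1 u2 ρ : ℝ} (h1 : |d1| ≤ ρ) (h2 : |d2| ≤ ρ) :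
    (d1 * u1) ^ 2 + (d1 * u1) * (d2 * u2 - d1 * u1) + (d2 * u2 - d1 * u1) ^ 2 ≤
      5 * ρ ^ 2 * (u0 ^ 2 + u1 ^ 2 + u2 ^ 2) := by
  have q1 : d1 ^ 2 ≤ ρ ^ 2 := sq_le_sq' (by linarith [abs_le.1 h1]) (abs_le.1 h1).2
  have q2 : d2 ^ 2 ≤ ρ ^ 2 := sq_le_sq' (by linarith [abs_le.1 h2]) (abs_le.1 h2).2
  have r2 : (d1 * u1) ^ 2 ≤ ρ ^ 2 * u1 ^ 2 := by
    rw [mul_pow]; exact mul_le_mul_of_nonneg_right q1 (sq_nonneg _)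
  have s2 : (d2 * u2) ^ 2 ≤ ρ ^ 2 * u2 ^ 2 := by
    rw [mul_pow]; exact mul_le_mul_of_nonneg_right q2 (sq_nonneg _)
  have e := sq_nonneg (d1 * u1 + d2 * u2)
  have t0 : 0 ≤ ρ ^ 2 * u0 ^ 2 := by positivity
  have t1 : 0 ≤ ρ ^ 2 * u1 ^ 2 := by positivity
  have t2 : 0 ≤ ρ ^ 2 * u2 ^ 2 := by positivity
  linarith

/-- Energy of the interpolant of a product `g u` on a triangle where `g` varies by at most `ρ`. -/
theorem abs_triEnergy_mul_sub_le {g u : ℤ × ℤ → ℝ} {T : Tri} {α ρ Γ η : ℝ} (hη : 0 < η)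
    (h1 : |g (T.vertex 1) - g (T.vertex 0)| ≤ ρ) (h2 : |g (T.vertex 2) - g (T.vertex 0)| ≤ ρ)
    (hΓ : g (T.vertex 0) ^ 2 ≤ Γ) :
    |triEnergy (fun p => g p * u p) T - α * triEnergy u T| ≤
      (|g (T.vertex 0) ^ 2 - α| + η) * triEnergy u T +
        5 * (Γ / η + 1) * ρ ^ 2 * triMass u T := by
  simp only [triEnergy, triMass, Fin.sum_univ_three]
  generalize g (T.vertex 0) = g0 at *
  generalize g (T.vertex 1) = g1 at *
  generalize g (T.vertex 2) = g2 at *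
  generalize u (T.vertex 0) = u0
  generalize u (T.vertex 1) = u1
  generalize u (T.vertex 2) = u2
  have hG0 := quad_nonneg (u1 - u0) (u2 - u1)
  have hH0 := quad_nonneg ((g1 - g0) * u1) ((g2 - g0) * u2 - (g1 - g0) * u1)
  have hH := quad_increment_le (u0 := u0) (u1 := u1) (u2 := u2) h1 h2
  have hy := abs_quad_mixed_le (u1 - u0) (u2 - u1) ((g1 - g0) * u1)
    ((g2 - g0) * u2 - (g1 - g0) * u1) g0 hη
  have hexp : (g1 * u1 - g0 * u0) ^ 2 + (g1 * u1 - g0 * u0) * (g2 * u2 - g1 * u1) +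
      (g2 * u2 - g1 * u1) ^ 2 - α * ((u1 - u0) ^ 2 + (u1 - u0) * (u2 - u1) + (u2 - u1) ^ 2) =
      (g0 ^ 2 - α) * ((u1 - u0) ^ 2 + (u1 - u0) * (u2 - u1) + (u2 - u1) ^ 2) +
      g0 * (2 * (u1 - u0) * ((g1 - g0) * u1) +
        (u1 - u0) * ((g2 - g0) * u2 - (g1 - g0) * u1) + (u2 - u1) * ((g1 - g0) * u1) +
        2 * (u2 - u1) * ((g2 - g0) * u2 - (g1 - g0) * u1)) +
      (((g1 - g0) * u1) ^ 2 + ((g1 - g0) * u1) * ((g2 - g0) * u2 - (g1 - g0) * u1) +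
        ((g2 - g0) * u2 - (g1 - g0) * u1) ^ 2) := by ring
  rw [hexp]
  generalize g0 * (2 * (u1 - u0) * ((g1 - g0) * u1) +
        (u1 - u0) * ((g2 - g0) * u2 - (g1 - g0) * u1) + (u2 - u1) * ((g1 - g0) * u1) +
        2 * (u2 - u1) * ((g2 - g0) * u2 - (g1 - g0) * u1)) = b at *
  generalize ((g1 - g0) * u1) ^ 2 + ((g1 - g0) * u1) * ((g2 - g0) * u2 - (g1 - g0) * u1) +
        ((g2 - g0) * u2 - (g1 - g0) * u1) ^ 2 = H at *
  generalize (u1 - u0) ^ 2 + (u1 - u0) * (u2 - u1) + (u2 - u1) ^ 2 = G at *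
  generalize u0 ^ 2 + u1 ^ 2 + u2 ^ 2 = V at *
  have t1 : |(g0 ^ 2 - α) * G| = |g0 ^ 2 - α| * G := by rw [abs_mul, abs_of_nonneg hG0]
  have t2 : g0 ^ 2 / η * H + H ≤ (Γ / η + 1) * (5 * ρ ^ 2 * V) := by
    have : g0 ^ 2 / η ≤ Γ / η := div_le_div_of_nonneg_right hΓ hη.le
    have h0 : 0 ≤ g0 ^ 2 / η := by positivity
    calc g0 ^ 2 / η * H + H = (g0 ^ 2 / η + 1) * H := by ring
      _ ≤ (Γ / η + 1) * (5 * ρ ^ 2 * V) := by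
        apply mul_le_mul _ hH hH0 _ <;> linarith
  calc |(g0 ^ 2 - α) * G + b + H| ≤ |(g0 ^ 2 - α) * G| + |b| + |H| := abs_add_three _ _ _
    _ ≤ |g0 ^ 2 - α| * G + (η * G + g0 ^ 2 / η * H) + H := by
        rw [t1, abs_of_nonneg hH0]; linarith
    _ ≤ _ := by linarith

/-- The summed form of `abs_triEnergy_mul_sub_le`. -/
theorem abs_energy_mul_sub_le {m : ℕ} {g : ℤ × ℤ → ℝ} {α : Tri → ℝ} {ρ τ Γ η : ℝ} (hη : 0 < η)
    (hΓ0 : 0 ≤ Γ)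
    (hg : ∀ T ∈ triangles m, ∀ k, |g (T.vertex k) - g (T.vertex 0)| ≤ ρ)
    (hα : ∀ T ∈ triangles m, |g (T.vertex 0) ^ 2 - α T| ≤ τ)
    (hΓ : ∀ T ∈ triangles m, g (T.vertex 0) ^ 2 ≤ Γ) (x : Idx m → ℝ) :
    |energy m (fun p => g p * zeroExt m x p) -
        ∑ T ∈ triangles m, α T * triEnergy (zeroExt m x) T| ≤
      (τ + η) * energy m (zeroExt m x) + 30 * (Γ / η + 1) * ρ ^ 2 * ∑ i, x i ^ 2 := by
  rw [energy, ← Finset.sum_sub_distrib]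
  refine (Finset.abs_sum_le_sum_abs _ _).trans ?_
  have h1 : ∀ T ∈ triangles m, |triEnergy (fun p => g p * zeroExt m x p) T -
      α T * triEnergy (zeroExt m x) T| ≤ (τ + η) * triEnergy (zeroExt m x) T +
        5 * (Γ / η + 1) * ρ ^ 2 * triMass (zeroExt m x) T := by
    intro T hT
    refine (abs_triEnergy_mul_sub_le (α := α T) hη (hg T hT 1) (hg T hT 2) (hΓ T hT)).trans ?_
    have := mul_le_mul_of_nonneg_right (add_le_add_left (hα T hT) η) (triEnergy_nonneg (zeroExt m x) T)
    linarith
  refine (Finset.sum_le_sum h1).trans ?_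
  rw [Finset.sum_add_distrib, ← Finset.mul_sum, ← Finset.mul_sum, energy]
  have h2 := mul_le_mul_of_nonneg_left (sum_triMass_zeroExt_le x)
    (show 0 ≤ 5 * (Γ / η + 1) * ρ ^ 2 by positivity)
  linarith

/-! ### Comparison of the preconditioner with the diffusion matrix -/

open Matrix in
theorem IsAssembled.diag {L : ℝ} (hL : 0 < L) {m : ℕ} (hm : 1 ≤ m) {α : Tri → ℝ}
    {Θ : Matrix (Idx m) (Idx m) ℝ} (h : IsAssembled L m α Θ) (i : Idx m) :
    Θ i i = (√3)⁻¹ * ∑ T ∈ triangles m, α T * triEnergy (Pi.single i.1 1) T := by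
  have := h.form hL hm (Pi.single i 1)
  rw [zeroExt_single] at this
  rw [← this]
  simp

theorem triEnergy_single_eq_zero {p : ℤ × ℤ} {T : Tri} (h : ∀ k, T.vertex k ≠ p) :
    triEnergy (Pi.single p 1) T = 0 := by
  have : ∀ k, (Pi.single p (1 : ℝ) : ℤ × ℤ → ℝ) (T.vertex k) = 0 := fun k => by simp [h k]
  simp [triEnergy, this]

/-- The scaling `Θᵢᵢ / Sᵢᵢ` is a weighted mean of the coefficient over the triangles around the
node `i`. -/
theorem abs_diag_div_sub_le {L : ℝ} (hL : 0 < L) {m : ℕ} (hm : 1 ≤ m) {α : Tri → ℝ}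
    {Θ S : Matrix (Idx m) (Idx m) ℝ} (hΘ : IsAssembled L m α Θ)
    (hS : IsAssembled L m (fun _ => 1) S) {A : ℤ × ℤ → ℝ} {δ : ℝ}
    (hα : ∀ T ∈ triangles m, ∀ k, |α T - A (T.vertex k)| ≤ δ) (i : Idx m) :
    |Θ i i / S i i - A i.1| ≤ δ := by
  have hSii : 0 < S i i := (hS.posDef hL hm one_pos fun _ _ => le_rfl).diag_pos
  have e : Θ i i / S i i - A i.1 = (Θ i i - A i.1 * S i i) / S i i := by field_simp
  rw [e, abs_div, abs_of_pos hSii, div_le_iff₀ hSii]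
  rw [hΘ.diag hL hm, hS.diag hL hm]
  have e2 : (√3)⁻¹ * ∑ T ∈ triangles m, α T * triEnergy (Pi.single i.1 1) T -
      A i.1 * ((√3)⁻¹ * ∑ T ∈ triangles m, 1 * triEnergy (Pi.single i.1 1) T) =
      (√3)⁻¹ * ∑ T ∈ triangles m, (α T - A i.1) * triEnergy (Pi.single i.1 1) T := by
    simp only [sub_mul, Finset.sum_sub_distrib, one_mul, ← Finset.mul_sum]
    ring
  rw [e2, abs_mul, abs_of_pos (by positivity : 0 < (√3)⁻¹), mul_left_comm]
  refine mul_le_mul_of_nonneg_left ?_ (by positivity)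
  rw [Finset.mul_sum]
  refine (Finset.abs_sum_le_sum_abs _ _).trans (Finset.sum_le_sum fun T hT => ?_)
  rw [abs_mul, abs_of_nonneg (triEnergy_nonneg _ _), one_mul]
  by_cases h : ∃ k, T.vertex k = i.1
  · obtain ⟨k, hk⟩ := h
    refine mul_le_mul_of_nonneg_right ?_ (triEnergy_nonneg _ _)
    rw [← hk]
    exact hα T hT k
  · push Not at h
    rw [triEnergy_single_eq_zero h]
    simp

theorem abs_sub_le_of_sq {x y β ε : ℝ} (hβ : 0 < β) (hx : β ≤ x) (hy : β ≤ y)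
    (h : |x ^ 2 - y ^ 2| ≤ ε) : |x - y| ≤ ε / (2 * β) := by
  rw [le_div_iff₀ (by positivity)]
  have : |x ^ 2 - y ^ 2| = |x - y| * (x + y) := by
    rw [← abs_of_pos (by linarith : 0 < x + y), ← abs_mul]
    congr 1; ring
  rw [this] at h
  exact (mul_le_mul_of_nonneg_left (by linarith) (abs_nonneg _)).trans h

/-- With `g = √(Θᵢᵢ / Sᵢᵢ)`, extended by `√A` to the boundary nodes, the preconditioner has the form
`energy (g u)`, and `g²` follows the coefficient up to `O(h)`. -/
theorem exists_scaling {L : ℝ} (hL : 0 < L) {m : ℕ} (hm : 1 ≤ m) {α : Tri → ℝ}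
    {Θ S : Matrix (Idx m) (Idx m) ℝ} (hΘ : IsAssembled L m α Θ)
    (hS : IsAssembled L m (fun _ => 1) S) {A : ℤ × ℤ → ℝ} {δ a₀ : ℝ} (ha₀ : 0 < a₀)
    (hA : ∀ T ∈ triangles m, ∀ k, a₀ ≤ A (T.vertex k))
    (hα : ∀ T ∈ triangles m, ∀ k, |α T - A (T.vertex k)| ≤ δ) (hδ : δ ≤ a₀ / 2) :
    ∃ g : ℤ × ℤ → ℝ, (∀ i : Idx m, g i.1 = √(Θ i i / S i i)) ∧
      (∀ T ∈ triangles m, ∀ k, √(a₀ / 2) ≤ g (T.vertex k)) ∧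
      (∀ T ∈ triangles m, ∀ k, |g (T.vertex k) ^ 2 - A (T.vertex k)| ≤ δ) := by
  classical
  let g : ℤ × ℤ → ℝ := fun p => if h : p ∈ innerNodes m then
    √(Θ ⟨p, h⟩ ⟨p, h⟩ / S ⟨p, h⟩ ⟨p, h⟩) else √(A p)
  have key : ∀ T ∈ triangles m, ∀ k, √(a₀ / 2) ≤ g (T.vertex k) ∧
      |g (T.vertex k) ^ 2 - A (T.vertex k)| ≤ δ := by
    intro T hT k
    have hAk := hA T hT k
    have hδ0 : 0 ≤ δ := (abs_nonneg _).trans (hα T hT k)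
    by_cases h : T.vertex k ∈ innerNodes m
    · have h1 := abs_diag_div_sub_le hL hm hΘ hS hα ⟨T.vertex k, h⟩
      have h2 := abs_le.1 h1
      have hg : g (T.vertex k) = √(Θ ⟨T.vertex k, h⟩ ⟨T.vertex k, h⟩ /
          S ⟨T.vertex k, h⟩ ⟨T.vertex k, h⟩) := by simp [g, h]
      rw [hg, Real.sq_sqrt (by simp only at h2; linarith)]
      exact ⟨Real.sqrt_le_sqrt (by simp only at h2; linarith), h1⟩
    · have hg : g (T.vertex k) = √(A (T.vertex k)) := by simp [g, h]
      rw [hg, Real.sq_sqrt (by linarith), sub_self, abs_zero]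
      exact ⟨Real.sqrt_le_sqrt (by linarith), hδ0⟩
  exact ⟨g, fun i => by simp [g], fun T hT k => (key T hT k).1, fun T hT k => (key T hT k).2⟩

theorem lower_order_le {Γ η q h X C : ℝ} (hη : 0 < η) (hη1 : η ≤ 1)
    (hC : 30 * (Γ + 1) * q ^ 2 ≤ C) (hX : 0 ≤ X) :
    30 * (Γ / η + 1) * (q * h) ^ 2 * X ≤ C / η * (h ^ 2 * X) := by
  have h1 : 30 * (Γ / η + 1) * q ^ 2 ≤ C / η := by
    rw [le_div_iff₀ hη]
    have e : 30 * (Γ / η + 1) * q ^ 2 * η = 30 * (Γ + η) * q ^ 2 := by field_simp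
    rw [e]
    refine le_trans (mul_le_mul_of_nonneg_right ?_ (sq_nonneg q)) hC
    linarith
  calc 30 * (Γ / η + 1) * (q * h) ^ 2 * X = 30 * (Γ / η + 1) * q ^ 2 * (h ^ 2 * X) := by ring
    _ ≤ _ := mul_le_mul_of_nonneg_right h1 (by positivity)

open Matrix in
/-- The preconditioner dominates the energy, and differs from the diffusion matrix by terms which
are small relative to the energy or of lower order. -/
theorem preconditioner_estimates {L a₀ a₁ C₁ : ℝ} (hL : 0 < L) (ha₀ : 0 < a₀) (ha₁ : 0 ≤ a₁)
    (hC₁ : 0 ≤ C₁) :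
    ∃ C : ℝ, 0 < C ∧ ∀ m : ℕ, 1 ≤ m → ∀ (A : ℤ × ℤ → ℝ) (α : Tri → ℝ)
      (Θ S : Matrix (Idx m) (Idx m) ℝ), IsAssembled L m α Θ → IsAssembled L m (fun _ => 1) S →
      (∀ T ∈ triangles m, ∀ k, a₀ ≤ A (T.vertex k)) →
      (∀ T ∈ triangles m, ∀ k, A (T.vertex k) ≤ a₁) →
      (∀ T ∈ triangles m, ∀ k, |α T - A (T.vertex k)| ≤ C₁ * meshSize L m) →
      C₁ * meshSize L m ≤ a₀ / 2 → ∀ x : Idx m → ℝ,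
      energy m (zeroExt m x) ≤ C * (x ⬝ᵥ (preconditioner Θ S *ᵥ x)) ∧
      ∀ η : ℝ, 0 < η → η ≤ 1 →
        |x ⬝ᵥ (preconditioner Θ S *ᵥ x) - x ⬝ᵥ (Θ *ᵥ x)| ≤
          (C * meshSize L m + η) * energy m (zeroExt m x) +
            C / η * (meshSize L m ^ 2 * ∑ i, x i ^ 2) := by
  set β := √(a₀ / 2) with hβdef
  have hβ : 0 < β := Real.sqrt_pos.2 (by linarith)
  set Γ := a₁ + a₀ / 2 with hΓdef
  have hΓ0 : 0 ≤ Γ := by positivity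
  set K₁ := 30 * (Γ + 1) * (2 * C₁ / β) ^ 2 with hK₁
  set K₂ := ((1 / β ^ 2 + 1) + 30 * (1 / β ^ 2 + 1) * (2 * C₁ / β ^ 3) ^ 2 * (8 * L ^ 2)) * √3
    with hK₂
  have hK₁0 : 0 ≤ K₁ := by positivity
  have hK₂0 : 0 < K₂ := by positivity
  refine ⟨2 * C₁ + K₁ + K₂, by positivity, ?_⟩
  intro m hm A α Θ S hΘ hS hA0 hA1 hα hsmall x
  have hh := meshSize_pos hL hm
  set h := meshSize L m with hhdef
  set δ := C₁ * h with hδ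
  have hδ0 : 0 ≤ δ := by positivity
  obtain ⟨g, hg1, hg2, hg3⟩ := exists_scaling hL hm hΘ hS ha₀ hA0 hα hsmall
  set w : Idx m → ℝ := fun i => √(Θ i i / S i i) * x i with hw
  have hwext : zeroExt m w = fun p => g p * zeroExt m x p := by
    ext p
    by_cases hp : p ∈ innerNodes m
    · have e1 := zeroExt_coe w ⟨p, hp⟩
      have e2 := zeroExt_coe x ⟨p, hp⟩
      have e3 := hg1 ⟨p, hp⟩
      simp only at e1 e2 e3
      rw [e1, e2, e3]
    · rw [zeroExt_of_notMem _ hp, zeroExt_of_notMem _ hp, mul_zero]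
  have h3 : (0 : ℝ) < √3 := by positivity
  have hP : x ⬝ᵥ (preconditioner Θ S *ᵥ x) = (√3)⁻¹ * energy m (zeroExt m w) := by
    rw [preconditioner_form, hS.form hL hm, energy]
    simp only [one_mul, hw]
  have hinner : ∀ p ∈ innerNodes m, g p ≠ 0 := by
    intro p hp
    have hT : ((p, true) : Tri) ∈ triangles m :=
      mem_triangles_of_vertex_mem (k := 0) (by simpa [Tri.vertex] using hp)
    have := hg2 _ hT 0
    simp only [Tri.vertex, cons_val_zero] at this
    exact (hβ.trans_le this).ne'
  have hvar : ∀ T ∈ triangles m, ∀ k, |g (T.vertex k) - g (T.vertex 0)| ≤ 2 * C₁ / β * h := by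
    intro T hT k
    refine (abs_sub_le_of_sq (ε := 4 * δ) hβ (hg2 T hT k) (hg2 T hT 0) ?_).trans (le_of_eq ?_)
    · have a1 := abs_le.1 (hg3 T hT k)
      have a2 := abs_le.1 (hg3 T hT 0)
      have a3 := abs_le.1 (hα T hT k)
      have a4 := abs_le.1 (hα T hT 0)
      rw [abs_le]; constructor <;> linarith
    · rw [hδ]; field_simp; ring
  have hsqα : ∀ T ∈ triangles m, |g (T.vertex 0) ^ 2 - α T| ≤ 2 * δ := by
    intro T hT
    have a2 := abs_le.1 (hg3 T hT 0)
    have a4 := abs_le.1 (hα T hT 0)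
    rw [abs_le]; constructor <;> linarith
  have hsqΓ : ∀ T ∈ triangles m, g (T.vertex 0) ^ 2 ≤ Γ := by
    intro T hT
    have a2 := abs_le.1 (hg3 T hT 0)
    linarith [hA1 T hT 0]
  have hE0 := energy_nonneg m (zeroExt m x)
  have hE0w := energy_nonneg m (zeroExt m w)
  constructor
  · have hx : zeroExt m x = fun p => (g p)⁻¹ * zeroExt m w p := by
      ext p
      rw [hwext]
      by_cases hp : p ∈ innerNodes m
      · simp only; rw [inv_mul_cancel_left₀ (hinner p hp)]
      · simp [zeroExt_of_notMem x hp]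
    have hginv : ∀ T ∈ triangles m, ((g (T.vertex 0))⁻¹) ^ 2 ≤ 1 / β ^ 2 := by
      intro T hT
      rw [one_div, ← inv_pow]
      have := hg2 T hT 0
      exact pow_le_pow_left₀ (inv_pos.2 (hβ.trans_le this)).le (inv_anti₀ hβ this) 2
    have hvar' : ∀ T ∈ triangles m, ∀ k,
        |(g (T.vertex k))⁻¹ - (g (T.vertex 0))⁻¹| ≤ 2 * C₁ / β ^ 3 * h := by
      intro T hT k
      have b0 := hg2 T hT 0
      have bk := hg2 T hT k
      have p0 : 0 < g (T.vertex 0) := hβ.trans_le b0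
      have pk : 0 < g (T.vertex k) := hβ.trans_le bk
      rw [inv_sub_inv pk.ne' p0.ne', abs_div, abs_of_pos (mul_pos pk p0), abs_sub_comm]
      have hden : β ^ 2 ≤ g (T.vertex k) * g (T.vertex 0) := by
        rw [sq]; exact mul_le_mul bk b0 hβ.le pk.le
      calc |g (T.vertex k) - g (T.vertex 0)| / (g (T.vertex k) * g (T.vertex 0))
          ≤ (2 * C₁ / β * h) / β ^ 2 :=
            div_le_div₀ (by positivity) (hvar T hT k) (by positivity) hden
        _ = _ := by field_simp
    have hmain := abs_energy_mul_sub_le (m := m) (g := fun p => (g p)⁻¹)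
      (α := fun T => ((g (T.vertex 0))⁻¹) ^ 2) (τ := 0) one_pos
      (by positivity : 0 ≤ 1 / β ^ 2) hvar' (fun T _ => by simp) hginv w
    rw [← hx] at hmain
    have hsum : ∑ T ∈ triangles m, ((g (T.vertex 0))⁻¹) ^ 2 * triEnergy (zeroExt m w) T ≤
        1 / β ^ 2 * energy m (zeroExt m w) := by
      rw [energy, Finset.mul_sum]
      exact Finset.sum_le_sum fun T hT =>
        mul_le_mul_of_nonneg_right (hginv T hT) (triEnergy_nonneg _ _)
    have hpoin := meshSize_sq_mul_sum_sq_le (L := L) hm w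
    have hlow : 30 * (1 / β ^ 2 / 1 + 1) * (2 * C₁ / β ^ 3 * h) ^ 2 * ∑ i, w i ^ 2 ≤
        30 * (1 / β ^ 2 + 1) * (2 * C₁ / β ^ 3) ^ 2 * (8 * L ^ 2) * energy m (zeroExt m w) := by
      calc _ = 30 * (1 / β ^ 2 + 1) * (2 * C₁ / β ^ 3) ^ 2 * (h ^ 2 * ∑ i, w i ^ 2) := by
            rw [div_one]; ring
        _ ≤ 30 * (1 / β ^ 2 + 1) * (2 * C₁ / β ^ 3) ^ 2 *
            (8 * L ^ 2 * energy m (zeroExt m w)) :=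
            mul_le_mul_of_nonneg_left hpoin (by positivity)
        _ = _ := by ring
    have h4 : energy m (zeroExt m x) ≤ K₂ * (x ⬝ᵥ (preconditioner Θ S *ᵥ x)) := by
      have e : K₂ * (x ⬝ᵥ (preconditioner Θ S *ᵥ x)) =
          ((1 / β ^ 2 + 1) + 30 * (1 / β ^ 2 + 1) * (2 * C₁ / β ^ 3) ^ 2 * (8 * L ^ 2)) *
            energy m (zeroExt m w) := by
        rw [hP, hK₂]; field_simp
      rw [e]
      linarith [(abs_le.1 hmain).2]
    have hP0 : 0 ≤ x ⬝ᵥ (preconditioner Θ S *ᵥ x) := by rw [hP]; positivity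
    refine h4.trans (mul_le_mul_of_nonneg_right ?_ hP0)
    linarith
  · intro η hη hη1
    have hmain := abs_energy_mul_sub_le (m := m) hη hΓ0 hvar hsqα hsqΓ x
    rw [← hwext] at hmain
    rw [hP, hΘ.form hL hm, ← mul_sub, abs_mul, abs_of_pos (by positivity : 0 < (√3)⁻¹)]
    have h31 : (√3)⁻¹ ≤ 1 := inv_le_one_of_one_le₀ (by
      rw [Real.one_le_sqrt]; norm_num)
    have hX : 0 ≤ ∑ i, x i ^ 2 := Finset.sum_nonneg fun _ _ => sq_nonneg _
    refine (mul_le_of_le_one_left (abs_nonneg _) h31).trans (hmain.trans ?_)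
    have c1 := lower_order_le (Γ := Γ) (q := 2 * C₁ / β) (C := 2 * C₁ + K₁ + K₂) (h := h)
      hη hη1 (by rw [← hK₁]; linarith) hX
    have c2 : (2 * δ + η) * energy m (zeroExt m x) ≤
        ((2 * C₁ + K₁ + K₂) * h + η) * energy m (zeroExt m x) := by
      refine mul_le_mul_of_nonneg_right ?_ hE0
      have : 0 ≤ (K₁ + K₂) * h := by positivity
      rw [hδ]; linarith
    linarith

/-! ### Clustering and spectral bounds from the estimates of the forms -/

theorem exists_meshSize_le (L : ℝ) {ε : ℝ} (hε : 0 < ε) :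
    ∃ M : ℕ, 1 ≤ M ∧ ∀ m, M ≤ m → meshSize L m ≤ ε := by
  have h : Filter.Tendsto (fun m : ℕ => meshSize L m) Filter.atTop (nhds 0) :=
    tendsto_const_div_atTop_nhds_zero_nat L
  obtain ⟨M, hM⟩ := Filter.eventually_atTop.1 (h.eventually_le_const hε)
  exact ⟨max M 1, le_max_right _ _, fun m hm => hM m ((le_max_left _ _).trans hm)⟩

/-- Uniform spectral bounds for large indices extend to all indices, since each single matrix has
positive eigenvalues. -/
theorem exists_uniform_eigsIn {ι : ℕ → Type*} [∀ m, Fintype (ι m)] [∀ m, DecidableEq (ι m)]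
    (P R : ∀ m, Matrix (ι m) (ι m) ℝ) {d D : ℝ} (hd : 0 < d) (m₀ : ℕ)
    (h : ∀ m, m₀ ≤ m → (P m).PosDef → (R m).PosDef → EigsIn ((P m)⁻¹ * R m) d D) :
    ∃ d D : ℝ, 0 < d ∧ ∀ m, (P m).PosDef → (R m).PosDef → EigsIn ((P m)⁻¹ * R m) d D := by
  induction m₀ generalizing d D with
  | zero => exact ⟨d, D, hd, fun m => h m (Nat.zero_le m)⟩
  | succ k ih =>
    by_cases hk : (P k).PosDef ∧ (R k).PosDef
    · obtain ⟨d', D', hd', h'⟩ := exists_eigsIn_of_posDef hk.1 hk.2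
      refine ih (d := min d d') (D := max D D') (lt_min hd hd') fun m hm hP hR => ?_
      rcases eq_or_lt_of_le hm with rfl | hlt
      · exact h'.mono (min_le_right _ _) (le_max_right _ _)
      · exact (h m hlt hP hR).mono (min_le_left _ _) (le_max_left _ _)
    · refine ih (d := d) (D := D) hd fun m hm hP hR => ?_
      rcases eq_or_lt_of_le hm with rfl | hlt
      · exact absurd ⟨hP, hR⟩ hk
      · exact h m hlt hP hR

open Matrix in
/-- The spectral conclusions for matrices given by any assembly procedure whose element weights are
`O(h)`-close to the nodal values of the diffusion coefficient and whose convection form is of lower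
order and almost nonnegative. -/
theorem spectral_conclusions {L a₀ a₁ C₁ C₂ C₃ : ℝ} (hL : 0 < L) (ha₀ : 0 < a₀) (ha₁ : 0 ≤ a₁)
    (hC₁ : 0 ≤ C₁) (hC₂ : 0 ≤ C₂) (hC₃ : 0 ≤ C₃) (A : ℕ → ℤ × ℤ → ℝ) (α : ℕ → Tri → ℝ)
    (Θ S Ψ : ∀ m, Matrix (Idx m) (Idx m) ℝ)
    (hΘ : ∀ m, 1 ≤ m → IsAssembled L m (α m) (Θ m))
    (hS : ∀ m, 1 ≤ m → IsAssembled L m (fun _ => 1) (S m))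
    (hA0 : ∀ m, 1 ≤ m → ∀ T ∈ triangles m, ∀ k, a₀ ≤ A m (T.vertex k))
    (hA1 : ∀ m, 1 ≤ m → ∀ T ∈ triangles m, ∀ k, A m (T.vertex k) ≤ a₁)
    (hα : ∀ m, 1 ≤ m → ∀ T ∈ triangles m, ∀ k, |α m T - A m (T.vertex k)| ≤ C₁ * meshSize L m)
    (hΨ1 : ∀ m, 1 ≤ m → ∀ (x : Idx m → ℝ) (η : ℝ), 0 < η → η ≤ 1 →
      |x ⬝ᵥ (Ψ m *ᵥ x)| ≤
        η * energy m (zeroExt m x) + C₂ / η * (meshSize L m ^ 2 * ∑ i, x i ^ 2))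
    (hΨ2 : ∀ m, 1 ≤ m → ∀ x : Idx m → ℝ,
      -(C₃ * meshSize L m * energy m (zeroExt m x)) ≤ x ⬝ᵥ (Ψ m *ᵥ x)) :
    (∃ m₀ : ℕ, ∀ m : ℕ, m₀ ≤ m →
      (preconditioner (Θ m) (S m)).PosDef ∧ (hermPart (Θ m + Ψ m)).PosDef) ∧
    ProperlyClusteredAt
      (fun m => (preconditioner (Θ m) (S m))⁻¹ * hermPart (Θ m + Ψ m)) 1 ∧
    ∃ d D : ℝ, 0 < d ∧ ∀ m : ℕ,
      (preconditioner (Θ m) (S m)).PosDef → (hermPart (Θ m + Ψ m)).PosDef →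
      EigsIn ((preconditioner (Θ m) (S m))⁻¹ * hermPart (Θ m + Ψ m)) d D := by
  obtain ⟨C, hC, hest⟩ := preconditioner_estimates hL ha₀ ha₁ hC₁
  set κ := (√3)⁻¹ with hκ
  have hκ0 : 0 < κ := by positivity
  -- mesh sizes for which the perturbations are dominated by the ellipticity constant
  obtain ⟨m₀, hm₀1, hm₀⟩ := exists_meshSize_le L
    (show 0 < min 1 (min (a₀ / 2 / (C₁ + 1)) (κ * (a₀ / 4) / (C₃ + 1))) by positivity)
  have hsmall1 : ∀ m, m₀ ≤ m → meshSize L m ≤ 1 := fun m hm => (hm₀ m hm).trans (min_le_left _ _)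
  have hsmall2 : ∀ m, m₀ ≤ m → C₁ * meshSize L m ≤ a₀ / 2 := by
    intro m hm
    have h1 := meshSize_pos hL (hm₀1.trans hm)
    have h2 := (hm₀ m hm).trans ((min_le_right _ _).trans (min_le_left _ _))
    rw [le_div_iff₀ (by positivity)] at h2
    linarith
  have hsmall3 : ∀ m, m₀ ≤ m → C₃ * meshSize L m ≤ κ * (a₀ / 4) := by
    intro m hm
    have h1 := meshSize_pos hL (hm₀1.trans hm)
    have h2 := (hm₀ m hm).trans ((min_le_right _ _).trans (min_le_right _ _))
    rw [le_div_iff₀ (by positivity)] at h2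
    linarith
  have hest' : ∀ m, m₀ ≤ m → ∀ x : Idx m → ℝ, _ := fun m hm =>
    hest m (hm₀1.trans hm) (A m) (α m) (Θ m) (S m) (hΘ m (hm₀1.trans hm)) (hS m (hm₀1.trans hm))
      (hA0 m (hm₀1.trans hm)) (hA1 m (hm₀1.trans hm)) (hα m (hm₀1.trans hm)) (hsmall2 m hm)
  have hRform : ∀ m (x : Idx m → ℝ), x ⬝ᵥ (hermPart (Θ m + Ψ m) *ᵥ x) =
      x ⬝ᵥ (Θ m *ᵥ x) + x ⬝ᵥ (Ψ m *ᵥ x) := by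
    intro m x
    rw [hermPart_form, add_mulVec, dotProduct_add]
  have hΘlow : ∀ m, m₀ ≤ m → ∀ x : Idx m → ℝ,
      κ * (a₀ / 2) * energy m (zeroExt m x) ≤ x ⬝ᵥ (Θ m *ᵥ x) := by
    intro m hm x
    have hm1 := hm₀1.trans hm
    rw [(hΘ m hm1).form hL hm1, mul_assoc]
    refine mul_le_mul_of_nonneg_left ?_ hκ0.le
    rw [energy, Finset.mul_sum]
    refine Finset.sum_le_sum fun T hT => mul_le_mul_of_nonneg_right ?_ (triEnergy_nonneg _ _)
    have h1 := abs_le.1 (hα m hm1 T hT 0)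
    have h2 := hA0 m hm1 T hT 0
    have h3 := hsmall2 m hm
    linarith
  have hΘup : ∀ m, m₀ ≤ m → ∀ x : Idx m → ℝ,
      x ⬝ᵥ (Θ m *ᵥ x) ≤ κ * (a₁ + a₀) * energy m (zeroExt m x) := by
    intro m hm x
    have hm1 := hm₀1.trans hm
    rw [(hΘ m hm1).form hL hm1, mul_assoc]
    refine mul_le_mul_of_nonneg_left ?_ hκ0.le
    rw [energy, Finset.mul_sum]
    refine Finset.sum_le_sum fun T hT => mul_le_mul_of_nonneg_right ?_ (triEnergy_nonneg _ _)
    have h1 := abs_le.1 (hα m hm1 T hT 0)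
    have h2 := hA1 m hm1 T hT 0
    have h3 := hsmall2 m hm
    linarith
  have hRlow : ∀ m, m₀ ≤ m → ∀ x : Idx m → ℝ,
      κ * (a₀ / 4) * energy m (zeroExt m x) ≤ x ⬝ᵥ (hermPart (Θ m + Ψ m) *ᵥ x) := by
    intro m hm x
    rw [hRform]
    have h1 := hΘlow m hm x
    have h2 := hΨ2 m (hm₀1.trans hm) x
    have h3 := mul_le_mul_of_nonneg_right (hsmall3 m hm) (energy_nonneg m (zeroExt m x))
    linarith
  have hpoin : ∀ m, m₀ ≤ m → ∀ x : Idx m → ℝ, _ := fun m hm x =>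
    meshSize_sq_mul_sum_sq_le (L := L) (hm₀1.trans hm) x
  have hPsymm : ∀ m, m₀ ≤ m → (preconditioner (Θ m) (S m)).IsHermitian := fun m hm =>
    preconditioner_isHermitian _ (hS m (hm₀1.trans hm)).isHermitian
  have hPpos : ∀ m, m₀ ≤ m → ∀ x : Idx m → ℝ, x ≠ 0 →
      0 < x ⬝ᵥ (preconditioner (Θ m) (S m) *ᵥ x) := by
    intro m hm x hx
    have h1 := (hest' m hm x).1
    have h2 := energy_pos hx
    exact pos_of_mul_pos_right (h2.trans_le h1) hC.le
  have hPosDef : ∀ m, m₀ ≤ m →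
      (preconditioner (Θ m) (S m)).PosDef ∧ (hermPart (Θ m + Ψ m)).PosDef := by
    intro m hm
    refine ⟨PosDef.of_dotProduct_mulVec_pos (hPsymm m hm) fun x hx => ?_,
      PosDef.of_dotProduct_mulVec_pos (hermPart_isHermitian _) fun x hx => ?_⟩
    · rw [star_trivial]; exact hPpos m hm x hx
    · rw [star_trivial]
      exact (mul_pos (by positivity) (energy_pos hx)).trans_le (hRlow m hm x)
  refine ⟨⟨m₀, hPosDef⟩, ?_, ?_⟩
  · classical
    intro ε hε
    set η := min 1 (ε / (8 * C)) with hη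
    have hη0 : 0 < η := by positivity
    have hη1 : η ≤ 1 := min_le_left _ _
    have hηε : η ≤ ε / (8 * C) := min_le_right _ _
    -- the number of boxes per side is chosen so that the lower order terms are absorbed
    set C₄ := (C₂ + C) / η * (36 * L ^ 2) with hC₄
    have hC₄0 : 0 ≤ C₄ := by positivity
    obtain ⟨K, hK⟩ := exists_nat_gt (max 1 (C₄ / (ε / (4 * C))))
    have hK1 : (1 : ℝ) ≤ K := ((le_max_left _ _).trans hK.le)
    have hK1' : 1 ≤ K := by exact_mod_cast hK1
    have hK0 : (0 : ℝ) < K := by linarith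
    have hKε : C₄ / (K : ℝ) ^ 2 ≤ ε / (4 * C) := by
      have h1 : C₄ / (ε / (4 * C)) < K := (le_max_right _ _).trans_lt hK
      rw [div_lt_iff₀ (by positivity)] at h1
      rw [div_le_iff₀ (by positivity)]
      have h2 : (K : ℝ) ≤ K ^ 2 := by nlinarith
      have h3 : 0 ≤ ε / (4 * C) := by positivity
      calc C₄ ≤ K * (ε / (4 * C)) := h1.le
        _ ≤ K ^ 2 * (ε / (4 * C)) := mul_le_mul_of_nonneg_right h2 h3
        _ = _ := mul_comm _ _
    obtain ⟨m₁, -, hm₁⟩ := exists_meshSize_le L (show 0 < ε / (4 * C) / C by positivity)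
    set M := max (max m₀ m₁) K with hM
    refine ⟨2 * (K * K) + ∑ m ∈ Finset.range M, Fintype.card (Idx m), fun m => ?_⟩
    rcases lt_or_ge m M with hlt | hge
    · refine (card_eigs_le _ _).trans (le_trans ?_ (Nat.le_add_left _ _))
      exact Finset.single_le_sum (f := fun m => Fintype.card (Idx m)) (fun _ _ => Nat.zero_le _)
        (Finset.mem_range.2 hlt)
    · have hmm₀ : m₀ ≤ m := (le_max_left _ _).trans ((le_max_left _ _).trans hge)
      have hmm₁ : m₁ ≤ m := (le_max_right _ _).trans ((le_max_left _ _).trans hge)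
      have hmK : K ≤ m := (le_max_right _ _).trans hge
      have hm1 := hm₀1.trans hmm₀
      have hmr : (0 : ℝ) < m := by exact_mod_cast hm1
      refine le_trans ?_ (Nat.le_add_right _ _)
      have hcard : Fintype.card (Fin K × Fin K) = K * K := by simp
      rw [← hcard]
      refine card_eigs_filter_le (hPosDef m hmm₀).1 (hermPart_isHermitian _)
        (boxSums m (2 * m / K + 1) K) (fun x hx hx0 => ?_) _ fun z hz => hz
      have hbox := sum_sq_le_energy_of_boxSums_eq_zero hK1' hmK x hx
      have hE := energy_pos hx0
      have hM2 : meshSize L m ^ 2 * ∑ i, x i ^ 2 ≤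
          36 * L ^ 2 / (K : ℝ) ^ 2 * energy m (zeroExt m x) := by
        calc _ ≤ meshSize L m ^ 2 * (36 * (m / K : ℝ) ^ 2 * energy m (zeroExt m x)) :=
              mul_le_mul_of_nonneg_left hbox (sq_nonneg _)
          _ = _ := by rw [meshSize]; field_simp
      have h1 := (hest' m hmm₀ x).2 η hη0 hη1
      have h2 := hΨ1 m hm1 x η hη0 hη1
      have h3 : |x ⬝ᵥ (hermPart (Θ m + Ψ m) *ᵥ x) - x ⬝ᵥ (preconditioner (Θ m) (S m) *ᵥ x)| ≤
          (C * meshSize L m + 2 * η) * energy m (zeroExt m x) +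
            (C₂ + C) / η * (meshSize L m ^ 2 * ∑ i, x i ^ 2) := by
        rw [hRform]
        rw [abs_le] at h1 h2 ⊢
        have e : (C₂ + C) / η * (meshSize L m ^ 2 * ∑ i, x i ^ 2) =
            C₂ / η * (meshSize L m ^ 2 * ∑ i, x i ^ 2) +
            C / η * (meshSize L m ^ 2 * ∑ i, x i ^ 2) := by ring
        rw [e]
        constructor <;> linarith
      have h4 : (C₂ + C) / η * (meshSize L m ^ 2 * ∑ i, x i ^ 2) ≤
          ε / (4 * C) * energy m (zeroExt m x) := by
        calc _ ≤ (C₂ + C) / η * (36 * L ^ 2 / (K : ℝ) ^ 2 * energy m (zeroExt m x)) :=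
              mul_le_mul_of_nonneg_left hM2 (by positivity)
          _ = C₄ / (K : ℝ) ^ 2 * energy m (zeroExt m x) := by rw [hC₄]; ring
          _ ≤ _ := mul_le_mul_of_nonneg_right hKε hE.le
      have h5 : C * meshSize L m ≤ ε / (4 * C) := by
        have := hm₁ m hmm₁
        rwa [le_div_iff₀ hC, mul_comm] at this
      have h6 : 2 * η ≤ ε / (4 * C) := by
        have : ε / (4 * C) = 2 * (ε / (8 * C)) := by field_simp; norm_num
        linarith
      have h7 : (C * meshSize L m + 2 * η) * energy m (zeroExt m x) ≤
          (2 * (ε / (4 * C))) * energy m (zeroExt m x) :=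
        mul_le_mul_of_nonneg_right (by linarith) hE.le
      have h8 : 0 < ε / (4 * C) * energy m (zeroExt m x) := by positivity
      have h9 : 4 * (ε / (4 * C) * energy m (zeroExt m x)) = ε / C * energy m (zeroExt m x) := by
        field_simp
      have h10 : ε / C * energy m (zeroExt m x) ≤
          ε * (x ⬝ᵥ (preconditioner (Θ m) (S m) *ᵥ x)) := by
        calc ε / C * energy m (zeroExt m x) ≤
            ε / C * (C * (x ⬝ᵥ (preconditioner (Θ m) (S m) *ᵥ x))) :=
              mul_le_mul_of_nonneg_left (hest' m hmm₀ x).1 (by positivity)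
          _ = _ := by field_simp
      linarith
  · set U := κ * (a₁ + a₀) + 1 + C₂ * (8 * L ^ 2) with hU
    have hU0 : 0 < U := by positivity
    set V := κ * (a₁ + a₀) + (C + 1) + C * (8 * L ^ 2) with hV
    have hV0 : 0 < V := by positivity
    have hRup : ∀ m, m₀ ≤ m → ∀ x : Idx m → ℝ,
        x ⬝ᵥ (hermPart (Θ m + Ψ m) *ᵥ x) ≤ U * energy m (zeroExt m x) := by
      intro m hm x
      rw [hRform]
      have h1 := hΘup m hm x
      have h2 := (abs_le.1 (hΨ1 m (hm₀1.trans hm) x 1 one_pos le_rfl)).2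
      rw [div_one] at h2
      have h3 := mul_le_mul_of_nonneg_left (hpoin m hm x) hC₂
      rw [hU]
      linarith
    have hPup : ∀ m, m₀ ≤ m → ∀ x : Idx m → ℝ,
        x ⬝ᵥ (preconditioner (Θ m) (S m) *ᵥ x) ≤ V * energy m (zeroExt m x) := by
      intro m hm x
      have h1 := hΘup m hm x
      have h2 := (abs_le.1 ((hest' m hm x).2 1 one_pos le_rfl)).2
      rw [div_one] at h2
      have h3 := mul_le_mul_of_nonneg_left (hpoin m hm x) hC.le
      have h4 : C * meshSize L m * energy m (zeroExt m x) ≤ C * energy m (zeroExt m x) := by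
        refine mul_le_mul_of_nonneg_right ?_ (energy_nonneg _ _)
        exact mul_le_of_le_one_right hC.le (hsmall1 m hm)
      rw [hV]
      linarith
    refine exists_uniform_eigsIn _ _ (d := κ * (a₀ / 4) / V) (D := U * C) (by positivity) m₀
      fun m hm hP hR => eigsIn_of_form_bounds hP hR.1 (fun x => ?_) fun x => ?_
    · calc _ ≤ κ * (a₀ / 4) / V * (V * energy m (zeroExt m x)) :=
            mul_le_mul_of_nonneg_left (hPup m hm x) (by positivity)
        _ = κ * (a₀ / 4) * energy m (zeroExt m x) := by field_simp
        _ ≤ _ := hRlow m hm x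
    · calc _ ≤ U * energy m (zeroExt m x) := hRup m hm x
        _ ≤ U * (C * (x ⬝ᵥ (preconditioner (Θ m) (S m) *ᵥ x))) :=
            mul_le_mul_of_nonneg_left (hest' m hm x).1 hU0.le
        _ = _ := by ring

/-! ### Matrices with exact integrals -/

theorem continuousOn_integrableOn_openTri {L : ℝ} (hL : 0 < L) {m : ℕ} (hm : 1 ≤ m) (c : ℝ × ℝ)
    {T : Tri} {f : ℝ × ℝ → ℝ} (hf : ContinuousOn f (triSet c L m T)) :
    IntegrableOn f (openTri c L m T) :=
  (hf.integrableOn_compact (isCompact_triSet c L m T)).mono_set (openTri_subset_triSet hL hm c T)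

/-- Mean values over a triangle of a function which is `ε`-close to a constant. -/
theorem abs_setIntegral_openTri_sub_le {L : ℝ} (hL : 0 < L) {m : ℕ} (hm : 1 ≤ m) (c : ℝ × ℝ)
    {T : Tri} {f : ℝ × ℝ → ℝ} (hf : IntegrableOn f (openTri c L m T)) {r ε : ℝ}
    (h : ∀ x ∈ openTri c L m T, |f x - r| ≤ ε) :
    |(∫ x in openTri c L m T, f x) - triArea L m * r| ≤ ε * triArea L m := by
  have hvol := volume_openTri hL hm c T
  have hlt : volume (openTri c L m T) < ⊤ := by rw [hvol]; exact ENNReal.ofReal_lt_top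
  rw [← setIntegral_openTri_const hL hm c T r, ← integral_sub hf (integrableOn_const hlt.ne)]
  have := norm_setIntegral_le_of_norm_le_const hlt (fun x hx => (Real.norm_eq_abs _).le.trans (h x hx))
  rwa [measureReal_def, hvol, ENNReal.toReal_ofReal (triArea_pos hL hm).le] at this

/-- The exact diffusion matrix is assembled with the mean values of the coefficient. -/
theorem diffusionMatrix_isAssembled {L : ℝ} (hL : 0 < L) {m : ℕ} (hm : 1 ≤ m) (c : ℝ × ℝ)
    {a : ℝ × ℝ → ℝ} (ha : ContinuousOn a (closedHexagon c L)) :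
    IsAssembled L m (fun T => (∫ x in openTri c L m T, a x) / triArea L m)
      (diffusionMatrix c L a m) := by
  intro i j
  have hA := triArea_pos hL hm
  have hpt : ∀ T, ∀ x ∈ openTri c L m T, a x * dot (grad (hat c L m j.1) x) (grad (hat c L m i.1) x)
      = a x * dot (interpGrad L m (Pi.single j.1 1) T) (interpGrad L m (Pi.single i.1 1) T) := by
    intro T x hx
    rw [grad_hat hL hm c hx, grad_hat hL hm c hx]
  have haT : ∀ T ∈ triangles m, IntegrableOn a (openTri c L m T) := fun T hT =>
    continuousOn_integrableOn_openTri hL hm c (ha.mono (triSet_subset_closedHexagon hL hm c hT))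
  rw [diffusionMatrix, Matrix.of_apply, setIntegral_hexagon hL hm]
  · refine Finset.sum_congr rfl fun T _ => ?_
    rw [setIntegral_congr_fun (isOpen_openTri c L m T).measurableSet (hpt T), integral_mul_const,
      mul_div_cancel₀ _ hA.ne']
  · intro T hT
    refine IntegrableOn.congr_fun ?_ (fun x hx => (hpt T x hx).symm)
      (isOpen_openTri c L m T).measurableSet
    exact (haT T hT).mul_const _

theorem diffusionMatrix_one_isAssembled {L : ℝ} (hL : 0 < L) {m : ℕ} (hm : 1 ≤ m) (c : ℝ × ℝ) :
    IsAssembled L m (fun _ => 1) (diffusionMatrix c L (fun _ => 1) m) := by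
  have h := diffusionMatrix_isAssembled hL hm c (a := fun _ => 1) continuousOn_const
  have e : (fun T => (∫ _ in openTri c L m T, (1 : ℝ)) / triArea L m) = fun _ => 1 := by
    ext T
    rw [setIntegral_openTri_const hL hm, mul_one, div_self (triArea_pos hL hm).ne']
  rwa [e] at h

theorem node_mem_triSet (c : ℝ × ℝ) (L : ℝ) (m : ℕ) (T : Tri) (k : Fin 3) :
    node c L m (T.vertex k) ∈ triSet c L m T :=
  subset_convexHull ℝ _ ⟨k, rfl⟩

theorem abs_sub_le_of_mem_triSet {F : Type*} [NormedAddCommGroup F] {f : ℝ × ℝ → F}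
    {c : ℝ × ℝ} {L : ℝ} (hL : 0 < L) {m : ℕ} (hm : 1 ≤ m) {K : NNReal}
    (hf : LipschitzOnWith K f (closedHexagon c L)) {T : Tri} (hT : T ∈ triangles m) {x y : ℝ × ℝ}
    (hx : x ∈ triSet c L m T) (hy : y ∈ triSet c L m T) :
    ‖f x - f y‖ ≤ 2 * K * meshSize L m := by
  have hsub := triSet_subset_closedHexagon hL hm c hT
  have h1 := hf.dist_le_mul _ (hsub hx) _ (hsub hy)
  rw [dist_eq_norm, dist_eq_norm] at h1
  refine h1.trans ((mul_le_mul_of_nonneg_left (norm_sub_le_of_mem_triSet hL hm c hx hy)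
    K.coe_nonneg).trans (le_of_eq (by ring)))

/-! ### The finite element function of a vector of nodal values -/

/-- The finite element function with nodal values `x`. -/
def femFun (c : ℝ × ℝ) (L : ℝ) (m : ℕ) (x : Idx m → ℝ) (y : ℝ × ℝ) : ℝ :=
  ∑ i, x i * hat c L m i.1 y

theorem femFun_eq_sum_bary {L : ℝ} (hL : 0 < L) {m : ℕ} (hm : 1 ≤ m) (c : ℝ × ℝ) {T : Tri}
    {y : ℝ × ℝ} (hy : y ∈ triSet c L m T) (x : Idx m → ℝ) :
    femFun c L m x y = ∑ k, zeroExt m x (T.vertex k) * bary c L m T y k := by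
  have hy' := (mem_triSet_iff hL hm c T y).1 hy
  simp only [femFun, hat_eq_sum_bary hL hm c hy', Finset.mul_sum]
  rw [Finset.sum_comm]
  refine Finset.sum_congr rfl fun k _ => ?_
  rw [← sum_smul_single, Finset.sum_mul]
  refine Finset.sum_congr rfl fun i _ => ?_
  rw [Pi.single_apply, mul_assoc]

/-- The value of a convex combination of the vertex values is bounded by Cauchy–Schwarz. -/
theorem femFun_sq_le {L : ℝ} (hL : 0 < L) {m : ℕ} (hm : 1 ≤ m) (c : ℝ × ℝ) {T : Tri}
    {y : ℝ × ℝ} (hy : y ∈ triSet c L m T) (x : Idx m → ℝ) :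
    femFun c L m x y ^ 2 ≤ triMass (zeroExt m x) T := by
  have hy' := (mem_triSet_iff hL hm c T y).1 hy
  have hs := sum_bary c L m T y
  rw [femFun_eq_sum_bary hL hm c hy, triMass]
  have h1 : ∀ k, bary c L m T y k ^ 2 ≤ bary c L m T y k := by
    intro k
    have : bary c L m T y k ≤ 1 := by
      rw [← hs]; exact Finset.single_le_sum (fun l _ => hy' l) (Finset.mem_univ k)
    nlinarith [hy' k]
  calc (∑ k, zeroExt m x (T.vertex k) * bary c L m T y k) ^ 2
      ≤ (∑ k, zeroExt m x (T.vertex k) ^ 2) * ∑ k, bary c L m T y k ^ 2 :=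
        Finset.sum_mul_sq_le_sq_mul_sq _ _ _
    _ ≤ (∑ k, zeroExt m x (T.vertex k) ^ 2) * 1 := by
        refine mul_le_mul_of_nonneg_left ?_ (Finset.sum_nonneg fun _ _ => sq_nonneg _)
        rw [← hs]
        exact Finset.sum_le_sum fun k _ => h1 k
    _ = _ := mul_one _

theorem femFun_sub {L : ℝ} (hL : 0 < L) {m : ℕ} (hm : 1 ≤ m) (c : ℝ × ℝ) {T : Tri}
    {y z : ℝ × ℝ} (hy : y ∈ triSet c L m T) (hz : z ∈ triSet c L m T) (x : Idx m → ℝ) :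
    femFun c L m x y - femFun c L m x z = dot (interpGrad L m (zeroExt m x) T) (y - z) := by
  rw [femFun_eq_sum_bary hL hm c hy, femFun_eq_sum_bary hL hm c hz, interpGrad, dot_sum_smul_left,
    ← Finset.sum_sub_distrib]
  refine Finset.sum_congr rfl fun k _ => ?_
  rw [bary_add_sub c L m T z y k]
  ring

theorem continuous_hat (c : ℝ × ℝ) (L : ℝ) (m : ℕ) (p : ℤ × ℤ) : Continuous (hat c L m p) := by
  unfold hat
  have := continuous_hexGauge
  fun_prop

theorem continuous_femFun (c : ℝ × ℝ) (L : ℝ) (m : ℕ) (x : Idx m → ℝ) :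
    Continuous (femFun c L m x) :=
  continuous_finsetSum _ fun i _ => continuous_const.mul (continuous_hat c L m i.1)

theorem exists_lipschitzWith_hat (c : ℝ × ℝ) (L : ℝ) (m : ℕ) (p : ℤ × ℤ) :
    ∃ K, LipschitzWith K (hat c L m p) := by
  have habs : ∀ {K : NNReal} {f : ℝ × ℝ → ℝ}, LipschitzWith K f → LipschitzWith K fun x => |f x| :=
    fun {K f} hf => LipschitzWith.of_dist_le_mul fun x y =>
      (abs_abs_sub_abs_le_abs_sub _ _).trans (hf.dist_le_mul x y)
  have hS := (ContinuousLinearMap.fst ℝ ℝ ℝ + (√3)⁻¹ • ContinuousLinearMap.snd ℝ ℝ ℝ).lipschitz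
  have eS : ⇑(ContinuousLinearMap.fst ℝ ℝ ℝ + (√3)⁻¹ • ContinuousLinearMap.snd ℝ ℝ ℝ) =
      coordS := by
    ext x; simp [coordS]; ring
  have hT := ((2 / √3) • ContinuousLinearMap.snd ℝ ℝ ℝ).lipschitz
  have eT : ⇑((2 / √3) • ContinuousLinearMap.snd ℝ ℝ ℝ) = coordT := by
    ext x; simp [coordT]; ring
  rw [eS] at hS
  rw [eT] at hT
  have hG : LipschitzWith _ hexGauge := (habs hS).max ((habs hT).max (habs (hS.sub hT)))
  have hA : LipschitzWith (‖(meshSize L m)⁻¹‖₊ * 1)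
      (fun x : ℝ × ℝ => (meshSize L m)⁻¹ • (x - node c L m p)) := by
    refine LipschitzWith.of_dist_le_mul fun x y => ?_
    rw [dist_smul₀, dist_sub_right, mul_one, coe_nnnorm]
  exact ⟨_, ((LipschitzWith.const (1 : ℝ)).sub (hG.comp hA)).const_max 0⟩

theorem exists_lipschitzWith_femFun (c : ℝ × ℝ) (L : ℝ) (m : ℕ) (x : Idx m → ℝ) :
    ∃ K, LipschitzWith K (femFun c L m x) := by
  have h : ∀ s : Finset (Idx m), ∃ K, LipschitzWith K fun y => ∑ i ∈ s, x i * hat c L m i.1 y := by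
    classical
    intro s
    induction s using Finset.induction_on with
    | empty => exact ⟨0, by simp⟩
    | insert i s hi ih =>
      obtain ⟨K, hK⟩ := ih
      obtain ⟨K', hK'⟩ := exists_lipschitzWith_hat c L m i.1
      have h1 : LipschitzWith (‖x i‖₊ * K') fun y => x i * hat c L m i.1 y := by
        refine LipschitzWith.of_dist_le_mul fun y z => ?_
        rw [Real.dist_eq, ← mul_sub, abs_mul, NNReal.coe_mul, coe_nnnorm, Real.norm_eq_abs, mul_assoc]
        exact mul_le_mul_of_nonneg_left (hK'.dist_le_mul y z) (abs_nonneg _)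
      exact ⟨_, by simpa only [Finset.sum_insert hi] using h1.add hK⟩
  exact h Finset.univ

theorem hat_eq_zero_of_notMem_hexagon {L : ℝ} (hL : 0 < L) {m : ℕ} (hm : 1 ≤ m) (c : ℝ × ℝ)
    {p : ℤ × ℤ} (hp : p ∈ innerNodes m) {y : ℝ × ℝ} (hy : y ∉ hexagon c L) :
    hat c L m p y = 0 := by
  rw [hat, hexGauge_smul_sub_node hL hm]
  by_contra hne
  apply hy
  have hlt : max |latS c L m y - p.1| (max |latT c L m y - p.2|
      |(latS c L m y - p.1) - (latT c L m y - p.2)|) < 1 := by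
    by_contra! h
    exact hne (max_eq_left (by linarith))
  rw [max_lt_iff, max_lt_iff, abs_lt, abs_lt, abs_lt] at hlt
  obtain ⟨⟨h1, h2⟩, ⟨h3, h4⟩, h5, h6⟩ := hlt
  rw [mem_innerNodes, abs_lt, abs_lt, abs_lt] at hp
  obtain ⟨⟨p1, p2⟩, ⟨p3, p4⟩, p5, p6⟩ := hp
  have cast_lo : ∀ z : ℤ, -(m : ℤ) < z → -(m : ℝ) + 1 ≤ z := by
    intro z hz
    have : -(m : ℤ) + 1 ≤ z := by omega
    exact_mod_cast this
  have cast_hi : ∀ z : ℤ, z < (m : ℤ) → (z : ℝ) + 1 ≤ m := by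
    intro z hz
    have : z + 1 ≤ (m : ℤ) := by omega
    exact_mod_cast this
  have q1 := cast_lo _ p1
  have q2 := cast_hi _ p2
  have q3 := cast_lo _ p3
  have q4 := cast_hi _ p4
  have q5 := cast_lo _ p5
  have q6 := cast_hi _ p6
  push_cast at q5 q6
  rw [mem_hexagon_iff hL hm, abs_lt, abs_lt, abs_lt]
  refine ⟨⟨?_, ?_⟩, ⟨?_, ?_⟩, ?_, ?_⟩ <;> linarith

theorem femFun_eq_zero_of_notMem_hexagon {L : ℝ} (hL : 0 < L) {m : ℕ} (hm : 1 ≤ m) (c : ℝ × ℝ)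
    (x : Idx m → ℝ) {y : ℝ × ℝ} (hy : y ∉ hexagon c L) : femFun c L m x y = 0 :=
  Finset.sum_eq_zero fun i _ => by rw [hat_eq_zero_of_notMem_hexagon hL hm c i.2 hy, mul_zero]

theorem hasCompactSupport_femFun {L : ℝ} (hL : 0 < L) {m : ℕ} (hm : 1 ≤ m) (c : ℝ × ℝ)
    (x : Idx m → ℝ) : HasCompactSupport (femFun c L m x) :=
  HasCompactSupport.intro (isCompact_closedHexagon c L) fun _ hy =>
    femFun_eq_zero_of_notMem_hexagon hL hm c x fun h => hy (hexagon_subset_closedHexagon c L h)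

theorem sum_smul_grad_hat {L : ℝ} (hL : 0 < L) {m : ℕ} (hm : 1 ≤ m) (c : ℝ × ℝ) {T : Tri}
    {y : ℝ × ℝ} (hy : y ∈ openTri c L m T) (x : Idx m → ℝ) :
    ∑ i, x i • grad (hat c L m i.1) y = interpGrad L m (zeroExt m x) T := by
  rw [← sum_smul_interpGrad_single]
  exact Finset.sum_congr rfl fun i _ => by rw [grad_hat hL hm c hy]

theorem grad_femFun {L : ℝ} (hL : 0 < L) {m : ℕ} (hm : 1 ≤ m) (c : ℝ × ℝ) {T : Tri}
    {y : ℝ × ℝ} (hy : y ∈ openTri c L m T) (x : Idx m → ℝ) :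
    DifferentiableAt ℝ (femFun c L m x) y ∧
      grad (femFun c L m x) y = interpGrad L m (zeroExt m x) T := by
  have h : HasFDerivAt (femFun c L m x) (∑ i, x i • fderiv ℝ (hat c L m i.1) y) y :=
    HasFDerivAt.fun_sum fun i _ =>
      ((hasFDerivAt_hat hL hm c hy i.1).differentiableAt.hasFDerivAt).const_mul _
  refine ⟨h.differentiableAt, ?_⟩
  rw [← sum_smul_grad_hat hL hm c hy, grad, h.fderiv]
  ext <;> simp [grad, Prod.fst_sum, Prod.snd_sum, sum_apply]

/-! ### The convection form with exact integrals -/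

theorem continuousOn_dot {b : ℝ × ℝ → ℝ × ℝ} {s : Set (ℝ × ℝ)} (hb : ContinuousOn b s)
    (v : ℝ × ℝ) : ContinuousOn (fun y => dot (b y) v) s := by
  unfold dot
  fun_prop

open Matrix in
/-- The quadratic form of the exact convection matrix, triangle by triangle. -/
theorem convectionMatrix_form {L : ℝ} (hL : 0 < L) {m : ℕ} (hm : 1 ≤ m) (c : ℝ × ℝ)
    {b : ℝ × ℝ → ℝ × ℝ} (hb : ContinuousOn b (closedHexagon c L)) (x : Idx m → ℝ) :
    x ⬝ᵥ (convectionMatrix c L b m *ᵥ x) = -∑ T ∈ triangles m, ∫ y in openTri c L m T,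
      dot (b y) (interpGrad L m (zeroExt m x) T) * femFun c L m x y := by
  have hint : ∀ T ∈ triangles m, ∀ i j : Idx m, IntegrableOn
      (fun y => dot (b y) (interpGrad L m (Pi.single i.1 1) T) * hat c L m j.1 y)
      (openTri c L m T) := fun T hT i j =>
    continuousOn_integrableOn_openTri hL hm c
      ((continuousOn_dot (hb.mono (triSet_subset_closedHexagon hL hm c hT)) _).mul
        (continuous_hat c L m j.1).continuousOn)
  have hentry : ∀ i j, convectionMatrix c L b m i j = -∑ T ∈ triangles m,
      ∫ y in openTri c L m T, dot (b y) (interpGrad L m (Pi.single i.1 1) T) * hat c L m j.1 y := by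
    intro i j
    have hpt : ∀ T, ∀ y ∈ openTri c L m T, dot (b y) (grad (hat c L m i.1) y) * hat c L m j.1 y =
        dot (b y) (interpGrad L m (Pi.single i.1 1) T) * hat c L m j.1 y := fun T y hy => by
      rw [grad_hat hL hm c hy]
    rw [convectionMatrix, of_apply, setIntegral_hexagon hL hm]
    · congr 1
      exact Finset.sum_congr rfl fun T _ =>
        setIntegral_congr_fun (isOpen_openTri c L m T).measurableSet (hpt T)
    · exact fun T hT => (hint T hT i j).congr_fun (fun y hy => (hpt T y hy).symm)
        (isOpen_openTri c L m T).measurableSet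
  have hT : ∀ T ∈ triangles m, ∫ y in openTri c L m T,
      dot (b y) (interpGrad L m (zeroExt m x) T) * femFun c L m x y =
      ∑ i, ∑ j, x i * x j * ∫ y in openTri c L m T,
        dot (b y) (interpGrad L m (Pi.single i.1 1) T) * hat c L m j.1 y := by
    intro T hT
    have e : ∀ y, dot (b y) (interpGrad L m (zeroExt m x) T) * femFun c L m x y =
        ∑ i, ∑ j, x i * x j *
          (dot (b y) (interpGrad L m (Pi.single i.1 1) T) * hat c L m j.1 y) := by
      intro y
      rw [← sum_smul_interpGrad_single, dot_comm, dot_sum_smul_left, femFun, Finset.sum_mul_sum]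
      refine Finset.sum_congr rfl fun i _ => Finset.sum_congr rfl fun j _ => ?_
      rw [dot_comm]; ring
    simp only [e]
    rw [integral_finsetSum _ fun i _ => integrable_finsetSum _ fun j _ =>
      (hint T hT i j).const_mul _]
    refine Finset.sum_congr rfl fun i _ => ?_
    rw [integral_finsetSum _ fun j _ => (hint T hT i j).const_mul _]
    exact Finset.sum_congr rfl fun j _ => integral_const_mul _ _
  rw [Finset.sum_congr rfl hT]
  simp only [dotProduct, mulVec, hentry, Finset.mul_sum, neg_mul, mul_neg, Finset.sum_neg_distrib,
    Finset.sum_mul]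
  congr 1
  rw [Finset.sum_congr rfl fun i _ => Finset.sum_comm, Finset.sum_comm]
  refine Finset.sum_congr rfl fun T _ => Finset.sum_congr rfl fun i _ =>
    Finset.sum_congr rfl fun j _ => by ring

/-- Young's inequality for the integrand of the convection form. -/
theorem abs_dot_mul_le (b g : ℝ × ℝ) {u V η : ℝ} (hη : 0 < η) (hu : u ^ 2 ≤ V) :
    |dot b g * u| ≤ η * dot g g + dot b b / (4 * η) * V := by
  have hcs : dot b g ^ 2 ≤ dot b b * dot g g := by
    simp only [dot]; nlinarith [sq_nonneg (b.1 * g.2 - b.2 * g.1)]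
  have hg : 0 ≤ dot g g := by simp only [dot]; nlinarith [sq_nonneg g.1, sq_nonneg g.2]
  have hbb : 0 ≤ dot b b := by simp only [dot]; nlinarith [sq_nonneg b.1, sq_nonneg b.2]
  have hV : 0 ≤ V := (sq_nonneg u).trans hu
  have h1 : (dot b g * u) ^ 2 ≤ (η * dot g g + dot b b / (4 * η) * V) ^ 2 := by
    calc (dot b g * u) ^ 2 = dot b g ^ 2 * u ^ 2 := by ring
      _ ≤ (dot b b * dot g g) * V := mul_le_mul hcs hu (sq_nonneg _) (by positivity)
      _ = 4 * (η * dot g g) * (dot b b / (4 * η) * V) := by field_simp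
      _ ≤ _ := by nlinarith [sq_nonneg (η * dot g g - dot b b / (4 * η) * V)]
  exact abs_le_of_sq_le_sq h1 (by positivity)

theorem dot_self_le {b : ℝ × ℝ} {B : ℝ} (hb : ‖b‖ ≤ B) : dot b b ≤ 2 * B ^ 2 := by
  rw [Prod.norm_def, max_le_iff, Real.norm_eq_abs, Real.norm_eq_abs] at hb
  have h1 : b.1 ^ 2 ≤ B ^ 2 := sq_le_sq' (by linarith [abs_le.1 hb.1]) (abs_le.1 hb.1).2
  have h2 : b.2 ^ 2 ≤ B ^ 2 := sq_le_sq' (by linarith [abs_le.1 hb.2]) (abs_le.1 hb.2).2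
  simp only [dot]
  nlinarith

theorem triArea_le {L : ℝ} (m : ℕ) : triArea L m ≤ meshSize L m ^ 2 := by
  have h33 : √3 ≤ 4 := by rw [Real.sqrt_le_left (by norm_num)]; norm_num
  rw [triArea]
  have := sq_nonneg (meshSize L m)
  nlinarith

/-- Summing a bound by gradient and vertex values over the triangles. -/
theorem sum_le_energy_add_mass {L : ℝ} (hL : 0 < L) {m : ℕ} (hm : 1 ≤ m) (x : Idx m → ℝ)
    {f : Tri → ℝ} {p q : ℝ} (hp : 0 ≤ p) (hq : 0 ≤ q)
    (hf : ∀ T ∈ triangles m, |f T| ≤ triArea L m *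
      (p * dot (interpGrad L m (zeroExt m x) T) (interpGrad L m (zeroExt m x) T) +
        q * triMass (zeroExt m x) T)) :
    |∑ T ∈ triangles m, f T| ≤
      p * energy m (zeroExt m x) + 6 * q * (meshSize L m ^ 2 * ∑ i, x i ^ 2) := by
  have h31 : (√3)⁻¹ ≤ 1 := inv_le_one_of_one_le₀ (by
    rw [Real.one_le_sqrt]; norm_num)
  have hT : ∀ T ∈ triangles m, |f T| ≤ p * triEnergy (zeroExt m x) T +
      q * meshSize L m ^ 2 * triMass (zeroExt m x) T := by
    intro T hT
    refine (hf T hT).trans ?_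
    rw [mul_add, mul_left_comm, triArea_mul_dot_interpGrad hL hm]
    refine add_le_add (mul_le_mul_of_nonneg_left ?_ hp) ?_
    · exact mul_le_of_le_one_left (triEnergy_nonneg _ _) h31
    · rw [← mul_assoc, mul_comm (triArea L m)]
      exact mul_le_mul_of_nonneg_right (mul_le_mul_of_nonneg_left (triArea_le m) hq)
        (triMass_nonneg _ _)
  refine (Finset.abs_sum_le_sum_abs _ _).trans ((Finset.sum_le_sum hT).trans ?_)
  rw [Finset.sum_add_distrib, ← Finset.mul_sum, ← Finset.mul_sum, energy]
  have := mul_le_mul_of_nonneg_left (sum_triMass_zeroExt_le x)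
    (show 0 ≤ q * meshSize L m ^ 2 by positivity)
  linarith

open Matrix in
/-- The exact convection form is of lower order with respect to the energy. -/
theorem abs_convectionMatrix_form_le {L : ℝ} (hL : 0 < L) {m : ℕ} (hm : 1 ≤ m) (c : ℝ × ℝ)
    {b : ℝ × ℝ → ℝ × ℝ} (hb : ContinuousOn b (closedHexagon c L)) {B : ℝ}
    (hB : ∀ y ∈ closedHexagon c L, ‖b y‖ ≤ B) (x : Idx m → ℝ) {η : ℝ} (hη : 0 < η) :
    |x ⬝ᵥ (convectionMatrix c L b m *ᵥ x)| ≤ η * energy m (zeroExt m x) +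
      3 * B ^ 2 / η * (meshSize L m ^ 2 * ∑ i, x i ^ 2) := by
  rw [convectionMatrix_form hL hm c hb, abs_neg]
  refine (sum_le_energy_add_mass hL hm x (p := η) (q := 2 * B ^ 2 / (4 * η)) hη.le
    (by positivity) fun T hT => ?_).trans (le_of_eq (by field_simp; ring))
  have hsub := triSet_subset_closedHexagon hL hm c hT
  have hvol := volume_openTri hL hm c T
  have hlt : volume (openTri c L m T) < ⊤ := by rw [hvol]; exact ENNReal.ofReal_lt_top
  have h := norm_setIntegral_le_of_norm_le_const (μ := volume) (f := fun y =>
    dot (b y) (interpGrad L m (zeroExt m x) T) * femFun c L m x y) hlt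
    (C := η * dot (interpGrad L m (zeroExt m x) T) (interpGrad L m (zeroExt m x) T) +
        2 * B ^ 2 / (4 * η) * triMass (zeroExt m x) T) (fun y hy => by
      have hy' := openTri_subset_triSet hL hm c T hy
      rw [Real.norm_eq_abs]
      refine (abs_dot_mul_le _ _ hη (femFun_sq_le hL hm c hy' x)).trans ?_
      have h1 := dot_self_le (hB y (hsub hy'))
      have h2 := triMass_nonneg (zeroExt m x) T
      gcongr)
  rw [measureReal_def, hvol, ENNReal.toReal_ofReal (triArea_pos hL hm).le, Real.norm_eq_abs] at h
  rw [mul_comm (triArea L m)]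
  exact h

/-! ### Nonnegativity of the exact convection form -/

theorem exists_lipschitzWith_femFun_sq {L : ℝ} (hL : 0 < L) {m : ℕ} (hm : 1 ≤ m) (c : ℝ × ℝ)
    (x : Idx m → ℝ) : ∃ K, LipschitzWith K fun y => femFun c L m x y * femFun c L m x y := by
  obtain ⟨K, hK⟩ := exists_lipschitzWith_femFun c L m x
  obtain ⟨C, hC⟩ := (hasCompactSupport_femFun hL hm c x).exists_bound_of_continuous
    (continuous_femFun c L m x)
  have hC0 : 0 ≤ C := (norm_nonneg _).trans (hC 0)
  refine ⟨2 * C.toNNReal * K, LipschitzWith.of_dist_le_mul fun y z => ?_⟩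
  have h1 := hK.dist_le_mul y z
  rw [Real.dist_eq] at h1 ⊢
  have e : femFun c L m x y * femFun c L m x y - femFun c L m x z * femFun c L m x z =
      (femFun c L m x y + femFun c L m x z) * (femFun c L m x y - femFun c L m x z) := by ring
  rw [e, abs_mul]
  have h2 : |femFun c L m x y + femFun c L m x z| ≤ 2 * C := by
    have := hC y
    have := hC z
    rw [Real.norm_eq_abs] at *
    exact (abs_add_le _ _).trans (by linarith)
  calc _ ≤ 2 * C * (K * dist y z) := mul_le_mul h2 h1 (abs_nonneg _) (by positivity)
    _ = _ := by
      push_cast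
      rw [Real.coe_toNNReal _ hC0]
      ring

/-- Integration by parts in the direction `v`: the boundary terms vanish with the finite element
function `u`, and only the Lipschitz continuity of the coefficient is needed. -/
theorem integral_lineDeriv_mul_femFun_sq {L : ℝ} (hL : 0 < L) {m : ℕ} (hm : 1 ≤ m) (c : ℝ × ℝ)
    (x : Idx m → ℝ) {f : ℝ × ℝ → ℝ} {K : NNReal} (hf : LipschitzWith K f) (v : ℝ × ℝ) :
    ∫ y, lineDeriv ℝ f y v * (femFun c L m x y * femFun c L m x y) =
      -∫ y, 2 * (femFun c L m x y * fderiv ℝ (femFun c L m x) y v * f y) := by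
  obtain ⟨K', hK'⟩ := exists_lipschitzWith_femFun_sq hL hm c x
  obtain ⟨K'', hK''⟩ := exists_lipschitzWith_femFun c L m x
  have hsupp : HasCompactSupport fun y => femFun c L m x y * femFun c L m x y :=
    (hasCompactSupport_femFun hL hm c x).mul_left
  rw [LipschitzWith.integral_lineDeriv_mul_eq hf hK' hsupp v, ← integral_neg]
  refine integral_congr_ae ?_
  filter_upwards [hK''.ae_differentiableAt] with y hy
  have h : HasFDerivAt (fun y => femFun c L m x y * femFun c L m x y)
      (femFun c L m x y • fderiv ℝ (femFun c L m x) y +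
        femFun c L m x y • fderiv ℝ (femFun c L m x) y) y := hy.hasFDerivAt.mul hy.hasFDerivAt
  rw [h.differentiableAt.lineDeriv_eq_fderiv, h.fderiv]
  simp
  ring

theorem integrable_lineDeriv_mul_femFun_sq {L : ℝ} (hL : 0 < L) {m : ℕ} (hm : 1 ≤ m) (c : ℝ × ℝ)
    (x : Idx m → ℝ) {f : ℝ × ℝ → ℝ} {K : NNReal} (hf : LipschitzWith K f) (v : ℝ × ℝ) :
    Integrable fun y => lineDeriv ℝ f y v * (femFun c L m x y * femFun c L m x y) := by
  have hcont := continuous_femFun c L m x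
  have h1 : Integrable fun y => femFun c L m x y * femFun c L m x y :=
    (hcont.mul hcont).integrable_of_hasCompactSupport
      (hasCompactSupport_femFun hL hm c x).mul_left
  exact h1.bdd_mul (aestronglyMeasurable_lineDeriv hf.continuous volume)
    (Filter.Eventually.of_forall fun y => norm_lineDeriv_le_of_lipschitz ℝ hf)

theorem integrable_femFun_mul_fderiv {L : ℝ} (hL : 0 < L) {m : ℕ} (hm : 1 ≤ m) (c : ℝ × ℝ)
    (x : Idx m → ℝ) {f : ℝ × ℝ → ℝ} (hf : Continuous f) (v : ℝ × ℝ) :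
    Integrable fun y => 2 * (femFun c L m x y * fderiv ℝ (femFun c L m x) y v * f y) := by
  obtain ⟨K, hK⟩ := exists_lipschitzWith_femFun c L m x
  have hcont := continuous_femFun c L m x
  have h1 : Integrable fun y => femFun c L m x y * f y :=
    (hcont.mul hf).integrable_of_hasCompactSupport
      (hasCompactSupport_femFun hL hm c x).mul_right
  have h2 := h1.bdd_mul (aestronglyMeasurable_lineDeriv hcont volume (𝕜 := ℝ) (v := v))
    (Filter.Eventually.of_forall fun y => norm_lineDeriv_le_of_lipschitz ℝ hK)
  refine (h2.const_mul 2).congr ?_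
  filter_upwards [hK.ae_differentiableAt] with y hy
  rw [hy.lineDeriv_eq_fderiv]
  ring

theorem divergence_eq_lineDeriv {c : ℝ × ℝ} {L : ℝ} {b : ℝ × ℝ → ℝ × ℝ}
    (hb : ContDiffOn ℝ 1 b (closedHexagon c L)) {f₁ f₂ : ℝ × ℝ → ℝ}
    (h1 : Set.EqOn (fun y => (b y).1) f₁ (closedHexagon c L))
    (h2 : Set.EqOn (fun y => (b y).2) f₂ (closedHexagon c L)) {y : ℝ × ℝ} (hy : y ∈ hexagon c L) :
    lineDeriv ℝ f₁ y (1, 0) + lineDeriv ℝ f₂ y (0, 1) = divergence b y := by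
  have hnhds : hexagon c L ∈ nhds y := (isOpen_hexagon c L).mem_nhds hy
  have hsub := hexagon_subset_closedHexagon c L
  have hdiff : DifferentiableAt ℝ b y :=
    ((hb.differentiableOn one_ne_zero).mono hsub).differentiableAt hnhds
  have d1 : HasFDerivAt f₁ ((ContinuousLinearMap.fst ℝ ℝ ℝ).comp (fderiv ℝ b y)) y :=
    hdiff.hasFDerivAt.fst.congr_of_eventuallyEq
      (Filter.eventually_of_mem hnhds fun z hz => (h1 (hsub hz)).symm)
  have d2 : HasFDerivAt f₂ ((ContinuousLinearMap.snd ℝ ℝ ℝ).comp (fderiv ℝ b y)) y :=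
    hdiff.hasFDerivAt.snd.congr_of_eventuallyEq
      (Filter.eventually_of_mem hnhds fun z hz => (h2 (hsub hz)).symm)
  rw [d1.differentiableAt.lineDeriv_eq_fderiv, d2.differentiableAt.lineDeriv_eq_fderiv,
    d1.fderiv, d2.fderiv]
  rfl

open Matrix in
/-- The quadratic form of the exact convection matrix is `1/2 ∫ div b u²`, hence nonnegative. -/
theorem convectionMatrix_form_nonneg {L : ℝ} (hL : 0 < L) {m : ℕ} (hm : 1 ≤ m) (c : ℝ × ℝ)
    {b : ℝ × ℝ → ℝ × ℝ} (hb : ContDiffOn ℝ 1 b (closedHexagon c L))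
    (hdiv : ∀ y ∈ hexagon c L, 0 ≤ divergence b y) (x : Idx m → ℝ) :
    0 ≤ x ⬝ᵥ (convectionMatrix c L b m *ᵥ x) := by
  obtain ⟨K, hK⟩ := exists_lipschitzOnWith_closedHexagon hL hb
  -- Lipschitz extensions of the components of `b` to the whole plane
  obtain ⟨f₁, hf₁, he₁⟩ := (LipschitzWith.prod_fst.comp_lipschitzOnWith hK).extend_real
  obtain ⟨f₂, hf₂, he₂⟩ := (LipschitzWith.prod_snd.comp_lipschitzOnWith hK).extend_real
  have hu0 : ∀ y, y ∉ hexagon c L → femFun c L m x y = 0 := fun y hy =>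
    femFun_eq_zero_of_notMem_hexagon hL hm c x hy
  have hsub := hexagon_subset_closedHexagon c L
  have hi1 := integrable_femFun_mul_fderiv hL hm c x hf₁.continuous (1, 0)
  have hi2 := integrable_femFun_mul_fderiv hL hm c x hf₂.continuous (0, 1)
  have hi12 : Integrable fun y =>
      2 * (femFun c L m x y * fderiv ℝ (femFun c L m x) y (1, 0) * f₁ y) +
      2 * (femFun c L m x y * fderiv ℝ (femFun c L m x) y (0, 1) * f₂ y) := hi1.add hi2
  have hform : x ⬝ᵥ (convectionMatrix c L b m *ᵥ x) =
      -((1 / 2 : ℝ) * ((∫ y, 2 * (femFun c L m x y * fderiv ℝ (femFun c L m x) y (1, 0) * f₁ y)) +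
        ∫ y, 2 * (femFun c L m x y * fderiv ℝ (femFun c L m x) y (0, 1) * f₂ y))) := by
    rw [convectionMatrix_form hL hm c hb.continuousOn]
    congr 1
    rw [← integral_add hi1 hi2, ← setIntegral_eq_integral_of_forall_compl_eq_zero
      (s := hexagon c L) (fun y hy => by rw [hu0 y hy]; ring),
      setIntegral_hexagon hL hm c (fun T _ => hi12.integrableOn), Finset.mul_sum]
    refine Finset.sum_congr rfl fun T hT => ?_
    rw [← integral_const_mul]
    refine setIntegral_congr_fun (isOpen_openTri c L m T).measurableSet fun y hy => ?_
    have hyc := triSet_subset_closedHexagon hL hm c hT (openTri_subset_triSet hL hm c T hy)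
    have g1 : f₁ y = (b y).1 := (he₁ hyc).symm
    have g2 : f₂ y = (b y).2 := (he₂ hyc).symm
    rw [g1, g2, ← (grad_femFun hL hm c hy x).2, grad, dot]
    ring
  have hparts : 0 ≤ (∫ y, lineDeriv ℝ f₁ y (1, 0) * (femFun c L m x y * femFun c L m x y)) +
      ∫ y, lineDeriv ℝ f₂ y (0, 1) * (femFun c L m x y * femFun c L m x y) := by
    rw [← integral_add (integrable_lineDeriv_mul_femFun_sq hL hm c x hf₁ _)
      (integrable_lineDeriv_mul_femFun_sq hL hm c x hf₂ _)]
    refine integral_nonneg fun y => ?_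
    by_cases hy : y ∈ hexagon c L
    · simp only [Pi.zero_apply]
      rw [← add_mul, divergence_eq_lineDeriv hb he₁ he₂ hy]
      exact mul_nonneg (hdiv y hy) (mul_self_nonneg _)
    · simp [hu0 y hy]
  rw [integral_lineDeriv_mul_femFun_sq hL hm c x hf₁,
    integral_lineDeriv_mul_femFun_sq hL hm c x hf₂] at hparts
  rw [hform]
  linarith

/-! ### Matrices assembled by quadrature -/

/-- The diffusion matrix computed by quadrature is assembled with the quadrature values of the
coefficient. -/
theorem diffusionMatrixQ_isAssembled (Q : QuadratureFamily) {L : ℝ} (hL : 0 < L) {m : ℕ}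
    (hm : 1 ≤ m) (c : ℝ × ℝ) (a : ℝ × ℝ → ℝ) :
    IsAssembled L m (fun T => ∑ k, Q.weight m T k * a (Q.point m T k))
      (diffusionMatrixQ Q c L a m) := by
  intro i j
  rw [diffusionMatrixQ, Matrix.of_apply]
  refine Finset.sum_congr rfl fun T _ => ?_
  rw [QuadratureFamily.apply, hatGrad_eq hL hm, hatGrad_eq hL hm, mul_assoc, Finset.sum_mul]
  congr 1
  exact Finset.sum_congr rfl fun k _ => by ring

/-- Since the constant function `1` is integrated with error `O(h²)`, the weights add up to
`1 + O(h²)`. -/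
theorem QuadratureFamily.HasErrorOrderTwo.exists_weight_bounds {Q : QuadratureFamily} {c : ℝ × ℝ}
    {L : ℝ} (hL : 0 < L) (h : Q.HasErrorOrderTwo c L) :
    ∃ W Cw : ℝ, 1 ≤ W ∧ 0 ≤ Cw ∧ ∀ m, 1 ≤ m → ∀ T ∈ triangles m,
      ∑ k, |Q.weight m T k| ≤ W ∧ |∑ k, Q.weight m T k - 1| ≤ Cw * meshSize L m := by
  obtain ⟨-, ⟨W, hW⟩, herr⟩ := h
  obtain ⟨C, hC⟩ := herr (fun _ => 1) contDiffOn_const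
  refine ⟨max W 1, |C| * L, le_max_right _ _, by positivity, fun m hm T hT =>
    ⟨(hW m hm T hT).trans (le_max_left _ _), ?_⟩⟩
  have h1 := hC m hm T hT
  have hA := triArea_pos hL hm
  have hh := meshSize_pos hL hm
  have hhL : meshSize L m ≤ L := div_le_self hL.le (by exact_mod_cast hm)
  rw [setIntegral_congr_set (triSet_ae_eq_openTri hL hm c T), setIntegral_openTri_const hL hm,
    QuadratureFamily.apply, ← mul_sub, abs_mul, abs_of_pos hA, mul_comm (triArea L m),
    abs_sub_comm] at h1
  simp only [mul_one] at h1
  have h2 := le_of_mul_le_mul_right h1 hA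
  calc _ ≤ C * meshSize L m ^ 2 := h2
    _ ≤ |C| * meshSize L m ^ 2 := mul_le_mul_of_nonneg_right (le_abs_self C) (sq_nonneg _)
    _ = |C| * (meshSize L m * meshSize L m) := by ring
    _ ≤ |C| * (L * meshSize L m) := by gcongr
    _ = _ := by ring

/-- Quadrature values of a function which is `ε`-close to a constant. -/
theorem QuadratureFamily.abs_apply_sub_le (Q : QuadratureFamily) {L : ℝ} (hL : 0 < L) {m : ℕ}
    (hm : 1 ≤ m) {T : Tri} {f : ℝ × ℝ → ℝ} {r ε W e : ℝ} (hε : 0 ≤ ε)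
    (hf : ∀ k, |f (Q.point m T k) - r| ≤ ε) (hW : ∑ k, |Q.weight m T k| ≤ W)
    (he : |∑ k, Q.weight m T k - 1| ≤ e) :
    |Q.apply L m T f - triArea L m * r| ≤ triArea L m * (W * ε + e * |r|) := by
  have hA := triArea_pos hL hm
  have e1 : Q.apply L m T f - triArea L m * r = triArea L m *
      (∑ k, Q.weight m T k * (f (Q.point m T k) - r) + (∑ k, Q.weight m T k - 1) * r) := by
    simp only [QuadratureFamily.apply, mul_sub, Finset.sum_sub_distrib, ← Finset.sum_mul]
    ring
  rw [e1, abs_mul, abs_of_pos hA]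
  refine mul_le_mul_of_nonneg_left ((abs_add_le _ _).trans (add_le_add ?_ ?_)) hA.le
  · refine (Finset.abs_sum_le_sum_abs _ _).trans (le_trans ?_ (mul_le_mul_of_nonneg_right hW hε))
    rw [Finset.sum_mul]
    refine Finset.sum_le_sum fun k _ => ?_
    rw [abs_mul]
    exact mul_le_mul_of_nonneg_left (hf k) (abs_nonneg _)
  · rw [abs_mul]
    exact mul_le_mul_of_nonneg_right he (abs_nonneg _)

theorem QuadratureFamily.abs_apply_le (Q : QuadratureFamily) {L : ℝ} (hL : 0 < L) {m : ℕ}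
    (hm : 1 ≤ m) {T : Tri} {f : ℝ × ℝ → ℝ} {F W : ℝ} (hF : 0 ≤ F)
    (hf : ∀ k, |f (Q.point m T k)| ≤ F) (hW : ∑ k, |Q.weight m T k| ≤ W) :
    |Q.apply L m T f| ≤ triArea L m * (W * F) := by
  have h := Q.abs_apply_sub_le hL hm (r := 0) hF (by simpa using hf) hW le_rfl
  simpa using h

open Matrix in
theorem convectionMatrixQ_form (Q : QuadratureFamily) {L : ℝ} (hL : 0 < L) {m : ℕ} (hm : 1 ≤ m)
    (c : ℝ × ℝ) (b : ℝ × ℝ → ℝ × ℝ) (x : Idx m → ℝ) :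
    x ⬝ᵥ (convectionMatrixQ Q c L b m *ᵥ x) = -∑ T ∈ triangles m, Q.apply L m T fun y =>
      dot (b y) (interpGrad L m (zeroExt m x) T) * femFun c L m x y := by
  have hT : ∀ T : Tri, (Q.apply L m T fun y =>
      dot (b y) (interpGrad L m (zeroExt m x) T) * femFun c L m x y) =
      ∑ i, ∑ j, x i * x j * Q.apply L m T fun y =>
        dot (b y) (interpGrad L m (Pi.single i.1 1) T) * hat c L m j.1 y := by
    intro T
    simp only [QuadratureFamily.apply, Finset.mul_sum]
    rw [Finset.sum_congr rfl fun i _ => Finset.sum_comm, Finset.sum_comm]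
    refine Finset.sum_congr rfl fun k _ => ?_
    rw [← sum_smul_interpGrad_single, dot_comm, dot_sum_smul_left, femFun, Finset.sum_mul_sum,
      Finset.mul_sum, Finset.mul_sum]
    refine Finset.sum_congr rfl fun i _ => ?_
    rw [Finset.mul_sum, Finset.mul_sum]
    refine Finset.sum_congr rfl fun j _ => ?_
    rw [dot_comm]; ring
  simp only [hT]
  simp only [dotProduct, mulVec, convectionMatrixQ, of_apply, hatGrad_eq hL hm, Finset.mul_sum,
    neg_mul, mul_neg, Finset.sum_neg_distrib, Finset.sum_mul]
  congr 1
  rw [Finset.sum_congr rfl fun i _ => Finset.sum_comm, Finset.sum_comm]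
  refine Finset.sum_congr rfl fun T _ => Finset.sum_congr rfl fun i _ =>
    Finset.sum_congr rfl fun j _ => by ring

theorem dot_self_nonneg (g : ℝ × ℝ) : 0 ≤ dot g g := by
  simp only [dot]; nlinarith [sq_nonneg g.1, sq_nonneg g.2]

open Matrix in
/-- The convection form computed by quadrature is of lower order with respect to the energy. -/
theorem abs_convectionMatrixQ_form_le (Q : QuadratureFamily) {L : ℝ} (hL : 0 < L) {m : ℕ}
    (hm : 1 ≤ m) (c : ℝ × ℝ) {b : ℝ × ℝ → ℝ × ℝ} {B W : ℝ} (hW1 : 1 ≤ W)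
    (hB : ∀ y ∈ closedHexagon c L, ‖b y‖ ≤ B)
    (hpt : ∀ T ∈ triangles m, ∀ k, Q.point m T k ∈ triSet c L m T)
    (hW : ∀ T ∈ triangles m, ∑ k, |Q.weight m T k| ≤ W) (x : Idx m → ℝ) {η : ℝ} (hη : 0 < η) :
    |x ⬝ᵥ (convectionMatrixQ Q c L b m *ᵥ x)| ≤ η * energy m (zeroExt m x) +
      3 * B ^ 2 * W ^ 2 / η * (meshSize L m ^ 2 * ∑ i, x i ^ 2) := by
  have hW0 : 0 < W := by linarith
  rw [convectionMatrixQ_form Q hL hm c, abs_neg]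
  refine (sum_le_energy_add_mass hL hm x (p := η) (q := B ^ 2 * W ^ 2 / (2 * η)) hη.le
    (by positivity) fun T hT => ?_).trans (le_of_eq (by field_simp; ring))
  have hsub := triSet_subset_closedHexagon hL hm c hT
  have hV := triMass_nonneg (zeroExt m x) T
  have hg := dot_self_nonneg (interpGrad L m (zeroExt m x) T)
  -- Young's inequality at each quadrature point with parameter `η / W`, as the absolute weights sum to at most `W`
  have hη' : 0 < η / W := by positivity
  refine (Q.abs_apply_le hL hm (F := η / W *
    dot (interpGrad L m (zeroExt m x) T) (interpGrad L m (zeroExt m x) T) +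
    2 * B ^ 2 / (4 * (η / W)) * triMass (zeroExt m x) T) (by positivity) (fun k => ?_)
    (hW T hT)).trans (le_of_eq (by field_simp; ring))
  refine (abs_dot_mul_le _ _ hη' (femFun_sq_le hL hm c (hpt T hT k) x)).trans ?_
  have h1 := dot_self_le (hB _ (hsub (hpt T hT k)))
  gcongr

/-- On a triangle the integrand of the convection form varies by `O(h)` in terms of the gradient
and the vertex values of the finite element function. -/
theorem abs_convection_integrand_sub_le {L : ℝ} (hL : 0 < L) {m : ℕ} (hm : 1 ≤ m) (c : ℝ × ℝ)
    {b : ℝ × ℝ → ℝ × ℝ} {K : NNReal} (hK : LipschitzOnWith K b (closedHexagon c L)) {B : ℝ}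
    (hB : ∀ y ∈ closedHexagon c L, ‖b y‖ ≤ B) (x : Idx m → ℝ) {T : Tri} (hT : T ∈ triangles m)
    {y z : ℝ × ℝ} (hy : y ∈ triSet c L m T) (hz : z ∈ triSet c L m T) :
    |dot (b y) (interpGrad L m (zeroExt m x) T) * femFun c L m x y -
        dot (b z) (interpGrad L m (zeroExt m x) T) * femFun c L m x z| ≤
      meshSize L m * ((2 + 4 * B ^ 2) *
        dot (interpGrad L m (zeroExt m x) T) (interpGrad L m (zeroExt m x) T) +
        2 * K ^ 2 * triMass (zeroExt m x) T) := by
  have hh := meshSize_pos hL hm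
  have hsub := triSet_subset_closedHexagon hL hm c hT
  have hV := triMass_nonneg (zeroExt m x) T
  have hdiff := femFun_sub hL hm c hy hz x
  set g := interpGrad L m (zeroExt m x) T
  set V := triMass (zeroExt m x) T
  set h := meshSize L m
  have hg := dot_self_nonneg g
  have h1 : |dot (b y - b z) g * femFun c L m x y| ≤ h * dot g g + 2 * h * K ^ 2 * V := by
    refine (abs_dot_mul_le _ _ hh (femFun_sq_le hL hm c hy x)).trans ?_
    have h2 := dot_self_le (abs_sub_le_of_mem_triSet hL hm hK hT hy hz)
    have h3 : dot (b y - b z) (b y - b z) / (4 * h) ≤ 2 * h * K ^ 2 := by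
      rw [div_le_iff₀ (by positivity)]
      refine h2.trans (le_of_eq (by ring))
    exact add_le_add le_rfl (mul_le_mul_of_nonneg_right h3 hV)
  have h2 : |dot (b z) g * (femFun c L m x y - femFun c L m x z)| ≤
      h * dot g g + 4 * B ^ 2 * h * dot g g := by
    have hsq : (femFun c L m x y - femFun c L m x z) ^ 2 ≤ 8 * h ^ 2 * dot g g := by
      rw [hdiff]
      have h3 := dot_self_le (norm_sub_le_of_mem_triSet hL hm c hy hz)
      have h4 : dot g (y - z) ^ 2 ≤ dot g g * dot (y - z) (y - z) := by
        simp only [dot]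
        nlinarith [sq_nonneg (g.1 * (y - z).2 - g.2 * (y - z).1)]
      refine h4.trans ((mul_le_mul_of_nonneg_left h3 hg).trans (le_of_eq ?_))
      ring
    refine (abs_dot_mul_le _ _ hh hsq).trans ?_
    have h5 : dot (b z) (b z) / (4 * h) ≤ B ^ 2 / (2 * h) := by
      rw [div_le_div_iff₀ (by positivity) (by positivity)]
      have := dot_self_le (hB z (hsub hz))
      nlinarith
    refine add_le_add le_rfl ((mul_le_mul_of_nonneg_right h5 (by positivity)).trans (le_of_eq ?_))
    field_simp
    ring
  have e : dot (b y) g * femFun c L m x y - dot (b z) g * femFun c L m x z =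
      dot (b y - b z) g * femFun c L m x y +
        dot (b z) g * (femFun c L m x y - femFun c L m x z) := by
    simp only [dot, Prod.fst_sub, Prod.snd_sub]; ring
  rw [e]
  refine (abs_add_le _ _).trans ((add_le_add h1 h2).trans (le_of_eq (by ring)))

/-- Exact and quadrature values of a function which is `ε`-close to a constant on a triangle. -/
theorem QuadratureFamily.abs_setIntegral_sub_apply_le (Q : QuadratureFamily) {L : ℝ} (hL : 0 < L)
    {m : ℕ} (hm : 1 ≤ m) {c : ℝ × ℝ} {T : Tri} {f : ℝ × ℝ → ℝ} {r ε W e : ℝ}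
    (hint : IntegrableOn f (openTri c L m T))
    (hf : ∀ y ∈ triSet c L m T, |f y - r| ≤ ε)
    (hpt : ∀ k, Q.point m T k ∈ triSet c L m T) (hW : ∑ k, |Q.weight m T k| ≤ W)
    (he : |∑ k, Q.weight m T k - 1| ≤ e) :
    |(∫ y in openTri c L m T, f y) - Q.apply L m T f| ≤
      triArea L m * ((1 + W) * ε + e * |r|) := by
  have hε : 0 ≤ ε := (abs_nonneg _).trans (hf _ (node_mem_triSet c L m T 0))
  have i1 := abs_setIntegral_openTri_sub_le hL hm c hint fun y hy =>
    hf y (openTri_subset_triSet hL hm c T hy)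
  have i2 := Q.abs_apply_sub_le hL hm hε (fun k => hf _ (hpt k)) hW he
  rw [abs_le] at i1 i2 ⊢
  constructor <;> linarith

/-- The error of the quadrature formula for the convection form on one triangle. -/
theorem QuadratureFamily.abs_convection_error_le (Q : QuadratureFamily) {L : ℝ} (hL : 0 < L)
    {m : ℕ} (hm : 1 ≤ m) (c : ℝ × ℝ) {b : ℝ × ℝ → ℝ × ℝ} {K : NNReal}
    (hK : LipschitzOnWith K b (closedHexagon c L)) {B W Cw : ℝ} (hCw : 0 ≤ Cw)
    (hB : ∀ y ∈ closedHexagon c L, ‖b y‖ ≤ B) {T : Tri} (hT : T ∈ triangles m)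
    (hpt : ∀ k, Q.point m T k ∈ triSet c L m T) (hW : ∑ k, |Q.weight m T k| ≤ W)
    (he : |∑ k, Q.weight m T k - 1| ≤ Cw * meshSize L m) (x : Idx m → ℝ) :
    |(∫ y in openTri c L m T, dot (b y) (interpGrad L m (zeroExt m x) T) * femFun c L m x y) -
      Q.apply L m T fun y => dot (b y) (interpGrad L m (zeroExt m x) T) * femFun c L m x y| ≤
      triArea L m * (meshSize L m * ((1 + W) * (2 + 4 * B ^ 2) + Cw) *
          dot (interpGrad L m (zeroExt m x) T) (interpGrad L m (zeroExt m x) T) +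
        meshSize L m * ((1 + W) * (2 * K ^ 2) + Cw * B ^ 2) * triMass (zeroExt m x) T) := by
  have hh := meshSize_pos hL hm
  have hA := triArea_pos hL hm
  have hsub := triSet_subset_closedHexagon hL hm c hT
  have hv := node_mem_triSet c L m T 0
  have hint : IntegrableOn (fun y =>
      dot (b y) (interpGrad L m (zeroExt m x) T) * femFun c L m x y) (openTri c L m T) :=
    continuousOn_integrableOn_openTri hL hm c
      ((continuousOn_dot (hK.continuousOn.mono hsub) _).mul
        (continuous_femFun c L m x).continuousOn)
  refine (Q.abs_setIntegral_sub_apply_le hL hm hint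
    (fun y hy => abs_convection_integrand_sub_le hL hm c hK hB x hT hy hv) hpt hW he).trans
    (mul_le_mul_of_nonneg_left ?_ hA.le)
  have hr : |dot (b (node c L m (T.vertex 0))) (interpGrad L m (zeroExt m x) T) *
      femFun c L m x (node c L m (T.vertex 0))| ≤
      dot (interpGrad L m (zeroExt m x) T) (interpGrad L m (zeroExt m x) T) +
        B ^ 2 * triMass (zeroExt m x) T := by
    refine (abs_dot_mul_le _ _ one_pos (femFun_sq_le hL hm c hv x)).trans ?_
    rw [one_mul]
    refine add_le_add le_rfl (mul_le_mul_of_nonneg_right ?_ (triMass_nonneg _ _))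
    have := dot_self_le (hB _ (hsub hv))
    have := sq_nonneg B
    rw [div_le_iff₀ (by norm_num)]
    linarith
  refine (add_le_add le_rfl (mul_le_mul_of_nonneg_left hr
    (show 0 ≤ Cw * meshSize L m by positivity))).trans (le_of_eq (by ring))

open Matrix in
/-- The convection forms with exact integrals and with quadrature differ by `O(h)` times the
energy. -/
theorem abs_convectionMatrixQ_form_sub_le (Q : QuadratureFamily) {L : ℝ} (hL : 0 < L) {m : ℕ}
    (hm : 1 ≤ m) (c : ℝ × ℝ) {b : ℝ × ℝ → ℝ × ℝ} {K : NNReal}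
    (hK : LipschitzOnWith K b (closedHexagon c L)) {B W Cw : ℝ} (hW0 : 0 ≤ W) (hCw : 0 ≤ Cw)
    (hB : ∀ y ∈ closedHexagon c L, ‖b y‖ ≤ B)
    (hpt : ∀ T ∈ triangles m, ∀ k, Q.point m T k ∈ triSet c L m T)
    (hW : ∀ T ∈ triangles m, ∑ k, |Q.weight m T k| ≤ W ∧
      |∑ k, Q.weight m T k - 1| ≤ Cw * meshSize L m) (x : Idx m → ℝ) :
    |x ⬝ᵥ (convectionMatrixQ Q c L b m *ᵥ x) - x ⬝ᵥ (convectionMatrix c L b m *ᵥ x)| ≤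
      (((1 + W) * (2 + 4 * B ^ 2) + Cw) + 48 * L ^ 2 * ((1 + W) * (2 * K ^ 2) + Cw * B ^ 2)) *
        meshSize L m * energy m (zeroExt m x) := by
  have hh := meshSize_pos hL hm
  have hp0 : 0 ≤ meshSize L m * ((1 + W) * (2 + 4 * B ^ 2) + Cw) := by positivity
  have hq0 : 0 ≤ meshSize L m * ((1 + W) * (2 * (K : ℝ) ^ 2) + Cw * B ^ 2) := by positivity
  rw [convectionMatrixQ_form Q hL hm c, convectionMatrix_form hL hm c hK.continuousOn,
    neg_sub_neg, ← Finset.sum_sub_distrib]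
  have hpo := mul_le_mul_of_nonneg_left (meshSize_sq_mul_sum_sq_le (L := L) hm x)
    (mul_nonneg (show (0 : ℝ) ≤ 6 by norm_num) hq0)
  refine (sum_le_energy_add_mass hL hm x hp0 hq0 fun T hT =>
    Q.abs_convection_error_le hL hm c hK hCw hB hT (hpt T hT) (hW T hT).1
      (hW T hT).2 x).trans ((add_le_add le_rfl hpo).trans (le_of_eq (by ring)))

/-! ### Element weights of the two assembly procedures -/

theorem exists_norm_le_closedHexagon {F : Type*} [NormedAddCommGroup F] {f : ℝ × ℝ → F}
    {c : ℝ × ℝ} {L : ℝ} (hf : ContinuousOn f (closedHexagon c L)) :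
    ∃ B : ℝ, 0 ≤ B ∧ ∀ x ∈ closedHexagon c L, ‖f x‖ ≤ B := by
  obtain ⟨B, hB⟩ := (isCompact_closedHexagon c L).exists_bound_of_continuousOn hf
  exact ⟨max B 0, le_max_right _ _, fun x hx => (hB x hx).trans (le_max_left _ _)⟩

theorem node_vertex_mem_closedHexagon {L : ℝ} (hL : 0 < L) {m : ℕ} (hm : 1 ≤ m) (c : ℝ × ℝ)
    {T : Tri} (hT : T ∈ triangles m) (k : Fin 3) :
    node c L m (T.vertex k) ∈ closedHexagon c L :=
  triSet_subset_closedHexagon hL hm c hT (node_mem_triSet c L m T k)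

theorem le_average_openTri {L a₀ : ℝ} (hL : 0 < L) {m : ℕ} (hm : 1 ≤ m) (c : ℝ × ℝ)
    {a : ℝ × ℝ → ℝ} (ha : ContinuousOn a (closedHexagon c L))
    (ha₀ : ∀ x ∈ closedHexagon c L, a₀ ≤ a x) {T : Tri} (hT : T ∈ triangles m) :
    a₀ ≤ (∫ x in openTri c L m T, a x) / triArea L m := by
  have hsub := triSet_subset_closedHexagon hL hm c hT
  have hA := triArea_pos hL hm
  have hlt : volume (openTri c L m T) < ⊤ := by
    rw [volume_openTri hL hm c T]; exact ENNReal.ofReal_lt_top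
  rw [le_div_iff₀ hA, mul_comm, ← setIntegral_openTri_const hL hm c T a₀]
  exact setIntegral_mono_on (integrableOn_const hlt.ne)
    (continuousOn_integrableOn_openTri hL hm c (ha.mono hsub))
    (isOpen_openTri c L m T).measurableSet
    fun x hx => ha₀ x (hsub (openTri_subset_triSet hL hm c T hx))

/-- The element weights of the exact diffusion matrix are `O(h)`-close to the vertex values. -/
theorem abs_average_openTri_sub_le {L : ℝ} (hL : 0 < L) {m : ℕ} (hm : 1 ≤ m) {c : ℝ × ℝ}
    {a : ℝ × ℝ → ℝ} {K : NNReal} (ha : LipschitzOnWith K a (closedHexagon c L)) {T : Tri}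
    (hT : T ∈ triangles m) (k : Fin 3) :
    |(∫ x in openTri c L m T, a x) / triArea L m - a (node c L m (T.vertex k))| ≤
      2 * K * meshSize L m := by
  have hA := triArea_pos hL hm
  have hsub := triSet_subset_closedHexagon hL hm c hT
  have h := abs_setIntegral_openTri_sub_le hL hm c
    (continuousOn_integrableOn_openTri hL hm c (ha.continuousOn.mono hsub)) fun x hx =>
      abs_sub_le_of_mem_triSet hL hm ha hT (openTri_subset_triSet hL hm c T hx)
        (node_mem_triSet c L m T k)
  rw [div_sub' hA.ne', abs_div, abs_of_pos hA, div_le_iff₀ hA]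
  exact h

/-- The element weights of the diffusion matrix computed by quadrature are `O(h)`-close to the vertex
values; the second constant accounts for weights whose sum is not exactly `1`. -/
theorem QuadratureFamily.abs_sum_weight_mul_sub_le (Q : QuadratureFamily) {L : ℝ} (hL : 0 < L)
    {m : ℕ} (hm : 1 ≤ m) {c : ℝ × ℝ} {a : ℝ × ℝ → ℝ} {K : NNReal}
    (ha : LipschitzOnWith K a (closedHexagon c L)) {a₁ W Cw : ℝ} (hCw : 0 ≤ Cw)
    (ha₁ : ∀ x ∈ closedHexagon c L, ‖a x‖ ≤ a₁) {T : Tri} (hT : T ∈ triangles m)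
    (hpt : ∀ k, Q.point m T k ∈ triSet c L m T) (hW : ∑ k, |Q.weight m T k| ≤ W)
    (he : |∑ k, Q.weight m T k - 1| ≤ Cw * meshSize L m) (k : Fin 3) :
    |∑ l, Q.weight m T l * a (Q.point m T l) - a (node c L m (T.vertex k))| ≤
      (W * (2 * K) + Cw * a₁) * meshSize L m := by
  have hA := triArea_pos hL hm
  have hh := meshSize_pos hL hm
  have h := Q.abs_apply_sub_le hL hm (f := a) (r := a (node c L m (T.vertex k)))
    (show 0 ≤ 2 * K * meshSize L m by positivity)
    (fun l => abs_sub_le_of_mem_triSet hL hm ha hT (hpt l) (node_mem_triSet c L m T k)) hW he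
  rw [QuadratureFamily.apply, ← mul_sub, abs_mul, abs_of_pos hA] at h
  have h1 := mul_le_mul_of_nonneg_left
    (ha₁ _ (node_vertex_mem_closedHexagon hL hm c hT k))
    (show 0 ≤ Cw * meshSize L m by positivity)
  rw [Real.norm_eq_abs] at h1
  linarith [le_of_mul_le_mul_left h hA]

end HexFEM

end

open HexFEM Matrix in
theorem mainTheorem2 (c : ℝ × ℝ) (L : ℝ) (hL : 0 < L)
    (a : ℝ × ℝ → ℝ) (b : ℝ × ℝ → ℝ × ℝ) (a₀ : ℝ) (ha₀ : 0 < a₀)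
    (ha : ContDiffOn ℝ 2 a (HexFEM.closedHexagon c L))
    (ha_lower : ∀ x ∈ HexFEM.closedHexagon c L, a₀ ≤ a x)
    (hb : ContDiffOn ℝ 1 b (HexFEM.closedHexagon c L))
    (hb_div : ∀ x ∈ HexFEM.hexagon c L, 0 ≤ HexFEM.divergence b x) :
    -- exact integrals
    ((∀ m : ℕ, 1 ≤ m → (HexFEM.precond c L a m).PosDef ∧ (HexFEM.reA c L a b m).PosDef) ∧
      HexFEM.ProperlyClusteredAt
        (fun m => (HexFEM.precond c L a m)⁻¹ * HexFEM.reA c L a b m) 1 ∧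
      ∃ d D : ℝ, 0 < d ∧ ∀ m : ℕ, 1 ≤ m →
        HexFEM.EigsIn ((HexFEM.precond c L a m)⁻¹ * HexFEM.reA c L a b m) d D) ∧
    -- quadrature formulas with error of order two
    (∀ Q : HexFEM.QuadratureFamily, Q.HasErrorOrderTwo c L →
      (∃ m₀ : ℕ, ∀ m : ℕ, m₀ ≤ m →
        (HexFEM.precondQ Q c L a m).PosDef ∧ (HexFEM.reAQ Q c L a b m).PosDef) ∧
      HexFEM.ProperlyClusteredAt
        (fun m => (HexFEM.precondQ Q c L a m)⁻¹ * HexFEM.reAQ Q c L a b m) 1 ∧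
      ∃ d D : ℝ, 0 < d ∧ ∀ m : ℕ, 1 ≤ m →
        (HexFEM.precondQ Q c L a m).PosDef → (HexFEM.reAQ Q c L a b m).PosDef →
        HexFEM.EigsIn ((HexFEM.precondQ Q c L a m)⁻¹ * HexFEM.reAQ Q c L a b m) d D) := by
  obtain ⟨K, hK⟩ := exists_lipschitzOnWith_closedHexagon hL (ha.of_le one_le_two)
  obtain ⟨Kb, hKb⟩ := exists_lipschitzOnWith_closedHexagon hL hb
  obtain ⟨a₁, ha₁0, ha₁⟩ := exists_norm_le_closedHexagon ha.continuousOn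
  obtain ⟨B, hB0, hB⟩ := exists_norm_le_closedHexagon hb.continuousOn
  have hA0 : ∀ m, 1 ≤ m → ∀ T ∈ triangles m, ∀ k, a₀ ≤ a (node c L m (T.vertex k)) :=
    fun m hm T hT k => ha_lower _ (node_vertex_mem_closedHexagon hL hm c hT k)
  have hA1 : ∀ m, 1 ≤ m → ∀ T ∈ triangles m, ∀ k, a (node c L m (T.vertex k)) ≤ a₁ :=
    fun m hm T hT k =>
      (le_abs_self _).trans (ha₁ _ (node_vertex_mem_closedHexagon hL hm c hT k))
  have hS := fun m (hm : 1 ≤ m) => diffusionMatrix_one_isAssembled hL hm c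
  refine ⟨?_, fun Q hQ => ?_⟩
  · have hΘ := fun m (hm : 1 ≤ m) => diffusionMatrix_isAssembled hL hm c ha.continuousOn
    have hΘpos := fun m (hm : 1 ≤ m) => (hΘ m hm).posDef hL hm ha₀ fun T hT =>
      le_average_openTri hL hm c ha.continuousOn ha_lower hT
    have hPpos : ∀ m, 1 ≤ m → (precond c L a m).PosDef := fun m hm =>
      preconditioner_posDef (hΘpos m hm) ((hS m hm).posDef hL hm one_pos fun _ _ => le_rfl)
    have hRpos : ∀ m, 1 ≤ m → (reA c L a b m).PosDef := fun m hm => by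
      refine PosDef.of_dotProduct_mulVec_pos (hermPart_isHermitian _) fun x hx => ?_
      rw [star_trivial, reA, hermPart_form, add_mulVec, dotProduct_add]
      exact add_pos_of_pos_of_nonneg (by simpa using (hΘpos m hm).dotProduct_mulVec_pos hx)
        (convectionMatrix_form_nonneg hL hm c hb hb_div x)
    -- the constants of the convection form are `3 B²` and, as the exact form is nonnegative, `0`
    obtain ⟨-, hcluster, d, D, hd, hdD⟩ := spectral_conclusions hL ha₀ ha₁0
      (show (0 : ℝ) ≤ 2 * K by positivity) (show 0 ≤ 3 * B ^ 2 by positivity) le_rfl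
      (fun m p => a (node c L m p)) _ (fun m => diffusionMatrix c L a m)
      (fun m => diffusionMatrix c L (fun _ => 1) m) (fun m => convectionMatrix c L b m)
      hΘ hS hA0 hA1 (fun m hm T hT k => abs_average_openTri_sub_le hL hm hK hT k)
      (fun m hm x η hη _ => abs_convectionMatrix_form_le hL hm c hb.continuousOn hB x hη)
      (fun m hm x => by
        simpa using convectionMatrix_form_nonneg hL hm c hb hb_div x)
    exact ⟨fun m hm => ⟨hPpos m hm, hRpos m hm⟩, hcluster, d, D, hd,
      fun m hm => hdD m (hPpos m hm) (hRpos m hm)⟩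
  · obtain ⟨W, Cw, hW1, hCw, hW⟩ := hQ.exists_weight_bounds hL
    have hW0 : 0 ≤ W := zero_le_one.trans hW1
    have hpt := hQ.1
    -- the third constant is the distance of the quadrature convection form from the exact one
    obtain ⟨hpos, hcluster, d, D, hd, hdD⟩ := spectral_conclusions hL ha₀ ha₁0
      (show 0 ≤ W * (2 * K) + Cw * a₁ by positivity) (show 0 ≤ 3 * B ^ 2 * W ^ 2 by positivity)
      (show 0 ≤ ((1 + W) * (2 + 4 * B ^ 2) + Cw) +
        48 * L ^ 2 * ((1 + W) * (2 * (Kb : ℝ) ^ 2) + Cw * B ^ 2) by positivity)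
      (fun m p => a (node c L m p)) _ (fun m => diffusionMatrixQ Q c L a m)
      (fun m => diffusionMatrix c L (fun _ => 1) m) (fun m => convectionMatrixQ Q c L b m)
      (fun m hm => diffusionMatrixQ_isAssembled Q hL hm c a) hS hA0 hA1
      (fun m hm T hT k => Q.abs_sum_weight_mul_sub_le hL hm hK hCw ha₁ hT (hpt m hm T hT)
        (hW m hm T hT).1 (hW m hm T hT).2 k)
      (fun m hm x η hη _ => abs_convectionMatrixQ_form_le Q hL hm c hW1 hB (hpt m hm)
        (fun T hT => (hW m hm T hT).1) x hη)
      (fun m hm x => by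
        have h1 := (abs_le.1 (abs_convectionMatrixQ_form_sub_le Q hL hm c hKb hW0 hCw hB
          (hpt m hm) (hW m hm) x)).1
        have h2 := convectionMatrix_form_nonneg hL hm c hb hb_div x
        linarith)
    exact ⟨hpos, hcluster, d, D, hd, fun m _ => hdD m⟩
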